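/- **Conventions.** For $a\in\mathbb R^2$ put $a^\perp=(-a_2,a_1)$. For a bounded open set $E\subset\mathbb R^2$, $n$ is the unit outward normal, $\mathbf T=n^\perp$ the unit tangent, $\partial_{\mathbf T}$ the tangential derivative along $\partial E$; boundary integrals are with respect to arc length, derivatives $D_i$, $D^2_{ij}$ in $E$ are weak derivatives, and on $\partial E$ the gradient $\nabla u$ is understood in the sense of traces. $H^s(E)$, for real $s\ge 0$, is the Sobolev–Slobodeckij space of functions all of whose weak derivatives of order at most $\lfloor s\rfloor$ are in $L^2(E)$ and, if $\sigma=s-\lfloor s\rfloor>0$, whose derivatives $w$ of order $\lfloor s\rfloor$ satisfy $\int_E\int_E |w(x)-w(y)|^2|x-y|^{-2-2\sigma}\,dx\,dy<\infty$. **Part 1.** Let $E\subset\mathbb R^2$ be a bounded Lipschitz domain (near each boundary point, in suitable orthogonal coordinates, $E$ is the strict subgraph of a Lipschitz function whose graph is $\partial E$) which is piecewise $C^2$: $\partial E=\bigcup_{n=1}^N\overline{\Gamma_n}$, where each $\Gamma_n$ is Lebesgue null, where near each point of $\Gamma_n$, in suitable orthogonal coordinates, $E$ is the strict subgraph of a $C^2$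 function whose graph is $\Gamma_n$, and where $\partial E\setminus\bigcup_n\Gamma_n$ has zero length. Let $\beta:\partial E\to\mathbb R^2$ satisfy $|\beta|=1$ on each $\Gamma_n$ and be continuously differentiable along each $\Gamma_n$ with bounded tangential derivative. Let $s>5/2$ and $u,v\in H^s(E)$. Then the traces of $D_iu$, $D_iv$ exist almost everywhere on $\partial E$; the functions $\beta\cdot\nabla u$, $\beta^\perp\cdot\nabla u$, $\beta\cdot\nabla v$, $\beta^\perp\cdot\nabla v$ are in $L^2(\partial E)$ and have weak tangential derivatives on $\bigcup_n\Gamma_n$ that are in $L^2$; all integrands below are integrable; and $$\begin{aligned} &\int_E \left(D^2_{11}u\,D^2_{22}v+D^2_{22}u\,D^2_{11}v-2D^2_{12}u\,D^2_{12}v\right)\\ &\quad=\int_{\partial E}\left(\beta_1\partial_{\mathbf T}\beta_2-\beta_2\partial_{\mathbf T}\beta_1\right)\left(\beta^\perp\cdot\nabla u\;\beta^\perp\cdot\nabla v+\beta\cdot\nabla u\;\beta\cdot\nabla v\right)\\ &\qquad+\int_{\partial E}\left(\partial_{\mathbf T}(\beta^\perp\cdot\nabla u)\,\beta\cdot\nabla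 v-\partial_{\mathbf T}(\beta\cdot\nabla u)\,\beta^\perp\cdot\nabla v\right), \end{aligned}$$ and $$\begin{aligned} \int_E D^2u:D^2v&+\int_{\partial E}\left(\beta_1\partial_{\mathbf T}\beta_2-\beta_2\partial_{\mathbf T}\beta_1\right)\left(\beta^\perp\cdot\nabla u\;\beta^\perp\cdot\nabla v+\beta\cdot\nabla u\;\beta\cdot\nabla v\right)\\ &+\int_{\partial E}\left(\partial_{\mathbf T}(\beta^\perp\cdot\nabla u)\,\beta\cdot\nabla v-\partial_{\mathbf T}(\beta\cdot\nabla u)\,\beta^\perp\cdot\nabla v\right)=\int_E\Delta u\,\Delta v . \end{aligned}$$ **Part 2.** Let $\Omega\subset\mathbb R^2$ be a bounded $C^2$ domain, $\beta\in C^1(\partial\Omega;\mathbb S^1)$, $s>5/2$ and $u,v\in H^s(\Omega)$. Let $\Theta$ be the oblique angle, i.e. the anticlockwise oriented angle from $n$ to $\beta$ (defined modulo $2\pi$; $\partial_{\mathbf T}\Theta$ is the derivative of any local continuous branch), and let $\mathcal H_{\partial\Omega}=\nabla_{\mathbf T}\cdot n$ be the mean curvature. Then, everywhere on $\partial\Omega$,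 $$\beta_1\partial_{\mathbf T}\beta_2-\beta_2\partial_{\mathbf T}\beta_1=\partial_{\mathbf T}\Theta+\mathcal H_{\partial\Omega},$$ and the assertions of Part 1 (existence of the traces and of the weak tangential derivatives, now on all of $\partial\Omega$; integrability; both identities) hold for $E=\Omega$ with the coefficient $\beta_1\partial_{\mathbf T}\beta_2-\beta_2\partial_{\mathbf T}\beta_1$ replaced by $\partial_{\mathbf T}\Theta+\mathcal H_{\partial\Omega}$. -/

import Mathlib

open MeasureTheory Filter Topology Set
open scoped ContDiff

noncomputable section

/-- The Euclidean plane. -/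
abbrev Plane : Type := EuclideanSpace ℝ (Fin 2)

/-- Arc length: the one-dimensional Hausdorff measure on the plane. -/
def arcLength : Measure Plane := Measure.hausdorffMeasure 1

/-- Anticlockwise rotation by a right angle, `(v₁, v₂) ↦ (-v₂, v₁)`. -/
def perp (v : Plane) : Plane := !₂[-v 1, v 0]

/-! ### Domains -/

/-- Near `x`, in suitable orthogonal coordinates `y = c z`, the set `E` is the strict subgraph and
`Γ` is the graph of a function `φ` which has the regularity `P` on an open interval. -/
def IsGraphNear (P : (ℝ → ℝ) → Set ℝ → Prop) (E Γ : Set Plane) (x : Plane) : Prop :=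
  ∃ (c : Plane ≃ᵃⁱ[ℝ] Plane) (a b : ℝ) (φ : ℝ → ℝ),
    c x 0 ∈ Ioo (-a) a ∧ c x 1 ∈ Ioo (-b) b ∧
    P φ (Ioo (-a) a) ∧ (∀ t ∈ Ioo (-a) a, |φ t| ≤ b / 2) ∧
    ∀ z : Plane, c z 0 ∈ Ioo (-a) a → c z 1 ∈ Ioo (-b) b →
      (z ∈ E ↔ c z 1 < φ (c z 0)) ∧ (z ∈ Γ ↔ c z 1 = φ (c z 0))

/-- The boundary of `E` is locally the graph of a Lipschitz function, with `E` on one side. -/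
def HasLipschitzBoundary (E : Set Plane) : Prop :=
  ∀ x ∈ frontier E,
    IsGraphNear (fun φ I => ∃ K : NNReal, LipschitzOnWith K φ I) E (frontier E) x

/-- The boundary of `E` is locally the graph of a `C²` function, with `E` on one side. -/
def HasC2Boundary (E : Set Plane) : Prop :=
  ∀ x ∈ frontier E, IsGraphNear (fun φ I => ContDiffOn ℝ 2 φ I) E (frontier E) x

/-- The boundary of `E` is the union of the closures of the finitely many `C²` portions `Γ n`,
which cover it up to a set of zero length. -/
structure IsPiecewiseC2 (E : Set Plane) {N : ℕ} (Γ : Fin N → Set Plane) : Prop where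
  frontier_eq : frontier E = ⋃ n, closure (Γ n)
  volume_eq_zero : ∀ n, volume (Γ n) = 0
  graph : ∀ n, ∀ x ∈ Γ n, IsGraphNear (fun φ I => ContDiffOn ℝ 2 φ I) E (Γ n) x
  exceptional : arcLength (frontier E \ ⋃ n, Γ n) = 0

/-! ### Normal, tangent, classical tangential derivatives -/

/-- `ν` is the unit outward normal to `E` at `x`: to first order at `x`, `E` is the half-plane
`{y | ⟪y - x, ν⟫ < 0}`. -/
def IsOutwardNormal (E : Set Plane) (x ν : Plane) : Prop :=
  ‖ν‖ = 1 ∧ ∀ ε > 0, ∀ᶠ y in 𝓝 x,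
    (inner ℝ (y - x) ν < -ε * ‖y - x‖ → y ∈ E) ∧ (ε * ‖y - x‖ < inner ℝ (y - x) ν → y ∉ E)

open Classical in
/-- The unit outward normal `n` (which is unique where it exists; `0` elsewhere). -/
def outwardNormal (E : Set Plane) (x : Plane) : Plane :=
  if h : ∃ ν, IsOutwardNormal E x ν then h.choose else 0

/-- The unit tangent `T = (-n₂, n₁)`. -/
def unitTangent (E : Set Plane) (x : Plane) : Plane := perp (outwardNormal E x)

/-- The classical tangential derivative `∂_T f` at the boundary point `x`: the derivative of `f`
along the boundary in the direction `T`. -/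
def tangDeriv (E : Set Plane) (f : Plane → ℝ) (x : Plane) : ℝ :=
  fderivWithin ℝ f (frontier E) x (unitTangent E x)

/-- `β` is continuously differentiable on the boundary portion `Γ`. -/
def IsC1OnBoundary (E Γ : Set Plane) (β : Plane → Plane) : Prop :=
  ∀ i, (∀ x ∈ Γ, DifferentiableWithinAt ℝ (fun y => β y i) (frontier E) x) ∧
    ContinuousOn (tangDeriv E (fun y => β y i)) Γ

/-- The tangential gradient `∇f - (∇f · n) n = (∂_T f) T` of a function on the boundary. -/
def tangGrad (E : Set Plane) (f : Plane → ℝ) (x : Plane) : Plane :=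
  tangDeriv E f x • unitTangent E x

/-- The mean curvature `∇_T · n`. -/
def meanCurvature (E : Set Plane) (x : Plane) : ℝ :=
  ∑ i, tangGrad E (fun y => outwardNormal E y i) x i

/-- The oblique angle `Θ`, modulo `2π`: the anticlockwise oriented angle from the outward normal
to `β`, so that `β = cos Θ n + sin Θ T` when `β` is a unit vector. -/
def obliqueAngle (E : Set Plane) (β : Plane → Plane) (x : Plane) : Real.Angle :=
  (Complex.arg ⟨inner ℝ (β x) (outwardNormal E x), inner ℝ (β x) (unitTangent E x)⟩ : ℝ)

/-- The real-valued continuous branch near `x` of `Θ - Θ(x)`. -/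
def angleBranch (E : Set Plane) (β : Plane → Plane) (x y : Plane) : ℝ :=
  (obliqueAngle E β y - obliqueAngle E β x).toReal

/-- The tangential derivative `∂_T Θ` of the oblique angle (of any local continuous branch). -/
def angleTangDeriv (E : Set Plane) (β : Plane → Plane) (x : Plane) : ℝ :=
  tangDeriv E (angleBranch E β x) x

/-! ### Weak derivatives and Sobolev spaces of real order -/

/-- `g` is the weak partial derivative `D_i w` on the open set `E`. -/
def HasWeakPartial (E : Set Plane) (i : Fin 2) (w g : Plane → ℝ) : Prop :=
  LocallyIntegrableOn w E ∧ LocallyIntegrableOn g E ∧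
    ∀ φ : Plane → ℝ, ContDiff ℝ ∞ φ → HasCompactSupport φ → tsupport φ ⊆ E →
      ∫ x in E, w x * fderiv ℝ φ x (EuclideanSpace.single i 1) = -∫ x in E, g x * φ x

open Classical in
/-- The weak partial derivative `D_i w` on `E` (unique almost everywhere on `E`). -/
def weakPartial (E : Set Plane) (i : Fin 2) (w : Plane → ℝ) : Plane → ℝ :=
  if h : ∃ g, HasWeakPartial E i w g then h.choose else 0

/-- The weak second derivative `D²_ij w`. -/
def weakPartial₂ (E : Set Plane) (i j : Fin 2) (w : Plane → ℝ) : Plane → ℝ :=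
  weakPartial E i (weakPartial E j w)

/-- The square of the Gagliardo seminorm of order `σ ∈ (0, 1)` on `E`. -/
def gagliardoSq (E : Set Plane) (σ : ℝ) (w : Plane → ℝ) : ENNReal :=
  ∫⁻ x in E, ∫⁻ y in E, ENNReal.ofReal ((w x - w y) ^ 2 / ‖x - y‖ ^ (2 + 2 * σ))

/-- All weak derivatives of `w` of order at most `k` are in `L²(E)` and, if `σ ≠ 0`, those of
order `k` have a finite Gagliardo seminorm of order `σ`. -/
def MemSlobodeckij (E : Set Plane) (σ : ℝ) : ℕ → (Plane → ℝ) → Prop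
  | 0, w => MemLp w 2 (volume.restrict E) ∧ (σ = 0 ∨ gagliardoSq E σ w < ⊤)
  | k + 1, w => MemLp w 2 (volume.restrict E) ∧
      ∀ i, ∃ g, HasWeakPartial E i w g ∧ MemSlobodeckij E σ k g

/-- The Sobolev space `H^s(E)` of real order `s ≥ 0`. -/
def MemHs (E : Set Plane) (s : ℝ) (w : Plane → ℝ) : Prop :=
  MemSlobodeckij E (Int.fract s) ⌊s⌋₊ w

/-! ### Traces and weak tangential derivatives -/

/-- The trace of `w` at the boundary point `x` is `t`: the mean values of `w` over the portions
of `E` in small balls around `x` converge to `t`. -/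
def HasTraceAt (E : Set Plane) (w : Plane → ℝ) (x : Plane) (t : ℝ) : Prop :=
  Tendsto (fun r : ℝ => ⨍ y in Metric.ball x r ∩ E, w y) (𝓝[>] 0) (𝓝 t)

/-- The trace of `w` on the boundary of `E`. -/
def trace (E : Set Plane) (w : Plane → ℝ) (x : Plane) : ℝ :=
  limUnder (𝓝[>] 0) (fun r : ℝ => ⨍ y in Metric.ball x r ∩ E, w y)

/-- The gradient of `w` on the boundary of `E`. -/
def gradTrace (E : Set Plane) (w : Plane → ℝ) (x : Plane) : Plane :=
  !₂[trace E (weakPartial E 0 w) x, trace E (weakPartial E 1 w) x]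

/-- The directional derivative `b · ∇w` on the boundary of `E`. -/
def dirDeriv (E : Set Plane) (b : Plane → Plane) (w : Plane → ℝ) (x : Plane) : ℝ :=
  inner ℝ (b x) (gradTrace E w x)

/-- `g` is the weak tangential derivative `∂_T f` on the relatively open boundary part `Γ`. -/
def HasWeakTangDeriv (E Γ : Set Plane) (f g : Plane → ℝ) : Prop :=
  LocallyIntegrableOn f Γ arcLength ∧ LocallyIntegrableOn g Γ arcLength ∧
    ∀ φ : Plane → ℝ, ContDiff ℝ 1 φ → HasCompactSupport φ → tsupport φ ∩ frontier E ⊆ Γ →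
      ∫ x in Γ, f x * fderiv ℝ φ x (unitTangent E x) ∂arcLength
        = -∫ x in Γ, g x * φ x ∂arcLength

open Classical in
/-- The weak tangential derivative `∂_T f` on `Γ` (unique almost everywhere on `Γ`). -/
def weakTangDeriv (E Γ : Set Plane) (f : Plane → ℝ) : Plane → ℝ :=
  if h : ∃ g, HasWeakTangDeriv E Γ f g then h.choose else 0

/-! ### The terms of the identities -/

/-- The traces of the first derivatives of `w` exist at almost every boundary point, and
`β · ∇w` and `β^⊥ · ∇w` have square integrable weak tangential derivatives on `Γ`. -/
def BoundaryDerivativesExist (E Γ : Set Plane) (β : Plane → Plane) (w : Plane → ℝ) : Prop :=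
  (∀ i, ∀ᵐ x ∂(arcLength.restrict (frontier E)),
    HasTraceAt E (weakPartial E i w) x (trace E (weakPartial E i w) x)) ∧
  ∀ b ∈ ({β, fun x => perp (β x)} : Set (Plane → Plane)),
    MemLp (dirDeriv E b w) 2 (arcLength.restrict (frontier E)) ∧
    HasWeakTangDeriv E Γ (dirDeriv E b w) (weakTangDeriv E Γ (dirDeriv E b w)) ∧
    MemLp (weakTangDeriv E Γ (dirDeriv E b w)) 2 (arcLength.restrict (frontier E))

/-- `β₁ ∂_T β₂ - β₂ ∂_T β₁`. -/
def rotationRate (E : Set Plane) (β : Plane → Plane) (x : Plane) : ℝ :=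
  β x 0 * tangDeriv E (fun y => β y 1) x - β x 1 * tangDeriv E (fun y => β y 0) x

/-- `β^⊥·∇u β^⊥·∇v + β·∇u β·∇v`. -/
def zeroOrderTerm (E : Set Plane) (β : Plane → Plane) (u v : Plane → ℝ) (x : Plane) : ℝ :=
  dirDeriv E (fun y => perp (β y)) u x * dirDeriv E (fun y => perp (β y)) v x
    + dirDeriv E β u x * dirDeriv E β v x

/-- `∂_T(β^⊥·∇u) β·∇v - ∂_T(β·∇u) β^⊥·∇v`. -/
def firstOrderTerm (E Γ : Set Plane) (β : Plane → Plane) (u v : Plane → ℝ) (x : Plane) : ℝ :=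
  weakTangDeriv E Γ (dirDeriv E (fun y => perp (β y)) u) x * dirDeriv E β v x
    - weakTangDeriv E Γ (dirDeriv E β u) x * dirDeriv E (fun y => perp (β y)) v x

/-- `D²₁₁u D²₂₂v + D²₂₂u D²₁₁v - 2 D²₁₂u D²₁₂v`. -/
def mixedHessian (E : Set Plane) (u v : Plane → ℝ) (x : Plane) : ℝ :=
  weakPartial₂ E 0 0 u x * weakPartial₂ E 1 1 v x + weakPartial₂ E 1 1 u x * weakPartial₂ E 0 0 v x
    - 2 * (weakPartial₂ E 0 1 u x * weakPartial₂ E 0 1 v x)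

/-- `D²u : D²v`. -/
def hessianProduct (E : Set Plane) (u v : Plane → ℝ) (x : Plane) : ℝ :=
  ∑ i, ∑ j, weakPartial₂ E i j u x * weakPartial₂ E i j v x

/-- The weak Laplacian. -/
def weakLaplacian (E : Set Plane) (w : Plane → ℝ) (x : Plane) : ℝ :=
  ∑ i, weakPartial₂ E i i w x

end

/-!
The identities rest on one observation.  For `p` and `q` in `H¹(E)` the form
`∂₁p ∂₀q - ∂₀p ∂₁q` is a divergence, so its integral over `E` only sees the boundary: it equals the
integral over `∂E` of the trace of `q` times the tangential derivative of `p`.  Up to symmetry of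
second derivatives, the mixed Hessian of `u` and `v` is this form for `(D₁u, D₀v)` minus the form
for `(D₀u, D₁v)`.  Its integral is therefore the boundary integral of
`D₀v ∂_T D₁u - D₁v ∂_T D₀u`, and rewriting the gradients in the moving frame `(β, β^⊥)` with the
product rule (`IsBoundaryH1.mul`, `moving_frame_identity`) gives the right-hand side; this is
`hessian_identities`.  The second identity follows from the pointwise equality of `Δu Δv` with the
sum of `D²u : D²v` and the mixed Hessian.

The analysis is done in charts (`IsLipChart`) in which the boundary is the graph of a Lipschitz
function.  Two facts about such graphs are used throughout: the formula for arc length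
(`comap_graphCurve_arcLength`) and the existence of an outward normal almost everywhere
(`IsLipChart.ae_outwardNormal`).

*Traces.*  A function in `H¹(E)` is mollified with kernels that are shifted into `E`, so that
mollification commutes with weak derivatives up to the boundary.  By the trace inequality the
mollifications converge in `L²` of the boundary (`IsLipChart.exists_trace_limit`), and a Lebesgue
point argument identifies the limit with the trace almost everywhere (`IsLipChart.ae_hasTraceAt`).
Passing to the limit in the divergence theorem for smooth functions yields the Gauss–Green formula
(`MemH1.gaussGreen`).

*Tangential derivatives.*  Apply Gauss–Green to `q` and to the derivatives of the mollifications of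
`p`: their second derivatives cancel, and only `∇q` and boundary terms remain
(`MemH1.integral_cutPartial_mul`).  The boundary terms converge if the mollified derivatives of `p`
converge in `L²` of the boundary (`HasBoundaryLimit`).  For `p = D_i u` these are mollified second
derivatives of `u`, and this is where `s > 5/2` enters: either `u` has three square integrable
derivatives, or the second derivatives have a finite Gagliardo seminorm of order `σ > 1/2`, in which
case consecutive dyadic mollifications differ on the boundary by `O(2 ^ (-k (σ - 1/2)))`
(`IsLipChart.exists_limit_of_gagliardo`).  The result is a function in `L²(∂E)` that represents the
form for all `q` (`MemH1.exists_pairing`); taking smooth `q` shows that it is the weak tangential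
derivative of the trace of `p` (`MemH1.integral_trace_mul_tangent`).

*The oblique angle.*  Near a boundary point, the branch of the angle from the normal to `β` is the
arcsine of a function of `β` and the normal (`angleBranch_eq_arcsin`).  Differentiating along the
boundary curve gives the rotation rate of `β` minus that of the normal, which is the mean curvature
(`IsC2Portion.rotationRate_eq`).
-/

noncomputable section

section

/-! ### Graph coordinates -/

/-- The unit vector of the first coordinate axis of the frame `c`. -/
def horVec (c : Plane ≃ᵃⁱ[ℝ] Plane) : Plane :=
  c.linearIsometryEquiv.symm (EuclideanSpace.single 0 1)

/-- The unit vector of the second coordinate axis of the frame `c`. -/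
def upVec (c : Plane ≃ᵃⁱ[ℝ] Plane) : Plane :=
  c.linearIsometryEquiv.symm (EuclideanSpace.single 1 1)

/-- The point with first coordinate `t` at depth `τ` below the graph of `φ` in the frame `c`. -/
def graphMap (c : Plane ≃ᵃⁱ[ℝ] Plane) (φ : ℝ → ℝ) (q : ℝ × ℝ) : Plane :=
  c.symm !₂[q.1, φ q.1 - q.2]

/-- The graph of `φ` in the frame `c`, parametrised by the first coordinate. -/
def graphCurve (c : Plane ≃ᵃⁱ[ℝ] Plane) (φ : ℝ → ℝ) (t : ℝ) : Plane := graphMap c φ (t, 0)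

variable {c : Plane ≃ᵃⁱ[ℝ] Plane} {φ : ℝ → ℝ}

theorem norm_horVec : ‖horVec c‖ = 1 := by simp [horVec]

theorem norm_upVec : ‖upVec c‖ = 1 := by simp [upVec]

theorem inner_horVec_upVec : inner ℝ (horVec c) (upVec c) = 0 := by
  simp [horVec, upVec, LinearIsometryEquiv.inner_map_map, EuclideanSpace.inner_single_left]

theorem affine_symm_eq (x y : ℝ) :
    c.symm !₂[x, y] = c.symm 0 + x • horVec c + y • upVec c := by
  have h : (!₂[x, y] : Plane) = x • EuclideanSpace.single 0 1 + y • EuclideanSpace.single 1 1 := by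
    ext i; fin_cases i <;> simp
  have := c.symm.map_vadd 0 (!₂[x, y] : Plane)
  simp only [vadd_eq_add, add_zero] at this
  rw [this, h, map_add, map_smul, map_smul]
  have hs : c.symm.linearIsometryEquiv = c.linearIsometryEquiv.symm := rfl
  simp only [hs, horVec, upVec]
  abel

theorem graphMap_eq (q : ℝ × ℝ) :
    graphMap c φ q = c.symm 0 + q.1 • horVec c + (φ q.1 - q.2) • upVec c := affine_symm_eq _ _

theorem graphCurve_eq (t : ℝ) :
    graphCurve c φ t = c.symm 0 + t • horVec c + φ t • upVec c := by
  simp [graphCurve, graphMap_eq]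

theorem coord_graphMap_zero (q : ℝ × ℝ) : c (graphMap c φ q) 0 = q.1 := by
  simp [graphMap]

theorem coord_graphMap_one (q : ℝ × ℝ) : c (graphMap c φ q) 1 = φ q.1 - q.2 := by
  simp [graphMap]

theorem coord_graphCurve_zero (t : ℝ) : c (graphCurve c φ t) 0 = t := coord_graphMap_zero _

theorem coord_graphCurve_one (t : ℝ) : c (graphCurve c φ t) 1 = φ t := by
  simp [graphCurve, coord_graphMap_one]

theorem graphMap_coord (z : Plane) : graphMap c φ (c z 0, φ (c z 0) - c z 1) = z := by
  have : (!₂[c z 0, φ (c z 0) - (φ (c z 0) - c z 1)] : Plane) = c z := by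
    ext i; fin_cases i <;> simp
  simp only [graphMap]
  rw [this]; simp

theorem continuous_coord (i : Fin 2) : Continuous fun z => c z i :=
  (EuclideanSpace.proj (𝕜 := ℝ) i).continuous.comp c.continuous

/-- Graph coordinates as a homeomorphism. -/
def graphHomeo (c : Plane ≃ᵃⁱ[ℝ] Plane) (φ : ℝ → ℝ) (hφ : Continuous φ) : ℝ × ℝ ≃ₜ Plane where
  toFun := graphMap c φ
  invFun z := (c z 0, φ (c z 0) - c z 1)
  left_inv q := by ext <;> simp [coord_graphMap_zero, coord_graphMap_one]
  right_inv z := graphMap_coord z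
  continuous_toFun := by
    have : graphMap c φ
        = fun q => c.symm 0 + q.1 • horVec c + (φ q.1 - q.2) • upVec c := funext graphMap_eq
    rw [this]
    fun_prop
  continuous_invFun := (continuous_coord 0).prodMk
    ((hφ.comp (continuous_coord 0)).sub (continuous_coord 1))

theorem continuous_graphMap (hφ : Continuous φ) : Continuous (graphMap c φ) :=
  (graphHomeo c φ hφ).continuous

theorem measurableEmbedding_graphMap (hφ : Continuous φ) : MeasurableEmbedding (graphMap c φ) :=
  (graphHomeo c φ hφ).measurableEmbedding

theorem continuous_graphCurve (hφ : Continuous φ) : Continuous (graphCurve c φ) :=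
  (continuous_graphMap hφ).comp (by fun_prop)

theorem graphCurve_injective : Function.Injective (graphCurve c φ) := fun s t h => by
  rw [← coord_graphCurve_zero (c := c) (φ := φ) s, h, coord_graphCurve_zero]

theorem measurableEmbedding_graphCurve (hφ : Continuous φ) :
    MeasurableEmbedding (graphCurve c φ) :=
  (continuous_graphCurve hφ).measurableEmbedding graphCurve_injective

theorem measurePreserving_graphMap (hφ : Continuous φ) :
    MeasurePreserving (graphMap c φ) volume volume := by
  have h1 : MeasurePreserving (fun q : ℝ × ℝ => (q.1, φ q.1 - q.2)) (volume.prod volume)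
      (volume.prod volume) := by
    refine (MeasurePreserving.id (volume : Measure ℝ)).skew_product (g := fun x y => φ x - y) ?_ ?_
    · have := hφ.measurable; fun_prop
    · exact ae_of_all _ fun x => (Measure.measurePreserving_sub_left volume (φ x)).map_eq
  have h2 : MeasurePreserving (fun q : ℝ × ℝ => (![q.1, q.2] : Fin 2 → ℝ)) (volume.prod volume)
      volume := by
    have := (MeasureTheory.volume_preserving_finTwoArrow ℝ).symm
    exact this
  have h3 : MeasurePreserving (fun v : Fin 2 → ℝ => (WithLp.toLp 2 v : Plane)) volume volume :=
    PiLp.volume_preserving_toLp (Fin 2)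
  have h4 : MeasurePreserving (c.symm : Plane → Plane) volume volume := by
    have : (c.symm : Plane → Plane) = (fun z => c.symm 0 + z) ∘ c.linearIsometryEquiv.symm := by
      ext1 z
      have := c.symm.map_vadd 0 z
      simp only [vadd_eq_add, add_zero] at this
      have hs : c.symm.linearIsometryEquiv = c.linearIsometryEquiv.symm := rfl
      simp [this, add_comm, hs]
    rw [this]
    exact (measurePreserving_add_left volume _).comp
      (LinearIsometryEquiv.measurePreserving _)
  exact h4.comp (h3.comp (h2.comp h1))

theorem norm_sq_frame (x y : ℝ) : ‖x • horVec c + y • upVec c‖ ^ 2 = x ^ 2 + y ^ 2 := by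
  rw [norm_add_sq_real, norm_smul, norm_smul, norm_horVec, norm_upVec, inner_smul_left,
    inner_smul_right, inner_horVec_upVec]
  simp

theorem norm_frame (x y : ℝ) : ‖x • horVec c + y • upVec c‖ = √(x ^ 2 + y ^ 2) := by
  rw [← norm_sq_frame (c := c), Real.sqrt_sq (norm_nonneg _)]

theorem norm_frame_le (x y : ℝ) : ‖x • horVec c + y • upVec c‖ ≤ |x| + |y| := by
  refine (norm_add_le _ _).trans ?_
  simp [norm_smul, norm_horVec, norm_upVec]

theorem coord_sub (z w : Plane) (i : Fin 2) : c z i - c w i = c.linearIsometryEquiv (z - w) i := by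
  have := c.map_vsub z w
  simp only [vsub_eq_sub] at this
  rw [this]; simp

theorem abs_coord_sub_le (z w : Plane) (i : Fin 2) : |c z i - c w i| ≤ ‖z - w‖ := by
  rw [coord_sub, ← c.linearIsometryEquiv.norm_map (z - w)]
  exact PiLp.norm_apply_le (p := 2) (c.linearIsometryEquiv (z - w)) i

theorem sub_eq_frame (z w : Plane) :
    z - w = (c z 0 - c w 0) • horVec c + (c z 1 - c w 1) • upVec c := by
  apply c.linearIsometryEquiv.injective
  ext i
  rw [← coord_sub]
  fin_cases i <;> simp [horVec, upVec]

theorem coord_add_frame (z : Plane) (x y : ℝ) :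
    c (z + x • horVec c + y • upVec c) 0 = c z 0 + x ∧
      c (z + x • horVec c + y • upVec c) 1 = c z 1 + y := by
  have h : ∀ i, c (z + x • horVec c + y • upVec c) i
      = c z i + c.linearIsometryEquiv (x • horVec c + y • upVec c) i := fun i => by
    rw [← sub_eq_iff_eq_add', coord_sub,
      show z + x • horVec c + y • upVec c - z = x • horVec c + y • upVec c by abel]
  constructor
  · rw [h 0]; simp [horVec, upVec]
  · rw [h 1]; simp [horVec, upVec]

theorem lipschitzWith_graphCurve {K : NNReal} (hφ : LipschitzWith K φ) :
    LipschitzWith (1 + K) (graphCurve c φ) := by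
  refine LipschitzWith.of_dist_le_mul fun s t => ?_
  rw [dist_eq_norm, sub_eq_frame (c := c)]
  refine (norm_frame_le _ _).trans ?_
  simp only [coord_graphCurve_zero, coord_graphCurve_one]
  have := hφ.dist_le_mul s t
  rw [Real.dist_eq, Real.dist_eq] at *
  push_cast
  linarith

/-! ### Arc length of Lipschitz graphs -/

/-- The density of arc length along the graph of `φ`. -/
def graphSpeed (φ : ℝ → ℝ) (t : ℝ) : ℝ := √(1 + deriv φ t ^ 2)

theorem graphSpeed_pos (t : ℝ) : 0 < graphSpeed φ t := Real.sqrt_pos.2 (by positivity)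

theorem measurable_graphSpeed : Measurable (graphSpeed φ) := by
  have := measurable_deriv φ
  unfold graphSpeed; fun_prop

theorem abs_sqrt_one_add_sq_sub_le (x y : ℝ) : |√(1 + x ^ 2) - √(1 + y ^ 2)| ≤ |x - y| := by
  have hx := Real.sqrt_nonneg (1 + x ^ 2)
  have hy := Real.sqrt_nonneg (1 + y ^ 2)
  have hx2 := Real.sq_sqrt (show 0 ≤ 1 + x ^ 2 by positivity)
  have hy2 := Real.sq_sqrt (show 0 ≤ 1 + y ^ 2 by positivity)
  rw [← sq_le_sq]
  have : 1 + x * y ≤ √(1 + x ^ 2) * √(1 + y ^ 2) := by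
    rw [← Real.sqrt_mul (by positivity)]
    apply Real.le_sqrt_of_sq_le
    nlinarith [sq_nonneg (x - y)]
  nlinarith

theorem graphSpeed_le {K : NNReal} (hφ : LipschitzWith K φ) (t : ℝ) : graphSpeed φ t ≤ 1 + K := by
  have h1 : ‖deriv φ t‖ ≤ K := norm_deriv_le_of_lipschitz hφ
  have := abs_sqrt_one_add_sq_sub_le (deriv φ t) 0
  simp at this
  have h2 := le_abs_self (√(1 + deriv φ t ^ 2) - 1)
  rw [Real.norm_eq_abs] at h1
  unfold graphSpeed
  linarith

theorem dist_graphCurve (s t : ℝ) :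
    dist (graphCurve c φ s) (graphCurve c φ t) = √((s - t) ^ 2 + (φ s - φ t) ^ 2) := by
  rw [dist_eq_norm, sub_eq_frame (c := c), norm_frame]
  simp only [coord_graphCurve_zero, coord_graphCurve_one]

/-- On a set where `φ` is close to a linear function of slope `m`, the distance along the graph is
close to `√(1 + m²)` times the distance of the parameters. -/
theorem abs_dist_graphCurve_sub_le {m δ s t : ℝ} (h : |φ s - φ t - m * (s - t)| ≤ δ * |s - t|) :
    abs (dist (graphCurve c φ s) (graphCurve c φ t) - √(1 + m ^ 2) * |s - t|) ≤ δ * |s - t| := by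
  rcases eq_or_ne s t with rfl | hst
  · simp
  have hpos : 0 < |s - t| := abs_pos.2 (sub_ne_zero.2 hst)
  have e1 : dist (graphCurve c φ s) (graphCurve c φ t)
      = √(1 + ((φ s - φ t) / (s - t)) ^ 2) * |s - t| := by
    rw [dist_graphCurve, ← Real.sqrt_sq_eq_abs, ← Real.sqrt_mul (by positivity)]
    congr 1
    have : s - t ≠ 0 := sub_ne_zero.2 hst
    field_simp
  rw [e1, ← sub_mul, abs_mul, abs_abs]
  refine mul_le_mul_of_nonneg_right ((abs_sqrt_one_add_sq_sub_le _ _).trans ?_) hpos.le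
  rw [← mul_le_mul_iff_left₀ hpos, ← abs_mul]
  have : s - t ≠ 0 := sub_ne_zero.2 hst
  have e : ((φ s - φ t) / (s - t) - m) * (s - t) = φ s - φ t - m * (s - t) := by
    field_simp
  rw [e]
  exact h

/-- Two-sided comparison of arc length with the integral of the graph speed over a set on which `φ`
is `δ`-close to a linear function: there the graph curve, and the first coordinate as its inverse,
are Lipschitz with constants `l + δ` and `(l - δ)⁻¹`, where `l = √(1 + m²)`. -/
theorem arcLength_graphCurve_image_piece {A : Set ℝ} (hA : MeasurableSet A) {L : ℝ →L[ℝ] ℝ}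
    {δ : NNReal} (hδ : δ < 1) (hL : ApproximatesLinearOn φ L A δ)
    (hd : ∀ x ∈ A, DifferentiableAt ℝ φ x) :
    arcLength (graphCurve c φ '' A) ≤ (∫⁻ t in A, ENNReal.ofReal (graphSpeed φ t))
        + 2 * δ * volume A ∧
      (∫⁻ t in A, ENNReal.ofReal (graphSpeed φ t)) ≤ arcLength (graphCurve c φ '' A)
        + 2 * δ * volume A := by
  set m := L 1 with hm
  set l : NNReal := ⟨√(1 + m ^ 2), Real.sqrt_nonneg _⟩ with hl
  have hLx : ∀ x, L x = m * x := fun x => by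
    conv_lhs => rw [← mul_one x, ← smul_eq_mul, map_smul, smul_eq_mul, mul_comm]
  have hl1 : 1 ≤ l := by
    rw [← NNReal.coe_le_coe]
    change (1 : ℝ) ≤ √(1 + m ^ 2)
    rw [Real.one_le_sqrt]
    nlinarith [sq_nonneg m]
  have hdist : ∀ s ∈ A, ∀ t ∈ A,
      abs (dist (graphCurve c φ s) (graphCurve c φ t) - l * |s - t|) ≤ δ * |s - t| := by
    intro s hs t ht
    apply abs_dist_graphCurve_sub_le
    have := hL s hs t ht
    simpa [hLx, Real.norm_eq_abs] using this
  have hup : arcLength (graphCurve c φ '' A) ≤ (l + δ : NNReal) * volume A := by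
    have : LipschitzOnWith (l + δ) (graphCurve c φ) A := by
      refine LipschitzOnWith.of_dist_le_mul fun s hs t ht => ?_
      have := (abs_le.1 (hdist s hs t ht)).2
      rw [Real.dist_eq s t]; push_cast; linarith
    have h := this.hausdorffMeasure_image_le (d := 1) zero_le_one
    rw [hausdorffMeasure_real] at h
    simpa [arcLength] using h
  have hlow : (l - δ : NNReal) * volume A ≤ arcLength (graphCurve c φ '' A) := by
    have hpos : 0 < l - δ := tsub_pos_of_lt (hδ.trans_le hl1)
    -- The first coordinate inverts the graph curve.
    have : LipschitzOnWith (l - δ)⁻¹ (fun z => c z 0) (graphCurve c φ '' A) := by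
      refine LipschitzOnWith.of_dist_le_mul ?_
      rintro _ ⟨s, hs, rfl⟩ _ ⟨t, ht, rfl⟩
      simp only [coord_graphCurve_zero]
      have := (abs_le.1 (hdist s hs t ht)).1
      rw [Real.dist_eq s t, NNReal.coe_inv, ← div_eq_inv_mul, le_div_iff₀ (by exact_mod_cast hpos),
        NNReal.coe_sub (hδ.le.trans hl1)]
      linarith
    have h := this.hausdorffMeasure_image_le (d := 1) zero_le_one
    rw [hausdorffMeasure_real, image_image] at h
    simp only [coord_graphCurve_zero, image_id'] at h
    rw [ENNReal.rpow_one] at h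
    calc ((l - δ : NNReal) : ENNReal) * volume A
        ≤ (l - δ : NNReal) * ((((l - δ)⁻¹ : NNReal) : ENNReal) * arcLength (graphCurve c φ '' A)) := by
          gcongr; exact h
      _ = arcLength (graphCurve c φ '' A) := by
          rw [← mul_assoc, ← ENNReal.coe_mul, mul_inv_cancel₀ hpos.ne']; simp
  have hae : ∀ᵐ t ∂(volume.restrict A), |graphSpeed φ t - l| ≤ δ := by
    filter_upwards [hL.norm_fderiv_sub_le volume hA (fun x => fderiv ℝ φ x)
      (fun x hx => (hd x hx).hasFDerivAt.hasFDerivWithinAt)] with t ht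
    refine (abs_sqrt_one_add_sq_sub_le _ _).trans ?_
    have h2 := (fderiv ℝ φ t - L).le_opNorm 1
    have h3 : ‖fderiv ℝ φ t - L‖ ≤ δ := by exact_mod_cast ht
    simp only [sub_apply, norm_one, mul_one, fderiv_eq_smul_deriv, one_smul,
      Real.norm_eq_abs] at h2
    exact h2.trans h3
  constructor
  · refine hup.trans ?_
    calc ((l + δ : NNReal) : ENNReal) * volume A
        = ∫⁻ _ in A, ((l + δ : NNReal) : ENNReal) := by simp
      _ ≤ ∫⁻ t in A, (ENNReal.ofReal (graphSpeed φ t) + 2 * δ) := by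
          refine lintegral_mono_ae ?_
          filter_upwards [hae] with t ht
          have : (l + δ : NNReal) ≤ Real.toNNReal (graphSpeed φ t) + 2 * δ := by
            rw [← NNReal.coe_le_coe]
            push_cast
            rw [Real.coe_toNNReal _ (graphSpeed_pos t).le]
            linarith [(abs_le.1 ht).1]
          rw [ENNReal.ofReal]
          exact_mod_cast this
      _ = _ := by rw [lintegral_add_right _ measurable_const]; simp
  · calc ∫⁻ t in A, ENNReal.ofReal (graphSpeed φ t)
        ≤ ∫⁻ t in A, (((l - δ : NNReal) : ENNReal) + 2 * δ) := by
          refine lintegral_mono_ae ?_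
          filter_upwards [hae] with t ht
          have : Real.toNNReal (graphSpeed φ t) ≤ (l - δ : NNReal) + 2 * δ := by
            rw [← NNReal.coe_le_coe]
            push_cast
            rw [Real.coe_toNNReal _ (graphSpeed_pos t).le, NNReal.coe_sub (hδ.le.trans hl1)]
            linarith [(abs_le.1 ht).2]
          rw [ENNReal.ofReal]
          exact_mod_cast this
      _ = (l - δ : NNReal) * volume A + 2 * δ * volume A := by simp [add_mul]
      _ ≤ _ := by gcongr

/-- The comparison of `arcLength_graphCurve_image_piece`, summed over countably many pieces on each
of which `φ` is `δ`-close to a linear function. -/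
theorem arcLength_graphCurve_image_aux {K : NNReal} (hφ : LipschitzWith K φ) {A : Set ℝ}
    (hA : MeasurableSet A) (hd : ∀ x ∈ A, DifferentiableAt ℝ φ x) {δ : NNReal} (hδ0 : 0 < δ)
    (hδ : δ < 1) :
    arcLength (graphCurve c φ '' A) ≤ (∫⁻ t in A, ENNReal.ofReal (graphSpeed φ t))
        + 2 * δ * volume A ∧
      (∫⁻ t in A, ENNReal.ofReal (graphSpeed φ t)) ≤ arcLength (graphCurve c φ '' A)
        + 2 * δ * volume A := by
  obtain ⟨T, L, hdisj, hmeas, hcov, happ, -⟩ :=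
    exists_partition_approximatesLinearOn_of_hasFDerivWithinAt φ A (fun x => fderiv ℝ φ x)
      (fun x hx => (hd x hx).hasFDerivAt.hasFDerivWithinAt) (fun _ => δ) (fun _ => hδ0.ne')
  have hAT : ⋃ n, A ∩ T n = A := by rw [← inter_iUnion]; exact inter_eq_left.2 hcov
  have hm : ∀ n, MeasurableSet (A ∩ T n) := fun n => hA.inter (hmeas n)
  have hdis : Pairwise (Function.onFun Disjoint fun n => A ∩ T n) := fun i j hij =>
    (hdisj hij).mono inter_subset_right inter_subset_right
  have hemb := measurableEmbedding_graphCurve (c := c) hφ.continuous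
  have e1 : arcLength (graphCurve c φ '' A) = ∑' n, arcLength (graphCurve c φ '' (A ∩ T n)) := by
    conv_lhs => rw [← hAT, image_iUnion]
    refine measure_iUnion (fun i j hij => ?_) fun n => hemb.measurableSet_image.2 (hm n)
    exact (disjoint_image_iff graphCurve_injective).2 (hdis hij)
  have e2 : ∫⁻ t in A, ENNReal.ofReal (graphSpeed φ t)
      = ∑' n, ∫⁻ t in A ∩ T n, ENNReal.ofReal (graphSpeed φ t) := by
    conv_lhs => rw [← hAT]
    exact lintegral_iUnion hm hdis _
  have e3 : volume A = ∑' n, volume (A ∩ T n) := by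
    conv_lhs => rw [← hAT]
    exact measure_iUnion hdis hm
  have hp := fun n => arcLength_graphCurve_image_piece (c := c) (hm n) hδ (happ n)
    fun x hx => hd x hx.1
  rw [e1, e2, e3, ← ENNReal.tsum_mul_left, ← ENNReal.tsum_add, ← ENNReal.tsum_add]
  exact ⟨ENNReal.tsum_le_tsum fun n => (hp n).1, ENNReal.tsum_le_tsum fun n => (hp n).2⟩

/-- The arc length of a Lipschitz graph over a measurable set of parameters. -/
theorem comap_graphCurve_arcLength {K : NNReal} (hφ : LipschitzWith K φ) :
    Measure.comap (graphCurve c φ) arcLength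
      = volume.withDensity fun t => ENNReal.ofReal (graphSpeed φ t) := by
  have hemb := measurableEmbedding_graphCurve (c := c) hφ.continuous
  have hfin : ∀ A : Set ℝ, MeasurableSet A → volume A ≠ ⊤ →
      arcLength (graphCurve c φ '' A) = ∫⁻ t in A, ENNReal.ofReal (graphSpeed φ t) := by
    intro A hA hAf
    -- By Rademacher's theorem the parameters at which `φ` is not differentiable form a null set,
    -- and a Lipschitz curve maps it to a set of length zero.
    set D := {x | DifferentiableAt ℝ φ x}
    have hD : MeasurableSet D := measurableSet_of_differentiableAt ℝ φ
    have hN : volume (A \ D) = 0 := by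
      refine measure_mono_null (fun x hx => hx.2) (ae_iff.1 (hφ.ae_differentiableAt (μ := volume)))
    have h1 : arcLength (graphCurve c φ '' (A \ D)) = 0 := by
      have := (lipschitzWith_graphCurve (c := c) hφ).hausdorffMeasure_image_le (d := 1)
        zero_le_one (A \ D)
      rw [hausdorffMeasure_real, hN, mul_zero] at this
      exact le_antisymm this zero_le
    have h2 : arcLength (graphCurve c φ '' A) = arcLength (graphCurve c φ '' (A ∩ D)) := by
      refine le_antisymm ?_ (measure_mono (image_mono inter_subset_left))
      conv_lhs => rw [← inter_union_sdiff A D, image_union]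
      refine (measure_union_le _ _).trans ?_
      rw [h1, add_zero]
    have h3 : ∫⁻ t in A, ENNReal.ofReal (graphSpeed φ t)
        = ∫⁻ t in A ∩ D, ENNReal.ofReal (graphSpeed φ t) := by
      rw [← lintegral_inter_add_sdiff _ A hD, setLIntegral_measure_zero _ _ hN, add_zero]
    have hADf : volume (A ∩ D) ≠ ⊤ := measure_ne_top_of_subset inter_subset_left hAf
    rw [h2, h3]
    -- The error term `2 δ |A ∩ D|` vanishes as `δ → 0`.
    have key : ∀ x y : ENNReal, (∀ δ : NNReal, 0 < δ → δ < 1 →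
        x ≤ y + 2 * δ * volume (A ∩ D)) → x ≤ y := by
      intro x y h
      have ht : Tendsto (fun δ : NNReal => y + 2 * δ * volume (A ∩ D)) (𝓝[>] 0)
          (𝓝 (y + 2 * ((0 : NNReal) : ENNReal) * volume (A ∩ D))) := by
        refine Tendsto.add tendsto_const_nhds (ENNReal.Tendsto.mul_const ?_ (Or.inr hADf))
        refine ENNReal.Tendsto.const_mul ?_ (Or.inr (by simp))
        exact (ENNReal.tendsto_coe.2 tendsto_id).mono_left nhdsWithin_le_nhds
      simp only [ENNReal.coe_zero, mul_zero, zero_mul, add_zero] at ht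
      refine ge_of_tendsto ht ?_
      filter_upwards [Ioo_mem_nhdsGT (zero_lt_one (α := NNReal))] with δ hδ using h δ hδ.1 hδ.2
    have aux := fun δ h0 h1 => arcLength_graphCurve_image_aux (c := c) hφ (hA.inter hD)
      (fun x hx => hx.2) (δ := δ) h0 h1
    exact le_antisymm (key _ _ fun δ h0 h1 => (aux δ h0 h1).1)
      (key _ _ fun δ h0 h1 => (aux δ h0 h1).2)
  rw [Measure.ext_iff_of_iUnion_eq_univ (iUnion_spanningSets (volume : Measure ℝ))]
  intro i
  ext A hA
  rw [Measure.restrict_apply hA, Measure.restrict_apply hA, hemb.comap_apply,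
    withDensity_apply _ (hA.inter (measurableSet_spanningSets _ _))]
  exact hfin _ (hA.inter (measurableSet_spanningSets _ _))
    (measure_ne_top_of_subset inter_subset_right (measure_spanningSets_lt_top _ _).ne)

end

section

variable {c : Plane ≃ᵃⁱ[ℝ] Plane} {φ : ℝ → ℝ} {E : Set Plane} {K : NNReal} {a d : ℝ}

/-! ### The outward normal -/

theorem IsOutwardNormal.unique {x ν ν' : Plane} (h : IsOutwardNormal E x ν)
    (h' : IsOutwardNormal E x ν') : ν = ν' := by
  by_contra hne
  set w := ν' - ν with hw
  have hw0 : 0 < ‖w‖ := norm_pos_iff.2 (sub_ne_zero.2 (Ne.symm hne))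
  have hww : inner ℝ w ν' - inner ℝ w ν = ‖w‖ ^ 2 := by
    rw [← inner_sub_right, real_inner_self_eq_norm_sq]
  have hsum : inner ℝ w ν' + inner ℝ w ν = 0 := by
    rw [← inner_add_right, hw, real_inner_comm]
    exact (real_inner_add_sub_eq_zero_iff _ _).2 (by rw [h.1, h'.1])
  -- moving from `x` in the direction `ν' - ν` enters `E` according to `ν`, leaves it by `ν'`
  set ε := ‖w‖ / 4
  have hε : 0 < ε := by positivity
  have ht : Tendsto (fun s : ℝ => x + s • w) (𝓝[>] 0) (𝓝 x) := by
    have : Tendsto (fun s : ℝ => x + s • w) (𝓝 0) (𝓝 (x + (0 : ℝ) • w)) :=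
      (by fun_prop : Continuous fun s : ℝ => x + s • w).tendsto 0
    simp only [zero_smul, add_zero] at this
    exact this.mono_left nhdsWithin_le_nhds
  obtain ⟨s, ⟨h1, h2⟩, hs⟩ := ((ht.eventually ((h.2 ε hε).and (h'.2 ε hε))).and
    self_mem_nhdsWithin).exists
  have hs0 : (0 : ℝ) < s := hs
  simp only [add_sub_cancel_left, norm_smul, Real.norm_eq_abs, abs_of_pos hs0,
    inner_smul_left, RCLike.conj_to_real] at h1 h2
  refine h2.2 ?_ (h1.1 ?_)
  · have : inner ℝ w ν' = ‖w‖ ^ 2 / 2 := by linarith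
    rw [this]
    have : 0 < s * ‖w‖ ^ 2 := by positivity
    simp only [ε]; nlinarith
  · have : inner ℝ w ν = -(‖w‖ ^ 2 / 2) := by linarith
    rw [this]
    have : 0 < s * ‖w‖ ^ 2 := by positivity
    simp only [ε]; nlinarith

theorem IsOutwardNormal.outwardNormal_eq {x ν : Plane} (h : IsOutwardNormal E x ν) :
    outwardNormal E x = ν := by
  have hex : ∃ ν, IsOutwardNormal E x ν := ⟨ν, h⟩
  rw [outwardNormal, dif_pos hex]
  exact hex.choose_spec.unique h

/-- The unit vector orthogonal to the direction `(1, m)` in the frame `c`, pointing upwards. -/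
def slopeNormal (c : Plane ≃ᵃⁱ[ℝ] Plane) (m : ℝ) : Plane :=
  (√(1 + m ^ 2))⁻¹ • (upVec c - m • horVec c)

theorem inner_horVec_self : inner ℝ (horVec c) (horVec c) = 1 := by
  rw [real_inner_self_eq_norm_sq, norm_horVec, one_pow]

theorem inner_upVec_self : inner ℝ (upVec c) (upVec c) = 1 := by
  rw [real_inner_self_eq_norm_sq, norm_upVec, one_pow]

theorem inner_frame (x y x' y' : ℝ) :
    inner ℝ (x • horVec c + y • upVec c) (x' • horVec c + y' • upVec c) = x * x' + y * y' := by
  have h : inner ℝ (upVec c) (horVec c) = 0 := by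
    rw [real_inner_comm]; exact inner_horVec_upVec
  simp only [inner_add_left, inner_add_right, inner_smul_left, inner_smul_right,
    inner_horVec_self, inner_upVec_self, inner_horVec_upVec, h, RCLike.conj_to_real]
  ring

theorem slopeNormal_eq (m : ℝ) : slopeNormal c m
    = (-((√(1 + m ^ 2))⁻¹ * m)) • horVec c + (√(1 + m ^ 2))⁻¹ • upVec c := by
  rw [slopeNormal, smul_sub, smul_smul, neg_smul]; abel

theorem norm_slopeNormal (m : ℝ) : ‖slopeNormal c m‖ = 1 := by
  have h0 : 0 < √(1 + m ^ 2) := Real.sqrt_pos.2 (by positivity)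
  have h1 : √(1 + m ^ 2) ^ 2 = 1 + m ^ 2 := Real.sq_sqrt (by positivity)
  rw [slopeNormal_eq, norm_frame]
  rw [Real.sqrt_eq_one]
  field_simp
  rw [h1]; ring

theorem isOutwardNormal_slopeNormal {x : Plane} {m : ℝ} (hx : c x 1 = φ (c x 0))
    (hm : HasDerivAt φ m (c x 0)) (hE : ∀ᶠ y in 𝓝 x, (y ∈ E ↔ c y 1 < φ (c y 0))) :
    IsOutwardNormal E x (slopeNormal c m) := by
  refine ⟨norm_slopeNormal m, fun ε hε => ?_⟩
  have hlin := hm.isLittleO.def hε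
  have hlin' : ∀ᶠ y in 𝓝 x, ‖φ (c y 0) - φ (c x 0) - (c y 0 - c x 0) • m‖
      ≤ ε * ‖c y 0 - c x 0‖ :=
    ((continuous_coord (c := c) 0).tendsto x).eventually hlin
  filter_upwards [hlin', hE] with y hy hyE
  have h0 : 0 < √(1 + m ^ 2) := Real.sqrt_pos.2 (by positivity)
  have h1 : 1 ≤ √(1 + m ^ 2) := by rw [Real.one_le_sqrt]; nlinarith [sq_nonneg m]
  have hin : inner ℝ (y - x) (slopeNormal c m)
      = (√(1 + m ^ 2))⁻¹ * ((c y 1 - c x 1) - m * (c y 0 - c x 0)) := by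
    rw [sub_eq_frame (c := c), slopeNormal_eq, inner_frame]; ring
  have hle := abs_coord_sub_le (c := c) y x 0
  have hn := norm_nonneg (y - x)
  simp only [Real.norm_eq_abs, smul_eq_mul] at hy
  have hy2 : |φ (c y 0) - φ (c x 0) - (c y 0 - c x 0) * m| ≤ ε * ‖y - x‖ :=
    hy.trans (mul_le_mul_of_nonneg_left hle hε.le)
  have hy3 := abs_le.1 hy2
  have h4 : ε * ‖y - x‖ ≤ √(1 + m ^ 2) * (ε * ‖y - x‖) :=
    le_mul_of_one_le_left (by positivity) h1
  rw [hin, hyE, inv_mul_eq_div, div_lt_iff₀ h0, lt_div_iff₀ h0]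
  constructor
  · intro h; nlinarith
  · intro h; nlinarith

/-! ### Lipschitz charts -/

/-- In the frame `c` and for `|t| < a`, `|τ| < d`, the point at depth `τ` below the graph of `φ`
belongs to `E` exactly for `τ > 0` and to its boundary exactly for `τ = 0`. -/
structure IsLipChart (E : Set Plane) (c : Plane ≃ᵃⁱ[ℝ] Plane) (φ : ℝ → ℝ) (K : NNReal)
    (a d : ℝ) : Prop where
  lip : LipschitzWith K φ
  a_pos : 0 < a
  d_pos : 0 < d
  mem_iff : ∀ t τ, |t| < a → |τ| < d → (graphMap c φ (t, τ) ∈ E ↔ 0 < τ)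
  frontier_iff : ∀ t τ, |t| < a → |τ| < d → (graphMap c φ (t, τ) ∈ frontier E ↔ τ = 0)

/-- The region covered by a chart. -/
def chartBox (c : Plane ≃ᵃⁱ[ℝ] Plane) (φ : ℝ → ℝ) (a d : ℝ) : Set Plane :=
  {z | |c z 0| < a ∧ |φ (c z 0) - c z 1| < d}

theorem isOpen_chartBox (hφ : Continuous φ) : IsOpen (chartBox c φ a d) := by
  have h0 := continuous_coord (c := c) 0
  have h1 := continuous_coord (c := c) 1
  exact (isOpen_lt h0.abs continuous_const).inter
    (isOpen_lt ((hφ.comp h0).sub h1).abs continuous_const)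

theorem graphMap_mem_chartBox {q : ℝ × ℝ} :
    graphMap c φ q ∈ chartBox c φ a d ↔ |q.1| < a ∧ |q.2| < d := by
  simp [chartBox, coord_graphMap_zero, coord_graphMap_one]

/-- Where `E` is the subgraph of a continuous function, its boundary is the graph. -/
theorem graphMap_mem_frontier_iff (hφ : Continuous φ)
    (h : ∀ t τ, |t| < a → |τ| < d → (graphMap c φ (t, τ) ∈ E ↔ 0 < τ)) {t τ : ℝ} (ht : |t| < a)
    (hτ : |τ| < d) : graphMap c φ (t, τ) ∈ frontier E ↔ τ = 0 := by
  have hΦ := continuous_graphMap (c := c) hφ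
  have h0 := continuous_coord (c := c) 0
  have h1 := continuous_coord (c := c) 1
  have hbox : ∀ᶠ y in 𝓝 (graphMap c φ (t, τ)), y ∈ chartBox c φ a d :=
    (isOpen_chartBox hφ).mem_nhds (graphMap_mem_chartBox.2 ⟨ht, hτ⟩)
  have hmem : ∀ y ∈ chartBox c φ a d, (y ∈ E ↔ 0 < φ (c y 0) - c y 1) := by
    rintro y ⟨hy0, hy1⟩
    rw [← h _ _ hy0 hy1, graphMap_coord]
  have hval : φ (c (graphMap c φ (t, τ)) 0) - c (graphMap c φ (t, τ)) 1 = τ := by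
    rw [coord_graphMap_zero, coord_graphMap_one]; dsimp only; ring
  have hcont : Continuous fun y : Plane => φ (c y 0) - c y 1 := (hφ.comp h0).sub h1
  have htends := hcont.tendsto (graphMap c φ (t, τ))
  rw [hval] at htends
  constructor
  · intro hf
    by_contra hne
    rcases lt_or_gt_of_ne hne with hlt | hgt
    -- Points strictly above the graph have a neighbourhood outside `E`, points strictly below one
    -- inside `E`.
    · have hcl : ∃ᶠ y in 𝓝 (graphMap c φ (t, τ)), y ∈ E :=
        mem_closure_iff_frequently.1 (frontier_subset_closure hf)
      obtain ⟨y, hy, hyb, hyn⟩ := (hcl.and_eventually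
        (hbox.and (htends.eventually (gt_mem_nhds hlt)))).exists
      exact absurd ((hmem y hyb).1 hy) (not_lt.2 hyn.le)
    · have : E ∈ 𝓝 (graphMap c φ (t, τ)) := by
        filter_upwards [hbox, htends.eventually (lt_mem_nhds hgt)] with y hyb hyp
        exact (hmem y hyb).2 hyp
      exact hf.2 (mem_interior_iff_mem_nhds.2 this)
  -- A point of the graph is approached along the vertical line from both sides.
  · rintro rfl
    have hline : Tendsto (fun s : ℝ => graphMap c φ (t, s)) (𝓝 0) (𝓝 (graphMap c φ (t, 0))) :=
      (hΦ.comp (by fun_prop : Continuous fun s : ℝ => (t, s))).tendsto 0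
    have hsmall : ∀ᶠ s : ℝ in 𝓝 0, |s| < d := by
      have : Tendsto (fun s : ℝ => |s|) (𝓝 0) (𝓝 |0|) := continuous_abs.tendsto 0
      exact this.eventually (gt_mem_nhds hτ)
    rw [frontier_eq_closure_inter_closure]
    constructor
    · refine mem_closure_of_tendsto (hline.mono_left (nhdsWithin_le_nhds (s := Ioi 0))) ?_
      filter_upwards [nhdsWithin_le_nhds hsmall, self_mem_nhdsWithin] with s hs hs0
      exact (h t s ht hs).2 hs0
    · refine mem_closure_of_tendsto (hline.mono_left (nhdsWithin_le_nhds (s := Iio 0))) ?_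
      filter_upwards [nhdsWithin_le_nhds hsmall, self_mem_nhdsWithin] with s hs hs0
      intro hmem'
      exact absurd ((h t s ht hs).1 hmem') (not_lt.2 (le_of_lt hs0))

/-- A graph description yields a Lipschitz chart, with the point in the smaller box of a pair. The
function `φ₀` of the description is only controlled on an interval; the chart uses a Lipschitz
extension `φ` of it to the line. -/
theorem IsGraphNear.exists_isLipChart {P : (ℝ → ℝ) → Set ℝ → Prop} {Γ : Set Plane} {x : Plane}
    (h : IsGraphNear P E Γ x) (hP : ∀ φ I, P φ I → ∃ K : NNReal, LipschitzOnWith K φ I)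
    (hx : x ∈ Γ) :
    ∃ c φ₀ φ K a d a' d', IsLipChart E c φ K a d ∧ P φ₀ (Ioo (-a) a) ∧ EqOn φ₀ φ (Ioo (-a) a) ∧
      0 < a' ∧ 0 < d' ∧ a' < a ∧ d' < d ∧ x ∈ chartBox c φ a' d' ∧
      ∀ z ∈ chartBox c φ a d, (z ∈ Γ ↔ z ∈ frontier E) := by
  obtain ⟨c, a, b, φ₀, hx0, hx1, hPφ, hb, hiff⟩ := h
  obtain ⟨K, hK⟩ := hP _ _ hPφ
  obtain ⟨φ, hφ, heq⟩ := hK.extend_real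
  have ha : 0 < a := by have := hx0.1.trans hx0.2; linarith
  have hbp : 0 < b := by have := hx1.1.trans hx1.2; linarith
  have hbox : ∀ t τ, |t| < a → |τ| < b / 2 → c (graphMap c φ (t, τ)) 0 ∈ Ioo (-a) a ∧
      c (graphMap c φ (t, τ)) 1 ∈ Ioo (-b) b ∧ φ₀ t = φ t := by
    intro t τ ht hτ
    have ht' : t ∈ Ioo (-a) a := abs_lt.1 ht
    rw [coord_graphMap_zero, coord_graphMap_one]
    have h1 := hb t ht'
    rw [heq ht'] at h1
    have h1 := abs_le.1 h1
    have h2 := abs_lt.1 hτ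
    exact ⟨ht', ⟨by dsimp only; linarith [h1.1, h2.2], by dsimp only; linarith [h1.2, h2.1]⟩, heq ht'⟩
  have hxg := (hiff x hx0 hx1).2.1 hx
  rw [heq hx0] at hxg
  have hmem : ∀ t τ, |t| < a → |τ| < b / 2 → (graphMap c φ (t, τ) ∈ E ↔ 0 < τ) := by
    intro t τ ht hτ
    obtain ⟨h1, h2, h3⟩ := hbox t τ ht hτ
    rw [(hiff _ h1 h2).1, coord_graphMap_zero, coord_graphMap_one]
    dsimp only; rw [h3]; constructor <;> intro <;> linarith
  have hfr : ∀ t τ, |t| < a → |τ| < b / 2 → (graphMap c φ (t, τ) ∈ frontier E ↔ τ = 0) :=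
    fun t τ ht hτ => graphMap_mem_frontier_iff hφ.continuous hmem ht hτ
  obtain ⟨a', h1, h2⟩ := exists_between (show max |c x 0| 0 < a from max_lt (abs_lt.2 hx0) ha)
  -- The values of `φ₀` are at most `b / 2` in absolute value, so a depth less than `b / 2` keeps
  -- the point inside the cylinder of the graph description.
  refine ⟨c, φ₀, φ, K, a, b / 2, a', b / 4, ⟨hφ, ha, by positivity, hmem, hfr⟩, hPφ, heq,
    (le_max_right _ _).trans_lt h1, by positivity, h2, by linarith,
    ⟨(le_max_left _ _).trans_lt h1, by rw [hxg]; simpa using by positivity⟩, ?_⟩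
  rintro z ⟨hz0, hz1⟩
  have hg := graphMap_coord (c := c) (φ := φ) z
  obtain ⟨k1, k2, k3⟩ := hbox _ _ hz0 hz1
  have e1 := hfr _ _ hz0 hz1
  rw [hg] at k1 k2 e1
  rw [e1, (hiff z k1 k2).2, k3]
  constructor <;> intro <;> linarith

theorem exists_isLipChart (hE : HasLipschitzBoundary E) {x : Plane} (hx : x ∈ frontier E) :
    ∃ c φ K a d a' d', IsLipChart E c φ K a d ∧ 0 < a' ∧ 0 < d' ∧ a' < a ∧ d' < d ∧
      x ∈ chartBox c φ a' d' := by
  obtain ⟨c, -, φ, K, a, d, a', d', h, -, -, h1, h2, h3, h4, h5, -⟩ :=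
    (hE x hx).exists_isLipChart (fun _ _ h => h) hx
  exact ⟨c, φ, K, a, d, a', d', h, h1, h2, h3, h4, h5⟩

theorem IsGraphNear.mono {P P' : (ℝ → ℝ) → Set ℝ → Prop} {Γ : Set Plane} {x : Plane}
    (h : IsGraphNear P E Γ x) (hP : ∀ φ I, P φ I → P' φ I) : IsGraphNear P' E Γ x := by
  obtain ⟨c, a, b, φ, h1, h2, h3, h4⟩ := h
  exact ⟨c, a, b, φ, h1, h2, hP _ _ h3, h4⟩

/-- On a smaller interval, a `C²` function is also Lipschitz. -/
theorem IsGraphNear.lipschitz_and_c2 {Γ : Set Plane} {x : Plane}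
    (h : IsGraphNear (fun φ I => ContDiffOn ℝ 2 φ I) E Γ x) :
    IsGraphNear (fun φ I => (∃ K : NNReal, LipschitzOnWith K φ I) ∧ ContDiffOn ℝ 2 φ I) E Γ x := by
  obtain ⟨c, a, b, φ, hx0, hx1, hφ, hb, hiff⟩ := h
  obtain ⟨a', h1, h2⟩ := exists_between (abs_lt.2 hx0)
  have hsub : Ioo (-a') a' ⊆ Ioo (-a) a := Ioo_subset_Ioo (by linarith) h2.le
  have hsub' : Icc (-a') a' ⊆ Ioo (-a) a := Icc_subset_Ioo (by linarith) h2
  obtain ⟨K, hK⟩ := (hφ.mono hsub').exists_lipschitzOnWith (by norm_num) (convex_Icc _ _)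
    isCompact_Icc
  exact ⟨c, a', b, φ, abs_lt.1 h1, hx1, ⟨⟨K, hK.mono Ioo_subset_Icc_self⟩, hφ.mono hsub⟩,
    fun t ht => hb t (hsub ht), fun z hz0 hz1 => hiff z (hsub hz0) hz1⟩

theorem HasC2Boundary.hasLipschitzBoundary (h : HasC2Boundary E) : HasLipschitzBoundary E :=
  fun x hx => (h x hx).lipschitz_and_c2.mono fun _ _ h => h.1

namespace IsLipChart

variable (h : IsLipChart E c φ K a d)
include h

theorem continuous : Continuous φ := h.lip.continuous

theorem isOpen_chartBox : IsOpen (chartBox c φ a d) := _root_.isOpen_chartBox h.continuous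

theorem frontier_inter : frontier E ∩ chartBox c φ a d = graphCurve c φ '' Ioo (-a) a := by
  ext z
  obtain ⟨q, rfl⟩ := (graphHomeo c φ h.continuous).surjective z
  change graphMap c φ q ∈ _ ↔ graphMap c φ q ∈ _
  rw [mem_inter_iff, graphMap_mem_chartBox]
  constructor
  · rintro ⟨h1, h2, h3⟩
    have := (h.frontier_iff q.1 q.2 h2 h3).1 h1
    exact ⟨q.1, abs_lt.1 h2, by rw [graphCurve, ← this]⟩
  · rintro ⟨t, ht, htq⟩
    have : q = (t, 0) := ((graphHomeo c φ h.continuous).injective htq).symm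
    subst this
    exact ⟨(h.frontier_iff t 0 (abs_lt.2 ht) (by simpa using h.d_pos)).2 rfl, abs_lt.2 ht,
      by simpa using h.d_pos⟩

/-- Arc length on the boundary, in a chart. -/
theorem arcLength_restrict : arcLength.restrict (frontier E ∩ chartBox c φ a d)
    = Measure.map (graphCurve c φ) ((volume.restrict (Ioo (-a) a)).withDensity
        fun t => ENNReal.ofReal (graphSpeed φ t)) := by
  have hemb := measurableEmbedding_graphCurve (c := c) h.continuous
  have h1 := hemb.map_comap arcLength
  rw [comap_graphCurve_arcLength h.lip] at h1
  have hm : MeasurableSet (graphCurve c φ '' Ioo (-a) a) :=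
    hemb.measurableSet_image.2 measurableSet_Ioo
  rw [h.frontier_inter, ← inter_eq_left.2 (image_subset_range (graphCurve c φ) (Ioo (-a) a)),
    ← Measure.restrict_restrict hm, ← h1, hemb.restrict_map,
    preimage_image_eq _ graphCurve_injective, restrict_withDensity measurableSet_Ioo]

theorem ae_iff {p : Plane → Prop} :
    (∀ᵐ x ∂arcLength.restrict (frontier E ∩ chartBox c φ a d), p x) ↔
      ∀ᵐ t ∂volume.restrict (Ioo (-a) a), p (graphCurve c φ t) := by
  rw [h.arcLength_restrict, (measurableEmbedding_graphCurve h.continuous).ae_map_iff,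
    ae_withDensity_iff measurable_graphSpeed.ennreal_ofReal]
  refine eventually_congr (Eventually.of_forall fun t => ?_)
  simp [(graphSpeed_pos (φ := φ) t)]

theorem setIntegral_eq (f : Plane → ℝ) :
    ∫ x in frontier E ∩ chartBox c φ a d, f x ∂arcLength
      = ∫ t in Ioo (-a) a, graphSpeed φ t * f (graphCurve c φ t) := by
  rw [h.arcLength_restrict, (measurableEmbedding_graphCurve h.continuous).integral_map,
    integral_withDensity_eq_integral_toReal_smul measurable_graphSpeed.ennreal_ofReal
      (ae_of_all _ fun _ => ENNReal.ofReal_lt_top)]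
  refine integral_congr_ae (ae_of_all _ fun t => ?_)
  simp only [ENNReal.toReal_ofReal (graphSpeed_pos t).le, smul_eq_mul]

theorem arcLength_lt_top : arcLength (frontier E ∩ chartBox c φ a d) < ⊤ := by
  have := h.arcLength_restrict
  have h2 := congrArg (fun m => m univ) this
  simp only [Measure.restrict_apply_univ] at h2
  rw [h2, (measurableEmbedding_graphCurve h.continuous).map_apply, preimage_univ,
    withDensity_apply _ MeasurableSet.univ, setLIntegral_univ]
  refine (lintegral_mono (g := fun _ => ENNReal.ofReal (1 + K)) fun t => ?_).trans_lt ?_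
  · exact ENNReal.ofReal_le_ofReal (graphSpeed_le h.lip t)
  · simp [ENNReal.mul_lt_top_iff]

theorem memLp_comp {f : ℝ → ℝ} (hf : MemLp f 2 (volume.restrict (Ioo (-a) a))) :
    MemLp (fun x => f (c x 0)) 2 (arcLength.restrict (frontier E ∩ chartBox c φ a d)) := by
  rw [h.arcLength_restrict, (measurableEmbedding_graphCurve h.continuous).memLp_map_measure_iff]
  have : (fun x => f (c x 0)) ∘ graphCurve c φ = f := by
    ext t; simp [coord_graphCurve_zero]
  rw [this]
  refine MemLp.of_measure_le_smul (c := ENNReal.ofReal (1 + K)) (by simp) ?_ hf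
  rw [← withDensity_const]
  exact withDensity_mono (ae_of_all _ fun t => ENNReal.ofReal_le_ofReal (graphSpeed_le h.lip t))

theorem isOutwardNormal {t : ℝ} (ht : t ∈ Ioo (-a) a) (hd : DifferentiableAt ℝ φ t) :
    IsOutwardNormal E (graphCurve c φ t) (slopeNormal c (deriv φ t)) := by
  refine isOutwardNormal_slopeNormal (φ := φ) ?_ ?_ ?_
  · rw [coord_graphCurve_zero, coord_graphCurve_one]
  · rw [coord_graphCurve_zero]; exact hd.hasDerivAt
  · have : graphCurve c φ t ∈ chartBox c φ a d :=
      graphMap_mem_chartBox.2 ⟨abs_lt.2 ht, by simpa using h.d_pos⟩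
    filter_upwards [h.isOpen_chartBox.mem_nhds this] with y hy
    obtain ⟨q, rfl⟩ := (graphHomeo c φ h.continuous).surjective y
    change graphMap c φ q ∈ _ ↔ _
    have hq := graphMap_mem_chartBox.1 hy
    rw [h.mem_iff q.1 q.2 hq.1 hq.2]
    change _ ↔ c (graphMap c φ q) 1 < φ (c (graphMap c φ q) 0)
    rw [coord_graphMap_zero, coord_graphMap_one]
    constructor <;> intro <;> linarith

/-- The outward normal times the density of arc length is the vector `(-φ', 1)` in the frame of the
chart. -/
theorem ae_outwardNormal : ∀ᵐ t ∂volume.restrict (Ioo (-a) a),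
    graphSpeed φ t • outwardNormal E (graphCurve c φ t) = upVec c - deriv φ t • horVec c := by
  filter_upwards [ae_restrict_of_ae h.lip.ae_differentiableAt, ae_restrict_mem measurableSet_Ioo]
    with t ht ht'
  rw [(h.isOutwardNormal ht' ht).outwardNormal_eq, slopeNormal, smul_smul, graphSpeed,
    mul_inv_cancel₀, one_smul]
  exact (graphSpeed_pos t).ne'

end IsLipChart

theorem arcLength_frontier_lt_top (hE : HasLipschitzBoundary E) (hb : Bornology.IsBounded E) :
    arcLength (frontier E) < ⊤ := by
  have hc : IsCompact (frontier E) := hb.isCompact_closure.of_isClosed_subset isClosed_frontier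
    frontier_subset_closure
  refine hc.measure_lt_top_of_nhdsWithin fun x hx => ?_
  obtain ⟨c, φ, K, a, d, a', d', h, h0, h1, ha, hd, hxb⟩ := exists_isLipChart hE hx
  have hxb' : x ∈ chartBox c φ a d := ⟨hxb.1.trans ha, hxb.2.trans hd⟩
  exact ⟨frontier E ∩ chartBox c φ a d, inter_mem_nhdsWithin _ (h.isOpen_chartBox.mem_nhds hxb'),
    h.arcLength_lt_top⟩

/-! ### Localisation of test functions -/

/-- An additive property of compactly supported `C^m` functions holds as soon as it holds locally:
use a partition of unity. -/
theorem localise_test_functions {m : WithTop ℕ∞} (hm : m ≤ ∞) {Q : (Plane → ℝ) → Prop}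
    (h0 : Q 0)
    (hadd : ∀ f g, ContDiff ℝ m f → HasCompactSupport f → ContDiff ℝ m g → HasCompactSupport g →
      Q f → Q g → Q (f + g))
    (S : Set Plane)
    (hloc : ∀ x ∈ S, ∃ U, IsOpen U ∧ x ∈ U ∧
      ∀ f, ContDiff ℝ m f → HasCompactSupport f → tsupport f ⊆ U → Q f)
    {f : Plane → ℝ} (hf : ContDiff ℝ m f) (hfc : HasCompactSupport f) (hfS : tsupport f ⊆ S) :
    Q f := by
  choose! U hU hxU hQ using hloc
  obtain ⟨T, hTS, hT⟩ := hfc.elim_nhds_subcover U fun x hx =>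
    (hU x (hfS hx)).mem_nhds (hxU x (hfS hx))
  have hT2 : tsupport f ⊆ ⋃ i : T, U i := by
    intro y hy
    obtain ⟨x, hx, hyx⟩ := mem_iUnion₂.1 (hT hy)
    exact mem_iUnion.2 ⟨⟨x, hx⟩, hyx⟩
  obtain ⟨χ, hχ⟩ := SmoothPartitionOfUnity.exists_isSubordinate (modelWithCornersSelf ℝ Plane)
    (isClosed_tsupport f) (fun i : T => U i) (fun i => hU i (hfS (hTS i i.2))) hT2
  have hsum : f = ∑ i : T, fun y => χ i y * f y := by
    ext y
    rw [Finset.sum_apply, ← Finset.sum_mul]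
    by_cases hy : y ∈ tsupport f
    · have := χ.sum_eq_one hy
      rw [finsum_eq_sum_of_fintype] at this
      rw [this, one_mul]
    · rw [image_eq_zero_of_notMem_tsupport hy, mul_zero]
  have hχd : ∀ i : T, ContDiff ℝ m (χ i) := fun i => ((χ i).contMDiff.contDiff).of_le hm
  have key : ∀ s : Finset T, Q (∑ i ∈ s, fun y => χ i y * f y) ∧
      ContDiff ℝ m (∑ i ∈ s, fun y => χ i y * f y) ∧
      HasCompactSupport (∑ i ∈ s, fun y => χ i y * f y) := by
    classical
    intro s
    induction s using Finset.induction_on with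
    | empty => simpa using ⟨h0, contDiff_const (c := (0 : ℝ)), HasCompactSupport.zero⟩
    | insert i s hi ih =>
      rw [Finset.sum_insert hi]
      have h1 : ContDiff ℝ m fun y => χ i y * f y := (hχd i).mul hf
      have h2 : HasCompactSupport fun y => χ i y * f y := hfc.mul_left
      refine ⟨hadd _ _ h1 h2 ih.2.1 ih.2.2 (hQ i (hfS (hTS i i.2)) _ h1 h2 ?_) ih.1,
        h1.add ih.2.1, h2.add ih.2.2⟩
      exact (tsupport_mul_subset_left (f := χ i) (g := f)).trans (hχ i)
  rw [hsum]
  exact (key Finset.univ).1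

end

section

open scoped Convolution ENNReal

/-! ### Mean square estimates -/

theorem eLpNorm_two_sq {α : Type*} [MeasurableSpace α] (μ : Measure α) (f : α → ℝ) :
    eLpNorm f 2 μ ^ 2 = ∫⁻ x, ‖f x‖ₑ ^ 2 ∂μ := by
  have := eLpNorm_nnreal_pow_eq_lintegral (μ := μ) (f := f) (p := 2) two_ne_zero
  simp only [NNReal.coe_ofNat, ENNReal.coe_ofNat, ENNReal.rpow_ofNat] at this
  exact this

theorem lintegral_sq_le {α : Type*} [MeasurableSpace α] (μ : Measure α) {F : α → ℝ≥0∞}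
    (hF : AEMeasurable F μ) : (∫⁻ x, F x ∂μ) ^ 2 ≤ μ univ * ∫⁻ x, F x ^ 2 ∂μ := by
  have h := ENNReal.lintegral_mul_le_Lp_mul_Lq μ Real.HolderConjugate.two_two hF
    (aemeasurable_const (b := (1 : ℝ≥0∞)))
  simp only [Pi.mul_apply, mul_one, ENNReal.one_rpow, lintegral_const, one_mul] at h
  calc (∫⁻ x, F x ∂μ) ^ 2
      ≤ ((∫⁻ x, F x ^ (2 : ℝ) ∂μ) ^ (1 / 2 : ℝ) * μ univ ^ (1 / 2 : ℝ)) ^ 2 := by gcongr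
    _ = μ univ * ∫⁻ x, F x ^ 2 ∂μ := by
      rw [mul_pow, ← ENNReal.rpow_natCast, ← ENNReal.rpow_mul, ← ENNReal.rpow_natCast,
        ← ENNReal.rpow_mul]
      norm_num
      rw [mul_comm]

/-- Weighted Cauchy–Schwarz inequality. -/
theorem lintegral_mul_sq_le {α : Type*} [MeasurableSpace α] (μ : Measure α) {κ F : α → ℝ≥0∞}
    (hκ : Measurable κ) (hF : AEMeasurable F μ) :
    (∫⁻ x, κ x * F x ∂μ) ^ 2 ≤ (∫⁻ x, κ x ∂μ) * ∫⁻ x, κ x * F x ^ 2 ∂μ := by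
  have h := lintegral_sq_le (μ.withDensity κ) (F := F)
    (hF.mono_ac (withDensity_absolutelyContinuous μ κ))
  rwa [lintegral_withDensity_eq_lintegral_mul₀ hκ.aemeasurable hF,
    lintegral_withDensity_eq_lintegral_mul₀ hκ.aemeasurable (hF.pow_const 2),
    withDensity_apply _ MeasurableSet.univ, setLIntegral_univ] at h

/-! ### Mollification -/

/-- The scales of mollification. -/
def molScale (k : ℕ) : ℝ := (1 / 2) ^ k

theorem molScale_pos (k : ℕ) : 0 < molScale k := by unfold molScale; positivity

theorem molScale_succ (k : ℕ) : molScale (k + 1) = molScale k / 2 := by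
  unfold molScale; rw [pow_succ]; ring

theorem tendsto_molScale : Tendsto molScale atTop (𝓝 0) :=
  tendsto_pow_atTop_nhds_zero_of_lt_one (by norm_num) (by norm_num)

/-- The bump function underlying the mollification at scale `molScale k`. -/
def molBump (k : ℕ) : ContDiffBump (0 : Plane) where
  rIn := molScale k / 2
  rOut := molScale k
  rIn_pos := half_pos (molScale_pos k)
  rIn_lt_rOut := half_lt_self (molScale_pos k)

/-- The mollification kernel at scale `molScale k`. -/
def molKernel (k : ℕ) : Plane → ℝ := (molBump k).normed volume

theorem molKernel_nonneg (k : ℕ) (z : Plane) : 0 ≤ molKernel k z :=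
  ContDiffBump.nonneg_normed _ _

theorem contDiff_molKernel (k : ℕ) : ContDiff ℝ ∞ (molKernel k) :=
  ContDiffBump.contDiff_normed _

theorem continuous_molKernel (k : ℕ) : Continuous (molKernel k) := (contDiff_molKernel k).continuous

theorem hasCompactSupport_molKernel (k : ℕ) : HasCompactSupport (molKernel k) :=
  ContDiffBump.hasCompactSupport_normed _

theorem tsupport_molKernel (k : ℕ) : tsupport (molKernel k) = Metric.closedBall 0 (molScale k) :=
  ContDiffBump.tsupport_normed_eq _

theorem integral_molKernel (k : ℕ) : ∫ z, molKernel k z = 1 := ContDiffBump.integral_normed _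

theorem molKernel_eq_zero {k : ℕ} {z : Plane} (h : molScale k < ‖z‖) : molKernel k z = 0 := by
  apply image_eq_zero_of_notMem_tsupport
  rw [tsupport_molKernel]
  simpa using h

theorem molKernel_neg (k : ℕ) (z : Plane) : molKernel k (-z) = molKernel k z :=
  ContDiffBump.normed_neg _ _

theorem exists_molKernel_le : ∃ C : ℝ, 0 ≤ C ∧ ∀ k z, molKernel k z ≤ C / molScale k ^ 2 := by
  refine ⟨4 / Real.pi, by positivity, fun k z => ?_⟩
  have h := (molBump k).normed_le_div_measure_closedBall_rOut volume 2
    (by change molScale k ≤ 2 * (molScale k / 2); linarith) z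
  refine h.trans (le_of_eq ?_)
  change 2 ^ _ / volume.real (Metric.closedBall 0 (molScale k)) = _
  have hk := molScale_pos k
  rw [Measure.real, EuclideanSpace.volume_closedBall_fin_two, finrank_euclideanSpace_fin]
  simp [hk.le]
  field_simp
  norm_num [ENNReal.toReal_ofReal Real.pi_pos.le, mul_comm]

theorem lintegral_molKernel_sub (k : ℕ) (x : Plane) :
    ∫⁻ y, ENNReal.ofReal (molKernel k (x - y)) = 1 := by
  rw [lintegral_sub_left_eq_self (fun y => ENNReal.ofReal (molKernel k y)) x,
    ← ofReal_integral_eq_lintegral_ofReal, integral_molKernel, ENNReal.ofReal_one]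
  · exact (continuous_molKernel k).integrable_of_hasCompactSupport (hasCompactSupport_molKernel k)
  · exact ae_of_all _ (molKernel_nonneg k)

/-- Mollification of `f` at scale `molScale k`, followed by a translation by the vector
`molScale k • v`. -/
def mollify (v : Plane) (k : ℕ) (f : Plane → ℝ) (z : Plane) : ℝ :=
  ∫ y, molKernel k (z - molScale k • v - y) * f y

variable {v : Plane} {k : ℕ} {f g : Plane → ℝ}

theorem mollify_eq_convolution :
    mollify v k f = fun z => (molKernel k ⋆[ContinuousLinearMap.lsmul ℝ ℝ, volume] f)
      (z - molScale k • v) := by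
  ext z
  rw [convolution_lsmul_swap]
  rfl

theorem contDiff_mollify (hf : LocallyIntegrable f) : ContDiff ℝ ∞ (mollify v k f) := by
  rw [mollify_eq_convolution]
  exact ((hasCompactSupport_molKernel k).contDiff_convolution_left _ (contDiff_molKernel k) hf).comp
    (contDiff_id.sub contDiff_const)

theorem integrable_kernel_mul {κ : Plane → ℝ} (hκ : Continuous κ) (hκc : HasCompactSupport κ)
    (hf : LocallyIntegrable f) (x : Plane) : Integrable fun y => κ (x - y) * f y := by
  have h1 : Continuous fun y => κ (x - y) := by fun_prop
  have h2 : HasCompactSupport fun y => κ (x - y) :=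
    hκc.comp_homeomorph (Homeomorph.subLeft x)
  exact hf.integrable_smul_left_of_hasCompactSupport h1 h2

theorem fderiv_mollify (hf : LocallyIntegrable f) (z w : Plane) :
    fderiv ℝ (mollify v k f) z w
      = ∫ y, fderiv ℝ (molKernel k) (z - molScale k • v - y) w * f y := by
  have h := (hasCompactSupport_molKernel k).hasFDerivAt_convolution_left
    (ContinuousLinearMap.lsmul ℝ ℝ) ((contDiff_molKernel k).of_le (by simp)) hf
    (z - molScale k • v)
  have h2 : HasFDerivAt (fun z : Plane => z - molScale k • v) (ContinuousLinearMap.id ℝ Plane) z :=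
    (hasFDerivAt_id z).sub_const _
  have h3 := h.comp z h2
  rw [mollify_eq_convolution]
  have h4 := h3.fderiv
  change fderiv ℝ (fun z => (molKernel k ⋆[ContinuousLinearMap.lsmul ℝ ℝ, volume] f)
      (z - molScale k • v)) z = _ at h4
  rw [h4, ContinuousLinearMap.comp_id, convolution_eq_swap, ContinuousLinearMap.integral_apply]
  · rfl
  · have h5 : Continuous (fderiv ℝ (molKernel k)) := (contDiff_molKernel k).continuous_fderiv (by simp)
    have h6 : HasCompactSupport (fderiv ℝ (molKernel k)) := (hasCompactSupport_molKernel k).fderiv ℝ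
    have h7 := h6.convolutionExists_left ((ContinuousLinearMap.lsmul ℝ ℝ).precompL Plane) h5 hf
      (z - molScale k • v)
    exact h7.integrable_swap

theorem locallyIntegrable_indicator {E : Set Plane} (hE : MeasurableSet E)
    (hf : MemLp f 2 (volume.restrict E)) : LocallyIntegrable (E.indicator f) :=
  ((memLp_indicator_iff_restrict hE).2 hf).locallyIntegrable (by norm_num)

/-- Where the mollification kernel is supported in `E`, mollification commutes with weak
derivatives. -/
theorem fderiv_mollify_eq {E : Set Plane} (hE : MeasurableSet E) {i : Fin 2}
    (hf : MemLp f 2 (volume.restrict E)) (h : HasWeakPartial E i f g) {z : Plane}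
    (hz : Metric.closedBall (z - molScale k • v) (molScale k) ⊆ E) :
    fderiv ℝ (mollify v k (E.indicator f)) z (EuclideanSpace.single i 1)
      = mollify v k (E.indicator g) z := by
  rw [fderiv_mollify (locallyIntegrable_indicator hE hf), mollify]
  set x := z - molScale k • v
  have hs : tsupport (fun y => molKernel k (x - y)) = Metric.closedBall x (molScale k) := by
    have := tsupport_comp_eq_preimage (molKernel k) (Homeomorph.subLeft x)
    change tsupport (fun y => molKernel k (x - y)) = _ at this
    rw [this, tsupport_molKernel]
    ext y
    simp [dist_eq_norm, norm_sub_rev]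
  -- The shifted kernel is an admissible test function for the weak derivative.
  have h1 := h.2.2 (fun y => molKernel k (x - y))
    ((contDiff_molKernel k).comp (contDiff_const.sub contDiff_id))
    (by rw [HasCompactSupport, hs]; exact isCompact_closedBall _ _) (by rwa [hs])
  have h2 : ∀ y, fderiv ℝ (fun y => molKernel k (x - y)) y (EuclideanSpace.single i 1)
      = -fderiv ℝ (molKernel k) (x - y) (EuclideanSpace.single i 1) := by
    intro y
    have h3 : HasFDerivAt (fun y : Plane => x - y) (-ContinuousLinearMap.id ℝ Plane) y :=
      (hasFDerivAt_id y).const_sub x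
    have h4 := (((contDiff_molKernel k).differentiable (by simp) (x - y)).hasFDerivAt).comp y h3
    have h5 := h4.fderiv
    change fderiv ℝ (fun y => molKernel k (x - y)) y = _ at h5
    rw [h5]; simp
  simp only [h2, mul_neg, integral_neg, neg_inj] at h1
  have e1 : ∀ (F G : Plane → ℝ), ∫ y, F y * E.indicator G y = ∫ y in E, G y * F y := by
    intro F G
    rw [← integral_indicator hE]
    congr 1; ext y
    by_cases hy : y ∈ E <;> simp [hy, mul_comm]
  rw [e1, e1]
  exact h1

/-- Jensen's inequality for the probability density `molKernel k`. -/
theorem enorm_mollify_sq_le (hf : AEStronglyMeasurable f) (z : Plane) :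
    ‖mollify v k f z‖ₑ ^ 2
      ≤ ∫⁻ y, ENNReal.ofReal (molKernel k (z - molScale k • v - y)) * ‖f y‖ₑ ^ 2 := by
  have h := lintegral_mul_sq_le volume
    (κ := fun y => ENNReal.ofReal (molKernel k (z - molScale k • v - y))) (F := fun y => ‖f y‖ₑ)
    (by have := (continuous_molKernel k).measurable; fun_prop) hf.enorm
  rw [lintegral_molKernel_sub, one_mul] at h
  refine le_trans ?_ h
  gcongr
  refine (enorm_integral_le_lintegral_enorm _).trans (lintegral_mono fun y => ?_)
  rw [enorm_mul, Real.enorm_of_nonneg (molKernel_nonneg _ _)]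

theorem tendsto_eLpNorm_translate (hf : MemLp f 2 volume) :
    Tendsto (fun u : Plane => eLpNorm (fun z => f (z - u) - f z) 2 volume) (𝓝 0) (𝓝 0) := by
  let G : C(Plane × Plane, Plane) := ⟨fun p => p.2 - p.1, by fun_prop⟩
  have hG : Tendsto (fun u => G.curry u) (𝓝 0) (𝓝 (G.curry 0)) := G.curry.continuous.tendsto 0
  have h := (tendsto_const_nhds (x := hf.toLp f)).compMeasurePreservingLp hG
    (fun u => measurePreserving_sub_right volume u) (measurePreserving_sub_right volume 0)
    (by norm_num)
  rw [Lp.tendsto_Lp_iff_tendsto_eLpNorm'] at h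
  refine h.congr fun u => eLpNorm_congr_ae ?_
  have a1 : ∀ u : Plane, Lp.compMeasurePreserving (G.curry u)
      (measurePreserving_sub_right volume u) (hf.toLp f) =ᵐ[volume] fun z => f (z - u) := by
    intro u
    refine (Lp.coeFn_compMeasurePreserving _ _).trans ?_
    exact (measurePreserving_sub_right volume u).quasiMeasurePreserving.ae_eq_comp hf.coeFn_toLp
  filter_upwards [a1 u, a1 0] with z h1 h2
  rw [Pi.sub_apply, h1, h2, sub_zero]

/-- Mollifications converge in mean square. -/
theorem tendsto_eLpNorm_mollify (hf : MemLp f 2 volume) :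
    Tendsto (fun k => eLpNorm (mollify v k f - f) 2 volume) atTop (𝓝 0) := by
  rw [ENNReal.tendsto_nhds_zero]
  intro η hη
  have h1 := (ENNReal.tendsto_nhds_zero.1 (tendsto_eLpNorm_translate hf)) η hη
  obtain ⟨δ, hδ, hball⟩ := Metric.eventually_nhds_iff.1 h1
  have hk : ∀ᶠ k in atTop, molScale k * (‖v‖ + 1) < δ := by
    have := tendsto_molScale.mul_const (‖v‖ + 1)
    rw [zero_mul] at this
    exact this.eventually (gt_mem_nhds hδ)
  filter_upwards [hk] with k hk
  have hli : LocallyIntegrable f := hf.locallyIntegrable (by norm_num)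
  have hκm : Measurable fun w => ENNReal.ofReal (molKernel k w) :=
    (continuous_molKernel k).measurable.ennreal_ofReal
  -- The mollification is an average of the translates of `f` by `molScale k • v + w` with `‖w‖ ≤
  -- molScale k`, so the difference is controlled by the continuity of translations in mean square.
  have hdiff : ∀ z, ‖(mollify v k f - f) z‖ₑ ^ 2 ≤ ∫⁻ w, ENNReal.ofReal (molKernel k w)
      * ‖f (z - (molScale k • v + w)) - f z‖ₑ ^ 2 := by
    intro z
    have e1 : (mollify v k f - f) z = ∫ w, molKernel k w * (f (z - (molScale k • v + w)) - f z) := by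
      have e2 : mollify v k f z = ∫ w, molKernel k w * f (z - (molScale k • v + w)) := by
        rw [mollify, ← integral_sub_left_eq_self _ _ (z - molScale k • v)]
        congr 1; ext w; congr 2 <;> abel
      have i1 : Integrable fun w => molKernel k w * f (z - (molScale k • v + w)) := by
        have := (integrable_kernel_mul (continuous_molKernel k) (hasCompactSupport_molKernel k) hli
          (z - molScale k • v)).comp_sub_left (z - molScale k • v)
        convert this using 2 with w
        congr 2 <;> abel
      have i2 : Integrable fun w => molKernel k w * f z :=
        ((continuous_molKernel k).integrable_of_hasCompactSupport
          (hasCompactSupport_molKernel k)).mul_const _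
      simp only [mul_sub]
      rw [integral_sub i1 i2, integral_mul_const, integral_molKernel, one_mul, Pi.sub_apply, e2]
    rw [e1]
    have hmp : MeasurePreserving (fun w : Plane => z - (molScale k • v + w)) volume volume :=
      (Measure.measurePreserving_sub_left volume z).comp (measurePreserving_add_left volume _)
    have hF : AEStronglyMeasurable (fun w => f (z - (molScale k • v + w)) - f z) volume :=
      (hf.1.comp_measurePreserving hmp).sub aestronglyMeasurable_const
    have h := lintegral_mul_sq_le volume hκm hF.enorm
    have hone : ∫⁻ w, ENNReal.ofReal (molKernel k w) = 1 := by
      have := lintegral_molKernel_sub k 0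
      simpa [molKernel_neg] using this
    rw [hone, one_mul] at h
    refine le_trans ?_ h
    gcongr
    refine (enorm_integral_le_lintegral_enorm _).trans (lintegral_mono fun y => ?_)
    rw [enorm_mul, Real.enorm_of_nonneg (molKernel_nonneg _ _)]
  have hsq : eLpNorm (mollify v k f - f) 2 volume ^ 2 ≤ η ^ 2 := by
    rw [eLpNorm_two_sq]
    calc ∫⁻ z, ‖(mollify v k f - f) z‖ₑ ^ 2
        ≤ ∫⁻ z, ∫⁻ w, ENNReal.ofReal (molKernel k w)
          * ‖f (z - (molScale k • v + w)) - f z‖ₑ ^ 2 := lintegral_mono hdiff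
      _ = ∫⁻ w, ∫⁻ z, ENNReal.ofReal (molKernel k w)
          * ‖f (z - (molScale k • v + w)) - f z‖ₑ ^ 2 := by
        apply lintegral_lintegral_swap
        refine (hκm.comp measurable_snd).aemeasurable.mul (AEMeasurable.pow_const ?_ 2)
        refine AEStronglyMeasurable.enorm (AEStronglyMeasurable.sub ?_ hf.1.comp_fst)
        have q : Measure.QuasiMeasurePreserving
            (fun p : Plane × Plane => p.1 - (molScale k • v + p.2)) (volume.prod volume) volume := by
          refine ⟨by fun_prop, ?_⟩
          intro s hs
          have q1 := (quasiMeasurePreserving_sub (volume : Measure Plane) volume)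
          have q2 : MeasurePreserving (fun p : Plane × Plane => (p.1, molScale k • v + p.2))
              (volume.prod volume) (volume.prod volume) :=
            (MeasurePreserving.id _).prod (measurePreserving_add_left volume _)
          exact (q1.comp q2.quasiMeasurePreserving).absolutelyContinuous hs
        exact hf.1.comp_quasiMeasurePreserving q
      _ ≤ ∫⁻ w, ENNReal.ofReal (molKernel k w) * η ^ 2 := by
        refine lintegral_mono fun w => ?_
        rw [lintegral_const_mul' _ _ ENNReal.ofReal_ne_top]
        by_cases hw : molScale k < ‖w‖
        · rw [molKernel_eq_zero hw]; simp
        gcongr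
        have := hball (y := molScale k • v + w) (by
          rw [dist_zero_right]
          refine (norm_add_le _ _).trans_lt (lt_of_le_of_lt ?_ hk)
          rw [norm_smul, Real.norm_of_nonneg (molScale_pos k).le]
          linarith [not_lt.1 hw])
        rw [← eLpNorm_two_sq volume (fun z => f (z - (molScale k • v + w)) - f z)]
        gcongr
      _ = η ^ 2 := by
        rw [lintegral_mul_const _ hκm]
        have := lintegral_molKernel_sub k 0
        simp only [zero_sub, molKernel_neg] at this
        rw [this, one_mul]
  exact (ENNReal.pow_le_pow_left_iff two_ne_zero).1 hsq

end

section

open scoped ENNReal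

variable {c : Plane ≃ᵃⁱ[ℝ] Plane} {φ : ℝ → ℝ} {E : Set Plane} {K : NNReal} {a d a' d' : ℝ}

/-! ### Approximation up to the boundary in a chart -/

/-- `f` belongs to `H¹(E)` and `F` is its weak gradient. -/
structure MemH1 (E : Set Plane) (f : Plane → ℝ) (F : Fin 2 → Plane → ℝ) : Prop where
  memLp : MemLp f 2 (volume.restrict E)
  partial_memLp : ∀ i, MemLp (F i) 2 (volume.restrict E)
  weak : ∀ i, HasWeakPartial E i f (F i)

/-- The direction of the translation which brings the mollification kernels inside the domain. -/
def chartDir (c : Plane ≃ᵃⁱ[ℝ] Plane) (K : NNReal) : Plane := ((K : ℝ) + 2) • upVec c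

theorem hasDerivAt_graphMap (t s : ℝ) :
    HasDerivAt (fun s => graphMap c φ (t, s)) (-upVec c) s := by
  have h : (fun s => graphMap c φ (t, s))
      = fun s => (c.symm 0 + t • horVec c) + (φ t - s) • upVec c := by
    ext1 s; rw [graphMap_eq]
  rw [h]
  have := ((hasDerivAt_id s).const_sub (φ t)).smul_const (upVec c)
  simpa using this.const_add (c.symm 0 + t • horVec c)

/-- The fundamental theorem of calculus along vertical segments. -/
theorem graphCurve_sub_graphMap {f : Plane → ℝ} (hf : ContDiff ℝ 1 f) (t τ : ℝ) :
    f (graphCurve c φ t) - f (graphMap c φ (t, τ))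
      = ∫ s in (0 : ℝ)..τ, fderiv ℝ f (graphMap c φ (t, s)) (upVec c) := by
  have hd : ∀ s, HasDerivAt (fun s => f (graphMap c φ (t, s)))
      (-fderiv ℝ f (graphMap c φ (t, s)) (upVec c)) s := by
    intro s
    have := ((hf.differentiable (by simp)) (graphMap c φ (t, s))).hasFDerivAt.comp_hasDerivAt s
      (hasDerivAt_graphMap t s)
    rw [map_neg] at this
    exact this
  have hc : Continuous fun s => fderiv ℝ f (graphMap c φ (t, s)) (upVec c) := by
    have h1 : Continuous fun s => graphMap c φ (t, s) :=
      continuous_iff_continuousAt.2 fun s => (hasDerivAt_graphMap t s).continuousAt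
    exact ((hf.continuous_fderiv (by simp)).comp h1).clm_apply continuous_const
  have := intervalIntegral.integral_eq_sub_of_hasDerivAt (a := 0) (b := τ) (fun s _ => hd s)
    (hc.neg.intervalIntegrable _ _)
  rw [intervalIntegral.integral_neg] at this
  rw [graphCurve]; linarith

theorem enorm_graphMap_sub_le {f : Plane → ℝ} (hf : ContDiff ℝ 1 f) {t τ δ : ℝ} (h0 : 0 ≤ τ)
    (hδ : τ ≤ δ) : ‖f (graphMap c φ (t, τ)) - f (graphCurve c φ t)‖ₑ
      ≤ ∫⁻ s in Ioo 0 δ, ‖fderiv ℝ f (graphMap c φ (t, s)) (upVec c)‖ₑ := by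
  rw [← enorm_neg, neg_sub, graphCurve_sub_graphMap hf, intervalIntegral.integral_of_le h0]
  refine (enorm_integral_le_lintegral_enorm _).trans ?_
  rw [← restrict_Ioo_eq_restrict_Ioc]
  exact lintegral_mono_set (Ioo_subset_Ioo_right hδ)

/-- Trace inequality for smooth functions. -/
theorem lintegral_graphCurve_sq_le (hφ : Continuous φ) {f : Plane → ℝ} (hf : ContDiff ℝ 1 f)
    (δ : ℝ) (J : Set ℝ) :
    ENNReal.ofReal δ * ∫⁻ t in J, ‖f (graphCurve c φ t)‖ₑ ^ 2
      ≤ 2 * (∫⁻ q in J ×ˢ Ioo 0 δ, ‖f (graphMap c φ q)‖ₑ ^ 2)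
        + 2 * ENNReal.ofReal δ ^ 2
          * ∫⁻ q in J ×ˢ Ioo 0 δ, ‖fderiv ℝ f (graphMap c φ q) (upVec c)‖ₑ ^ 2 := by
  have hΦ := continuous_graphMap (c := c) hφ
  have m1 : Measurable fun q => ‖f (graphMap c φ q)‖ₑ ^ 2 :=
    (hf.continuous.comp hΦ).enorm.measurable.pow_const 2
  have c2 : Continuous fun q => fderiv ℝ f (graphMap c φ q) (upVec c) :=
    ((hf.continuous_fderiv (by simp)).comp hΦ).clm_apply continuous_const
  have m2 : Measurable fun q => ‖fderiv ℝ f (graphMap c φ q) (upVec c)‖ₑ ^ 2 :=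
    c2.enorm.measurable.pow_const 2
  rw [Measure.volume_eq_prod, ← Measure.prod_restrict, lintegral_prod _ m1.aemeasurable,
    lintegral_prod _ m2.aemeasurable, ← lintegral_const_mul' _ _ ENNReal.ofReal_ne_top,
    ← lintegral_const_mul' _ _ (by norm_num), ← lintegral_const_mul' _ _ (by
      exact ENNReal.mul_ne_top (by norm_num) (ENNReal.pow_ne_top ENNReal.ofReal_ne_top)),
    ← lintegral_add_left' (m1.lintegral_prod_right'.const_mul _).aemeasurable]
  refine lintegral_mono fun t => ?_
  set D := ∫⁻ s in Ioo 0 δ, ‖fderiv ℝ f (graphMap c φ (t, s)) (upVec c)‖ₑ with hD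
  have hDsq : D ^ 2 ≤ ENNReal.ofReal δ
      * ∫⁻ s in Ioo 0 δ, ‖fderiv ℝ f (graphMap c φ (t, s)) (upVec c)‖ₑ ^ 2 := by
    have := lintegral_sq_le (volume.restrict (Ioo 0 δ))
      (F := fun s => ‖fderiv ℝ f (graphMap c φ (t, s)) (upVec c)‖ₑ)
      (c2.comp (by fun_prop : Continuous fun s : ℝ => (t, s))).enorm.measurable.aemeasurable
    simpa using this
  -- Compare the boundary value with the value at depth `τ`, then average over `τ`.
  have hpt : ∀ τ ∈ Ioo 0 δ, ‖f (graphCurve c φ t)‖ₑ ^ 2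
      ≤ 2 * ‖f (graphMap c φ (t, τ))‖ₑ ^ 2 + 2 * D ^ 2 := by
    intro τ hτ
    have h1 := enorm_graphMap_sub_le (c := c) (φ := φ) hf (t := t) hτ.1.le hτ.2.le
    have h2 : ‖f (graphCurve c φ t)‖ₑ ≤ ‖f (graphMap c φ (t, τ))‖ₑ + D := by
      calc ‖f (graphCurve c φ t)‖ₑ = ‖f (graphMap c φ (t, τ))
            - (f (graphMap c φ (t, τ)) - f (graphCurve c φ t))‖ₑ := by congr 1; ring
        _ ≤ _ := enorm_sub_le.trans (by gcongr)
    calc _ ≤ (‖f (graphMap c φ (t, τ))‖ₑ + D) ^ 2 := by gcongr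
      _ ≤ _ := by
        have := ENNReal.rpow_add_le_mul_rpow_add_rpow ‖f (graphMap c φ (t, τ))‖ₑ D
          (p := 2) (by norm_num)
        norm_num at this
        rw [mul_add] at this
        exact this
  calc ENNReal.ofReal δ * ‖f (graphCurve c φ t)‖ₑ ^ 2
      = ∫⁻ _ in Ioo 0 δ, ‖f (graphCurve c φ t)‖ₑ ^ 2 := by simp [mul_comm]
    _ ≤ ∫⁻ τ in Ioo 0 δ, (2 * ‖f (graphMap c φ (t, τ))‖ₑ ^ 2 + 2 * D ^ 2) :=
        setLIntegral_mono' measurableSet_Ioo hpt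
    _ = 2 * (∫⁻ τ in Ioo 0 δ, ‖f (graphMap c φ (t, τ))‖ₑ ^ 2) + 2 * D ^ 2 * ENNReal.ofReal δ := by
        rw [lintegral_add_right _ measurable_const, lintegral_const_mul' _ _ (by norm_num)]
        simp
    _ ≤ _ := by
        refine add_le_add le_rfl ?_
        calc 2 * D ^ 2 * ENNReal.ofReal δ ≤ 2 * (ENNReal.ofReal δ
              * ∫⁻ s in Ioo 0 δ, ‖fderiv ℝ f (graphMap c φ (t, s)) (upVec c)‖ₑ ^ 2)
              * ENNReal.ofReal δ := by gcongr
          _ = _ := by ring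

theorem setLIntegral_graphMap_le (hφ : Continuous φ) (G : Plane → ℝ≥0∞) (A : Set (ℝ × ℝ)) :
    ∫⁻ q in A, G (graphMap c φ q) ≤ ∫⁻ z, G z := by
  refine (setLIntegral_le_lintegral _ _).trans (le_of_eq ?_)
  exact (measurePreserving_graphMap hφ).lintegral_comp_emb (measurableEmbedding_graphMap hφ) G

/-- Completeness of `L²` for sequences of functions. -/
theorem exists_tendsto_eLpNorm {α : Type*} [MeasurableSpace α] {μ : Measure α} {g : ℕ → α → ℝ}
    (hg : ∀ k, MemLp (g k) 2 μ) {b : ℕ → ℝ≥0∞} (hb : Tendsto b atTop (𝓝 0))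
    (h : ∀ᶠ k in atTop, ∀ l ≥ k, eLpNorm (g k - g l) 2 μ ≤ b k) :
    ∃ f, MemLp f 2 μ ∧ Tendsto (fun k => eLpNorm (g k - f) 2 μ) atTop (𝓝 0) := by
  have hC : CauchySeq fun k => (hg k).toLp (g k) := by
    rw [EMetric.cauchySeq_iff]
    intro ε hε
    obtain ⟨N, hN1, hN2⟩ :=
      ((hb.eventually (gt_mem_nhds (show 0 < ε / 2 by simpa using hε.ne'))).and h).exists
    have hN : ∀ l ≥ N, edist ((hg l).toLp (g l)) ((hg N).toLp (g N)) < ε / 2 := fun l hl => by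
      rw [edist_comm, Lp.edist_toLp_toLp]
      exact (hN2 l hl).trans_lt hN1
    refine ⟨N, fun m hm n hn => ?_⟩
    calc _ ≤ edist ((hg m).toLp (g m)) ((hg N).toLp (g N))
          + edist ((hg n).toLp (g n)) ((hg N).toLp (g N)) := edist_triangle_right _ _ _
      _ < ε / 2 + ε / 2 := ENNReal.add_lt_add (hN m hm) (hN n hn)
      _ = ε := ENNReal.add_halves ε
  obtain ⟨f, hf⟩ := cauchySeq_tendsto_of_complete hC
  refine ⟨f, Lp.memLp f, ?_⟩
  rw [Lp.tendsto_Lp_iff_tendsto_eLpNorm'] at hf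
  refine hf.congr fun k => eLpNorm_congr_ae ?_
  filter_upwards [(hg k).coeFn_toLp] with x hx
  rw [Pi.sub_apply, Pi.sub_apply, hx]

theorem memLp_Ioo_of_continuous {g : ℝ → ℝ} (hg : Continuous g) (x y : ℝ) :
    MemLp g 2 (volume.restrict (Ioo x y)) := by
  obtain ⟨C, hC⟩ := (isCompact_Icc (a := x) (b := y)).exists_bound_of_continuousOn hg.continuousOn
  refine MemLp.of_bound hg.aestronglyMeasurable C ?_
  filter_upwards [ae_restrict_mem measurableSet_Ioo] with t ht using hC t (Ioo_subset_Icc_self ht)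

theorem fderiv_apply_eq (f : Plane → ℝ) (z w : Plane) :
    fderiv ℝ f z w = w 0 * fderiv ℝ f z (EuclideanSpace.single 0 1)
      + w 1 * fderiv ℝ f z (EuclideanSpace.single 1 1) := by
  have h : w = w 0 • EuclideanSpace.single 0 (1 : ℝ) + w 1 • EuclideanSpace.single 1 (1 : ℝ) := by
    ext i; fin_cases i <;> simp
  conv_lhs => rw [h, map_add, map_smul, map_smul]
  rfl

theorem abs_upVec_le (i : Fin 2) : |upVec c i| ≤ 1 := by
  rw [← norm_upVec (c := c)]
  exact PiLp.norm_apply_le (p := 2) (upVec c) i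

namespace IsLipChart

variable (h : IsLipChart E c φ K a d)
include h

/-- Near the boundary the shifted mollification kernels are supported in `E`: the shift by `K + 2`
times the radius outweighs both the radius and the slope `K` of the graph. -/
theorem closedBall_subset (ha : a' < a) (hd : d' < d) : ∀ᶠ k in atTop, ∀ t τ, |t| < a' → 0 ≤ τ →
    τ < d' → Metric.closedBall (graphMap c φ (t, τ) - molScale k • chartDir c K) (molScale k)
      ⊆ E := by
  -- The kernel at `graphMap c φ (t, τ)` lives on depths between `τ + ε` and `τ + (2 K + 3) ε`.
  have e1 : ∀ᶠ k in atTop, molScale k < a - a' :=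
    tendsto_molScale.eventually (gt_mem_nhds (sub_pos.2 ha))
  have e2 : ∀ᶠ k in atTop, molScale k * (2 * K + 3) < d - d' := by
    have := tendsto_molScale.mul_const (2 * (K : ℝ) + 3)
    rw [zero_mul] at this
    exact this.eventually (gt_mem_nhds (sub_pos.2 hd))
  filter_upwards [e1, e2] with k h1 h2 t τ ht h0 hτ y hy
  have hε := molScale_pos k
  set ε := molScale k
  rw [Metric.mem_closedBall, dist_eq_norm] at hy
  have hK : (0 : ℝ) ≤ K := K.2
  have hx := coord_add_frame (c := c) (graphMap c φ (t, τ)) 0 (-(ε * (K + 2)))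
  have hxe : graphMap c φ (t, τ) + (0 : ℝ) • horVec c + (-(ε * (K + 2))) • upVec c
      = graphMap c φ (t, τ) - ε • chartDir c K := by
    rw [chartDir, smul_smul, zero_smul, add_zero, neg_smul, sub_eq_add_neg]
  rw [hxe, coord_graphMap_zero, coord_graphMap_one] at hx
  have b0 := (abs_coord_sub_le (c := c) _ _ 0).trans hy
  have b1 := (abs_coord_sub_le (c := c) _ _ 1).trans hy
  rw [hx.1] at b0
  rw [hx.2] at b1
  dsimp only at b0 b1
  have b2 := h.lip.dist_le_mul (c y 0) t
  rw [Real.dist_eq, Real.dist_eq] at b2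
  have b3 : |φ (c y 0) - φ t| ≤ K * ε := by
    refine b2.trans (mul_le_mul_of_nonneg_left ?_ hK)
    simpa using b0
  have b0' := abs_le.1 b0
  have b1' := abs_le.1 b1
  have b3' := abs_le.1 b3
  have ht' := abs_lt.1 ht
  rw [← graphMap_coord (c := c) (φ := φ) y]
  refine (h.mem_iff _ _ (abs_lt.2 ⟨by linarith, by linarith⟩) (abs_lt.2 ⟨?_, ?_⟩)).2 ?_ <;> nlinarith

variable {f : Plane → ℝ} {F : Fin 2 → Plane → ℝ}

/-- In a chart, the gradient of the mollified function is the mollified gradient, up to the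
boundary. -/
theorem fderiv_mollify_eventually (hE : MeasurableSet E) (hf : MemH1 E f F) (ha : a' < a)
    (hd : d' < d) : ∀ᶠ k in atTop, ∀ t τ, |t| < a' → 0 ≤ τ → τ < d' → ∀ i,
      fderiv ℝ (mollify (chartDir c K) k (E.indicator f)) (graphMap c φ (t, τ))
        (EuclideanSpace.single i 1)
        = mollify (chartDir c K) k (E.indicator (F i)) (graphMap c φ (t, τ)) := by
  filter_upwards [h.closedBall_subset ha hd] with k hk t τ ht h0 hτ i
  exact fderiv_mollify_eq hE hf.memLp (hf.weak i) (hk t τ ht h0 hτ)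

/-- The mollifications of an `H¹` function, restricted to the boundary, converge in mean square:
they form a Cauchy sequence by the trace inequality. -/
theorem exists_trace_limit (hE : MeasurableSet E) (hf : MemH1 E f F) (ha : a' < a)
    (hd0 : 0 < d') (hd : d' < d) :
    ∃ fs : ℝ → ℝ, MemLp fs 2 (volume.restrict (Ioo (-a') a')) ∧
      Tendsto (fun k => eLpNorm ((fun t => mollify (chartDir c K) k (E.indicator f)
        (graphCurve c φ t)) - fs) 2 (volume.restrict (Ioo (-a') a'))) atTop (𝓝 0) := by
  set S : ℕ → (Plane → ℝ) → Plane → ℝ := fun k g => mollify (chartDir c K) k (E.indicator g) with hS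
  have hfL := (memLp_indicator_iff_restrict hE).2 hf.memLp
  have hFL := fun i => (memLp_indicator_iff_restrict hE).2 (hf.partial_memLp i)
  have hcd : ∀ k, ContDiff ℝ ∞ (S k f) := fun k =>
    contDiff_mollify (locallyIntegrable_indicator hE hf.memLp)
  have hcdF : ∀ k i, ContDiff ℝ ∞ (S k (F i)) := fun k i =>
    contDiff_mollify (locallyIntegrable_indicator hE (hf.partial_memLp i))
  set A : ℕ → ℝ≥0∞ := fun k => eLpNorm (S k f - E.indicator f) 2 volume
  set B : ℕ → Fin 2 → ℝ≥0∞ := fun k i => eLpNorm (S k (F i) - E.indicator (F i)) 2 volume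
  have hA : Tendsto A atTop (𝓝 0) := tendsto_eLpNorm_mollify hfL
  have hB : ∀ i, Tendsto (fun k => B k i) atTop (𝓝 0) := fun i => tendsto_eLpNorm_mollify (hFL i)
  have hdiff : ∀ (g : Plane → ℝ), MemLp (E.indicator g) 2 volume → (∀ k, Continuous (S k g)) →
      ∀ k l, eLpNorm (S k g - S l g) 2 volume ≤ eLpNorm (S k g - E.indicator g) 2 volume
        + eLpNorm (S l g - E.indicator g) 2 volume := by
    intro g hg hc k l
    have : S k g - S l g = (S k g - E.indicator g) - (S l g - E.indicator g) := by abel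
    rw [this]
    exact eLpNorm_sub_le ((hc k).aestronglyMeasurable.sub hg.1)
      ((hc l).aestronglyMeasurable.sub hg.1) (by norm_num)
  have hδ : ENNReal.ofReal d' ≠ 0 := by simpa using hd0
  set M : ℝ≥0∞ := (ENNReal.ofReal d')⁻¹ * (2 + 2 * ENNReal.ofReal d' ^ 2) with hM
  have hMtop : M ≠ ⊤ := ENNReal.mul_ne_top (ENNReal.inv_ne_top.2 hδ) (by finiteness)
  -- the trace inequality for the difference of two mollifications
  have hmain : ∀ᶠ k in atTop, ∀ l ≥ k, eLpNorm ((fun t => S k f (graphCurve c φ t))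
      - fun t => S l f (graphCurve c φ t)) 2 (volume.restrict (Ioo (-a') a')) ^ 2
      ≤ M * (eLpNorm (S k f - S l f) 2 volume + eLpNorm (S k (F 0) - S l (F 0)) 2 volume
        + eLpNorm (S k (F 1) - S l (F 1)) 2 volume) ^ 2 := by
    obtain ⟨N, hN⟩ := eventually_atTop.1 (h.fderiv_mollify_eventually hE hf ha hd)
    filter_upwards [eventually_ge_atTop N] with k hk l hl
    have hkN := hN k hk
    have hlN := hN l (hk.trans hl)
    set g := S k f - S l f with hg
    have hgc : ContDiff ℝ 1 g := ((hcd k).sub (hcd l)).of_le (by simp)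
    have hgd : ∀ q ∈ Ioo (-a') a' ×ˢ Ioo 0 d', ‖fderiv ℝ g (graphMap c φ q) (upVec c)‖ₑ
        ≤ ‖(S k (F 0) - S l (F 0)) (graphMap c φ q)‖ₑ
          + ‖(S k (F 1) - S l (F 1)) (graphMap c φ q)‖ₑ := by
      rintro ⟨t, τ⟩ ⟨ht, hτ⟩
      have hfd : fderiv ℝ g (graphMap c φ (t, τ)) = fderiv ℝ (S k f) (graphMap c φ (t, τ))
          - fderiv ℝ (S l f) (graphMap c φ (t, τ)) :=
        fderiv_sub ((hcd k).differentiable (by simp) _) ((hcd l).differentiable (by simp) _)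
      have hcomp : ∀ i, fderiv ℝ g (graphMap c φ (t, τ)) (EuclideanSpace.single i 1)
          = (S k (F i) - S l (F i)) (graphMap c φ (t, τ)) := by
        intro i
        rw [hfd, sub_apply, hkN t τ (abs_lt.2 ht) hτ.1.le hτ.2 i,
          hlN t τ (abs_lt.2 ht) hτ.1.le hτ.2 i]
        rfl
      rw [fderiv_apply_eq, hcomp, hcomp]
      refine (enorm_add_le _ _).trans ?_
      rw [enorm_mul, enorm_mul]
      have hu : ∀ i, ‖upVec c i‖ₑ ≤ 1 := fun i => by
        rw [Real.enorm_eq_ofReal_abs]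
        exact ENNReal.ofReal_le_one.2 (abs_upVec_le i)
      gcongr
      · exact mul_le_of_le_one_left zero_le (hu 0)
      · exact mul_le_of_le_one_left zero_le (hu 1)
    have htr := lintegral_graphCurve_sq_le (c := c) h.continuous hgc d' (Ioo (-a') a')
    have hI1 : ∫⁻ q in Ioo (-a') a' ×ˢ Ioo 0 d', ‖g (graphMap c φ q)‖ₑ ^ 2
        ≤ eLpNorm g 2 volume ^ 2 := by
      rw [eLpNorm_two_sq]
      exact setLIntegral_graphMap_le h.continuous (fun z => ‖g z‖ₑ ^ 2) _
    have hI2 : ∫⁻ q in Ioo (-a') a' ×ˢ Ioo 0 d', ‖fderiv ℝ g (graphMap c φ q) (upVec c)‖ₑ ^ 2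
        ≤ (eLpNorm (S k (F 0) - S l (F 0)) 2 volume
          + eLpNorm (S k (F 1) - S l (F 1)) 2 volume) ^ 2 := by
      set G : Plane → ℝ := fun z => |(S k (F 0) - S l (F 0)) z| + |(S k (F 1) - S l (F 1)) z|
      have hG : eLpNorm G 2 volume ≤ eLpNorm (S k (F 0) - S l (F 0)) 2 volume
          + eLpNorm (S k (F 1) - S l (F 1)) 2 volume := by
        have c0 := ((hcdF k 0).sub (hcdF l 0)).continuous
        have c1 := ((hcdF k 1).sub (hcdF l 1)).continuous
        refine (eLpNorm_add_le (f := fun z => |(S k (F 0) - S l (F 0)) z|)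
          (g := fun z => |(S k (F 1) - S l (F 1)) z|) c0.abs.aestronglyMeasurable
          c1.abs.aestronglyMeasurable (by norm_num)).trans (le_of_eq ?_)
        congr 1
        · exact eLpNorm_norm (S k (F 0) - S l (F 0))
        · exact eLpNorm_norm (S k (F 1) - S l (F 1))
      refine le_trans ?_ (pow_le_pow_left₀ zero_le hG 2)
      rw [eLpNorm_two_sq]
      refine le_trans ?_ (setLIntegral_graphMap_le (c := c) h.continuous (fun z => ‖G z‖ₑ ^ 2)
        (Ioo (-a') a' ×ˢ Ioo 0 d'))
      refine setLIntegral_mono' (measurableSet_Ioo.prod measurableSet_Ioo) fun q hq => ?_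
      gcongr
      refine (hgd q hq).trans (le_of_eq ?_)
      simp only [G]
      rw [Real.enorm_of_nonneg (add_nonneg (abs_nonneg _) (abs_nonneg _)),
        ENNReal.ofReal_add (abs_nonneg _) (abs_nonneg _),
        Real.enorm_eq_ofReal_abs, Real.enorm_eq_ofReal_abs]
    rw [eLpNorm_two_sq]
    set X := ∫⁻ t in Ioo (-a') a', ‖((fun t => S k f (graphCurve c φ t))
      - fun t => S l f (graphCurve c φ t)) t‖ₑ ^ 2
    have hX : ENNReal.ofReal d' * X ≤ (2 + 2 * ENNReal.ofReal d' ^ 2)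
        * (eLpNorm (S k f - S l f) 2 volume + eLpNorm (S k (F 0) - S l (F 0)) 2 volume
        + eLpNorm (S k (F 1) - S l (F 1)) 2 volume) ^ 2 := by
      refine htr.trans ?_
      rw [add_mul]
      refine add_le_add (mul_le_mul' le_rfl ?_) (mul_le_mul' le_rfl ?_)
      · refine hI1.trans (pow_le_pow_left₀ zero_le ?_ 2)
        rw [add_assoc]; exact le_self_add
      · refine hI2.trans (pow_le_pow_left₀ zero_le ?_ 2)
        rw [add_assoc]; exact le_add_self
    rw [hM, mul_assoc]
    calc X = (ENNReal.ofReal d')⁻¹ * (ENNReal.ofReal d' * X) := by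
          rw [← mul_assoc, ENNReal.inv_mul_cancel hδ ENNReal.ofReal_ne_top, one_mul]
      _ ≤ _ := by gcongr
  -- the norms of the differences are dominated by a sequence tending to zero
  set T : ℕ → ℝ≥0∞ := fun k => A k + B k 0 + B k 1
  have hT : Tendsto T atTop (𝓝 0) := by
    have := (hA.add (hB 0)).add (hB 1)
    simpa using this
  obtain ⟨R, hR⟩ : ∃ R : NNReal, M ≤ (R : ℝ≥0∞) ^ 2 := by
    refine ⟨M.toNNReal + 1, ?_⟩
    calc M = (M.toNNReal : ℝ≥0∞) := (ENNReal.coe_toNNReal hMtop).symm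
      _ ≤ ((M.toNNReal + 1 : NNReal) : ℝ≥0∞) ^ 2 := by
        rw [← ENNReal.coe_pow]
        rw [ENNReal.coe_le_coe, ← NNReal.coe_le_coe]
        push_cast
        nlinarith [M.toNNReal.2]
  -- `b` is a majorant of `T` which is monotone, hence bounds `T l` for all `l ≥ k` at once.
  set b : ℕ → ℝ≥0∞ := fun k => ⨆ l ≥ k, T l
  have hTb : ∀ k l, k ≤ l → T l ≤ b k := fun k l hl => le_iSup₂ (f := fun l (_ : l ≥ k) => T l) l hl
  have hb : Tendsto b atTop (𝓝 0) := by
    rw [ENNReal.tendsto_nhds_zero]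
    intro ε hε
    obtain ⟨N, hN⟩ := eventually_atTop.1 ((ENNReal.tendsto_nhds_zero.1 hT) ε hε)
    filter_upwards [eventually_ge_atTop N] with k hk
    exact iSup₂_le fun l hl => hN l (hk.trans hl)
  refine exists_tendsto_eLpNorm (b := fun k => R * (b k + b k)) (fun k => ?_) ?_ ?_
  · exact memLp_Ioo_of_continuous ((hcd k).continuous.comp (continuous_graphCurve h.continuous)) _ _
  · have := ENNReal.Tendsto.const_mul (hb.add hb) (Or.inr (ENNReal.coe_ne_top (r := R)))
    simpa using this
  · filter_upwards [hmain] with k hk l hl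
    refine (ENNReal.pow_le_pow_left_iff two_ne_zero).1 ((hk l hl).trans ?_)
    rw [mul_pow]
    refine mul_le_mul' hR (pow_le_pow_left₀ zero_le ?_ 2)
    refine le_trans ?_ (add_le_add (hTb k k le_rfl) (hTb k l hl))
    have e0 := hdiff f hfL (fun k => (hcd k).continuous) k l
    have e1 := fun i => hdiff (F i) (hFL i) (fun k => (hcdF k i).continuous) k l
    calc _ ≤ (A k + A l) + (B k 0 + B l 0) + (B k 1 + B l 1) :=
          add_le_add (add_le_add e0 (e1 0)) (e1 1)
      _ = T k + T l := by simp only [T]; ring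

end IsLipChart

end

section

open scoped ENNReal

variable {c : Plane ≃ᵃⁱ[ℝ] Plane} {φ : ℝ → ℝ} {E : Set Plane} {K : NNReal} {a d a' d' : ℝ}

/-! ### Existence of traces -/

theorem lintegral_enorm_le_eLpNorm_two {α : Type*} [MeasurableSpace α] {μ : Measure α} {g : α → ℝ}
    (hg : AEStronglyMeasurable g μ) :
    ∫⁻ x, ‖g x‖ₑ ∂μ ≤ μ univ ^ (1 / 2 : ℝ) * eLpNorm g 2 μ := by
  have := eLpNorm_le_eLpNorm_mul_rpow_measure_univ (μ := μ) (p := 1) (q := 2) (by norm_num) hg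
  rw [eLpNorm_one_eq_lintegral_enorm, mul_comm] at this
  norm_num at this
  norm_num
  exact this

theorem setLIntegral_enorm_graphMap_le (hφ : Continuous φ) {g : Plane → ℝ}
    (hg : AEStronglyMeasurable g volume) (Q : Set (ℝ × ℝ)) :
    ∫⁻ q in Q, ‖g (graphMap c φ q)‖ₑ ≤ volume Q ^ (1 / 2 : ℝ) * eLpNorm g 2 volume := by
  have hmp := measurePreserving_graphMap (c := c) hφ
  have h1 : AEStronglyMeasurable (fun q => g (graphMap c φ q)) (volume.restrict Q) :=
    (hg.comp_measurePreserving hmp).restrict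
  refine (lintegral_enorm_le_eLpNorm_two h1).trans ?_
  rw [Measure.restrict_apply_univ]
  gcongr
  refine (eLpNorm_mono_measure _ Measure.restrict_le_self).trans (le_of_eq ?_)
  exact eLpNorm_comp_measurePreserving hg hmp

namespace IsLipChart

variable {f : Plane → ℝ} {F : Fin 2 → Plane → ℝ} {fs : ℝ → ℝ}

/-- The distance in mean between a function and its trace in a boundary strip is controlled by the
gradient in the strip. -/
theorem lintegral_sub_trace_le (h : IsLipChart E c φ K a d) (hE : MeasurableSet E)
    (hf : MemH1 E f F) (ha : a' < a) (hd : d' < d)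
    (hfs : MemLp fs 2 (volume.restrict (Ioo (-a') a')))
    (hlim : Tendsto (fun k => eLpNorm ((fun t => mollify (chartDir c K) k (E.indicator f)
        (graphCurve c φ t)) - fs) 2 (volume.restrict (Ioo (-a') a'))) atTop (𝓝 0))
    {J : Set ℝ} (hJ : J ⊆ Ioo (-a') a') {δ : ℝ} (hδ : δ ≤ d') :
    ∫⁻ q in J ×ˢ Ioo 0 δ, ‖E.indicator f (graphMap c φ q) - fs q.1‖ₑ
      ≤ ENNReal.ofReal δ * ∫⁻ q in J ×ˢ Ioo 0 δ, (‖E.indicator (F 0) (graphMap c φ q)‖ₑ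
        + ‖E.indicator (F 1) (graphMap c φ q)‖ₑ) := by
  set S : ℕ → (Plane → ℝ) → Plane → ℝ := fun k g => mollify (chartDir c K) k (E.indicator g) with hS
  set Q : Set (ℝ × ℝ) := J ×ˢ Ioo 0 δ with hQ
  have hΦ := continuous_graphMap (c := c) h.continuous
  have hmp := measurePreserving_graphMap (c := c) h.continuous
  have hfL := (memLp_indicator_iff_restrict hE).2 hf.memLp
  have hFL := fun i => (memLp_indicator_iff_restrict hE).2 (hf.partial_memLp i)
  have hcd : ∀ k, ContDiff ℝ ∞ (S k f) := fun k =>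
    contDiff_mollify (locallyIntegrable_indicator hE hf.memLp)
  have hcdF : ∀ k i, Continuous (S k (F i)) := fun k i =>
    (contDiff_mollify (locallyIntegrable_indicator hE (hf.partial_memLp i))).continuous
  have hQfin : volume Q ≠ ⊤ := by
    have : volume Q ≤ volume (Ioo (-a') a' ×ˢ Ioo 0 δ) := measure_mono (prod_mono hJ le_rfl)
    refine ne_top_of_le_ne_top ?_ this
    rw [Measure.volume_eq_prod, Measure.prod_prod]
    simp [ENNReal.mul_eq_top]
  set M := volume Q ^ (1 / 2 : ℝ) with hM
  have hMtop : M ≠ ⊤ := ENNReal.rpow_ne_top_of_nonneg (by norm_num) hQfin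
  set A : ℕ → ℝ≥0∞ := fun k => eLpNorm (S k f - E.indicator f) 2 volume
  set B : ℕ → Fin 2 → ℝ≥0∞ := fun k i => eLpNorm (S k (F i) - E.indicator (F i)) 2 volume
  have hA : Tendsto A atTop (𝓝 0) := tendsto_eLpNorm_mollify hfL
  have hB : ∀ i, Tendsto (fun k => B k i) atTop (𝓝 0) := fun i => tendsto_eLpNorm_mollify (hFL i)
  set T : ℕ → ℝ≥0∞ := fun k => eLpNorm ((fun t => S k f (graphCurve c φ t)) - fs) 2
    (volume.restrict (Ioo (-a') a'))
  set M' := ENNReal.ofReal δ * volume (Ioo (-a') a') ^ (1 / 2 : ℝ)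
  have hM'top : M' ≠ ⊤ := ENNReal.mul_ne_top ENNReal.ofReal_ne_top
    (ENNReal.rpow_ne_top_of_nonneg (by norm_num) (by simp))
  set R := ∫⁻ q in Q, (‖E.indicator (F 0) (graphMap c φ q)‖ₑ
        + ‖E.indicator (F 1) (graphMap c φ q)‖ₑ)
  have hprod : (volume.restrict Q : Measure (ℝ × ℝ))
      = (volume.restrict J).prod (volume.restrict (Ioo 0 δ)) := by
    rw [hQ, Measure.volume_eq_prod, Measure.prod_restrict]
  have hfsm : AEStronglyMeasurable fs (volume.restrict J) :=
    hfs.1.mono_measure (Measure.restrict_mono hJ le_rfl)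
  have hfsQ : AEStronglyMeasurable (fun q : ℝ × ℝ => fs q.1) (volume.restrict Q) := by
    rw [hprod]; exact hfsm.comp_fst
  have hfQ : AEStronglyMeasurable (fun q => E.indicator f (graphMap c φ q)) (volume.restrict Q) :=
    (hfL.1.comp_measurePreserving hmp).restrict
  have hFQ : ∀ i, AEStronglyMeasurable (fun q => E.indicator (F i) (graphMap c φ q))
      (volume.restrict Q) := fun i => ((hFL i).1.comp_measurePreserving hmp).restrict
  -- The estimate for the mollification `S k f`, with error terms which vanish in the limit.
  have hbound : ∀ᶠ k in atTop, ∫⁻ q in Q, ‖E.indicator f (graphMap c φ q) - fs q.1‖ₑ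
      ≤ M * A k + ENNReal.ofReal δ * (R + (M * B k 0 + M * B k 1)) + M' * T k := by
    filter_upwards [h.fderiv_mollify_eventually hE hf ha hd] with k hk
    have hcont := (hcd k).continuous
    have i1 : ∫⁻ q in Q, ‖S k f (graphMap c φ q) - E.indicator f (graphMap c φ q)‖ₑ ≤ M * A k :=
      setLIntegral_enorm_graphMap_le (c := c) h.continuous (g := S k f - E.indicator f)
        (hcont.aestronglyMeasurable.sub hfL.1) Q
    have i2 : ∫⁻ q in Q, ‖S k f (graphCurve c φ q.1) - fs q.1‖ₑ ≤ M' * T k := by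
      have hm : AEStronglyMeasurable (fun t => S k f (graphCurve c φ t) - fs t)
          (volume.restrict J) :=
        (hcont.comp (continuous_graphCurve h.continuous)).aestronglyMeasurable.sub hfsm
      rw [hprod, lintegral_prod _ (hm.comp_fst (ν := volume.restrict (Ioo 0 δ))).enorm]
      simp only [lintegral_const, Measure.restrict_apply_univ, Real.volume_Ioo, sub_zero]
      rw [lintegral_mul_const'' _ hm.enorm, mul_comm, mul_assoc]
      gcongr
      refine (lintegral_mono_set hJ).trans ?_
      have hm' : AEStronglyMeasurable (fun t => S k f (graphCurve c φ t) - fs t)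
          (volume.restrict (Ioo (-a') a')) :=
        (hcont.comp (continuous_graphCurve h.continuous)).aestronglyMeasurable.sub hfs.1
      have := lintegral_enorm_le_eLpNorm_two hm'
      rwa [Measure.restrict_apply_univ] at this
    have i3 : ∀ i, ∫⁻ q in Q, ‖S k (F i) (graphMap c φ q)‖ₑ
        ≤ (∫⁻ q in Q, ‖E.indicator (F i) (graphMap c φ q)‖ₑ) + M * B k i := by
      intro i
      have := setLIntegral_enorm_graphMap_le (c := c) h.continuous
        (g := S k (F i) - E.indicator (F i)) ((hcdF k i).aestronglyMeasurable.sub (hFL i).1) Q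
      refine le_trans ?_ (add_le_add le_rfl this)
      rw [← lintegral_add_left' (hFQ i).enorm]
      refine lintegral_mono fun q => ?_
      calc ‖S k (F i) (graphMap c φ q)‖ₑ = ‖E.indicator (F i) (graphMap c φ q)
            + (S k (F i) - E.indicator (F i)) (graphMap c φ q)‖ₑ := by
              congr 1; simp
        _ ≤ _ := enorm_add_le _ _
    -- The smooth case: integrate the derivative along vertical segments.
    have i4 : ∫⁻ q in Q, ‖S k f (graphMap c φ q) - S k f (graphCurve c φ q.1)‖ₑ
        ≤ ENNReal.ofReal δ * ∫⁻ q in Q, (‖S k (F 0) (graphMap c φ q)‖ₑ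
          + ‖S k (F 1) (graphMap c φ q)‖ₑ) := by
      have m1 : Continuous fun q => ‖S k f (graphMap c φ q) - S k f (graphCurve c φ q.1)‖ₑ :=
        ((hcont.comp hΦ).sub (hcont.comp
          ((continuous_graphCurve h.continuous).comp continuous_fst))).enorm
      have m2 : Continuous fun q => ‖S k (F 0) (graphMap c φ q)‖ₑ
          + ‖S k (F 1) (graphMap c φ q)‖ₑ :=
        ((hcdF k 0).comp hΦ).enorm.add ((hcdF k 1).comp hΦ).enorm
      rw [hprod, lintegral_prod _ m1.measurable.aemeasurable,
        lintegral_prod _ m2.measurable.aemeasurable,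
        ← lintegral_const_mul' _ _ ENNReal.ofReal_ne_top]
      have hJm : ∀ᵐ t ∂volume.restrict J, t ∈ Ioo (-a') a' :=
        ae_mono (Measure.restrict_mono hJ le_rfl) (ae_restrict_mem measurableSet_Ioo)
      refine lintegral_mono_ae (hJm.mono fun t ht => ?_)
      calc ∫⁻ τ in Ioo 0 δ, ‖S k f (graphMap c φ (t, τ)) - S k f (graphCurve c φ t)‖ₑ
          ≤ ∫⁻ _ in Ioo 0 δ, ∫⁻ s in Ioo 0 δ, ‖fderiv ℝ (S k f) (graphMap c φ (t, s)) (upVec c)‖ₑ :=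
            setLIntegral_mono' measurableSet_Ioo fun τ hτ =>
              enorm_graphMap_sub_le ((hcd k).of_le (by simp)) hτ.1.le hτ.2.le
        _ = ENNReal.ofReal δ
            * ∫⁻ s in Ioo 0 δ, ‖fderiv ℝ (S k f) (graphMap c φ (t, s)) (upVec c)‖ₑ := by
            simp [mul_comm]
        _ ≤ _ := by
            gcongr ENNReal.ofReal δ * ?_
            refine setLIntegral_mono' measurableSet_Ioo fun s hs => ?_
            have hc : ∀ i, fderiv ℝ (S k f) (graphMap c φ (t, s)) (EuclideanSpace.single i 1)
                = S k (F i) (graphMap c φ (t, s)) :=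
              hk t s (abs_lt.2 ht) hs.1.le (hs.2.trans_le hδ)
            rw [fderiv_apply_eq, hc, hc]
            refine (enorm_add_le _ _).trans ?_
            rw [enorm_mul, enorm_mul]
            have hu : ∀ i, ‖upVec c i‖ₑ ≤ 1 := fun i => by
              rw [Real.enorm_eq_ofReal_abs]
              exact ENNReal.ofReal_le_one.2 (abs_upVec_le i)
            exact add_le_add (mul_le_of_le_one_left zero_le (hu 0))
              (mul_le_of_le_one_left zero_le (hu 1))
    have i5 : ∫⁻ q in Q, (‖S k (F 0) (graphMap c φ q)‖ₑ + ‖S k (F 1) (graphMap c φ q)‖ₑ)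
        ≤ R + (M * B k 0 + M * B k 1) := by
      have m2 : Continuous fun q => ‖S k (F 0) (graphMap c φ q)‖ₑ := ((hcdF k 0).comp hΦ).enorm
      rw [lintegral_add_left m2.measurable]
      refine (add_le_add (i3 0) (i3 1)).trans (le_of_eq ?_)
      simp only [R]
      rw [lintegral_add_left' (hFQ 0).enorm]
      ring
    calc ∫⁻ q in Q, ‖E.indicator f (graphMap c φ q) - fs q.1‖ₑ
        ≤ ∫⁻ q in Q, (‖S k f (graphMap c φ q) - E.indicator f (graphMap c φ q)‖ₑ
          + ‖S k f (graphMap c φ q) - S k f (graphCurve c φ q.1)‖ₑ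
          + ‖S k f (graphCurve c φ q.1) - fs q.1‖ₑ) := by
          refine lintegral_mono fun q => ?_
          set x := E.indicator f (graphMap c φ q)
          set y := S k f (graphMap c φ q)
          set z := S k f (graphCurve c φ q.1)
          calc ‖x - fs q.1‖ₑ = ‖-(y - x) + (y - z) + (z - fs q.1)‖ₑ := by congr 1; ring
            _ ≤ ‖-(y - x)‖ₑ + ‖y - z‖ₑ + ‖z - fs q.1‖ₑ :=
              (enorm_add_le _ _).trans (add_le_add (enorm_add_le _ _) le_rfl)
            _ = _ := by rw [enorm_neg]
      _ = (∫⁻ q in Q, ‖S k f (graphMap c φ q) - E.indicator f (graphMap c φ q)‖ₑ)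
          + (∫⁻ q in Q, ‖S k f (graphMap c φ q) - S k f (graphCurve c φ q.1)‖ₑ)
          + ∫⁻ q in Q, ‖S k f (graphCurve c φ q.1) - fs q.1‖ₑ := by
          have c1 : AEStronglyMeasurable (fun q => S k f (graphMap c φ q)) (volume.restrict Q) :=
            (hcont.comp hΦ).aestronglyMeasurable
          have c2 : AEStronglyMeasurable (fun q : ℝ × ℝ => S k f (graphCurve c φ q.1))
              (volume.restrict Q) := (hcont.comp
            ((continuous_graphCurve h.continuous).comp continuous_fst)).aestronglyMeasurable
          have d1 : AEStronglyMeasurable (fun q : ℝ × ℝ => S k f (graphCurve c φ q.1) - fs q.1)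
              (volume.restrict Q) := c2.sub hfsQ
          have d2 : AEStronglyMeasurable (fun q : ℝ × ℝ => S k f (graphMap c φ q)
              - S k f (graphCurve c φ q.1)) (volume.restrict Q) := c1.sub c2
          rw [lintegral_add_right' _ d1.enorm, lintegral_add_right' _ d2.enorm]
      _ ≤ _ := add_le_add (add_le_add i1 (i4.trans (mul_le_mul' le_rfl i5))) i2
  have hlimit : Tendsto (fun k => M * A k + ENNReal.ofReal δ * (R + (M * B k 0 + M * B k 1))
      + M' * T k) atTop (𝓝 (M * 0 + ENNReal.ofReal δ * (R + (M * 0 + M * 0)) + M' * 0)) := by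
    refine ((ENNReal.Tendsto.const_mul hA (Or.inr hMtop)).add (ENNReal.Tendsto.const_mul
      (tendsto_const_nhds.add ((ENNReal.Tendsto.const_mul (hB 0) (Or.inr hMtop)).add
        (ENNReal.Tendsto.const_mul (hB 1) (Or.inr hMtop)))) (Or.inr ENNReal.ofReal_ne_top))).add
      (ENNReal.Tendsto.const_mul hlim (Or.inr hM'top))
  simp only [mul_zero, add_zero, zero_add] at hlimit
  exact ge_of_tendsto hlimit hbound

end IsLipChart

end

section

open scoped ENNReal

variable {c : Plane ≃ᵃⁱ[ℝ] Plane} {φ : ℝ → ℝ} {E : Set Plane} {K : NNReal} {a d a' d' : ℝ}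

theorem aestronglyMeasurable_comp_graphMap (hφ : Continuous φ) {g : Plane → ℝ}
    (hg : AEStronglyMeasurable g volume) :
    AEStronglyMeasurable (fun q => g (graphMap c φ q)) (volume.prod volume) :=
  hg.comp_measurePreserving (measurePreserving_graphMap hφ)

theorem enorm_setAverage_sub_le {f : Plane → ℝ} {W : Set Plane} (hW : volume W ≠ ⊤)
    (hW0 : volume W ≠ 0) (hf : IntegrableOn f W) (x : ℝ) :
    ‖(⨍ y in W, f y) - x‖ₑ ≤ (volume W)⁻¹ * ∫⁻ y in W, ‖f y - x‖ₑ := by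
  have hr : volume.real W ≠ 0 := (ENNReal.toReal_ne_zero).2 ⟨hW0, hW⟩
  have e : (⨍ y in W, f y) - x = (volume.real W)⁻¹ * ∫ y in W, (f y - x) := by
    rw [integral_sub hf (integrableOn_const hW), setAverage_eq, setIntegral_const, smul_eq_mul,
      smul_eq_mul, mul_sub, inv_mul_cancel_left₀ hr]
  rw [e, enorm_mul]
  gcongr
  · rw [Real.enorm_of_nonneg (by positivity), ENNReal.ofReal_inv_of_pos
      (lt_of_le_of_ne measureReal_nonneg (Ne.symm hr)), Measure.real, ENNReal.ofReal_toReal hW]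
  · exact enorm_integral_le_lintegral_enorm _

namespace IsLipChart

variable {f : Plane → ℝ} {F : Fin 2 → Plane → ℝ} {fs : ℝ → ℝ}

/-- In graph coordinates the part of a small ball in `E` lies in a rectangle of comparable size. -/
theorem ball_inter_subset (h : IsLipChart E c φ K a d) {t₀ r : ℝ}
    (hJ : Metric.closedBall t₀ r ⊆ Ioo (-a) a) (hr : ((K : ℝ) + 1) * r ≤ d) :
    graphMap c φ ⁻¹' (Metric.ball (graphCurve c φ t₀) r ∩ E)
      ⊆ Metric.closedBall t₀ r ×ˢ Ioo 0 (((K : ℝ) + 1) * r) := by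
  rintro ⟨t, τ⟩ ⟨hb, hE⟩
  rw [Metric.mem_ball, dist_eq_norm] at hb
  have b0 := (abs_coord_sub_le (c := c) _ _ 0).trans_lt hb
  have b1 := (abs_coord_sub_le (c := c) _ _ 1).trans_lt hb
  rw [coord_graphMap_zero, coord_graphCurve_zero] at b0
  rw [coord_graphMap_one, coord_graphCurve_one] at b1
  dsimp only at b0 b1
  have b2 := h.lip.dist_le_mul t t₀
  rw [Real.dist_eq, Real.dist_eq] at b2
  have hK : (0 : ℝ) ≤ K := K.2
  have b3 : |φ t - φ t₀| ≤ K * r := b2.trans (mul_le_mul_of_nonneg_left b0.le hK)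
  have ht : t ∈ Metric.closedBall t₀ r := by rw [Metric.mem_closedBall, Real.dist_eq]; exact b0.le
  have b1' := abs_lt.1 b1
  have b3' := abs_le.1 b3
  have hτ : |τ| < (K + 1) * r := abs_lt.2 ⟨by linarith, by linarith⟩
  have hpos := (h.mem_iff t τ (abs_lt.2 (hJ ht)) (hτ.trans_le hr)).1 hE
  exact ⟨ht, hpos, (le_abs_self τ).trans_lt hτ⟩

/-- The part of a small ball in `E` contains, in graph coordinates, a rectangle of comparable size.
-/
theorem le_volume_ball_inter (h : IsLipChart E c φ K a d) {t₀ r : ℝ} (hr0 : 0 < r)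
    (hJ : Metric.closedBall t₀ r ⊆ Ioo (-a) a) (hr : ((K : ℝ) + 1) * r ≤ d) :
    ENNReal.ofReal (2 * (r / (K + 3)) ^ 2) ≤ volume (Metric.ball (graphCurve c φ t₀) r ∩ E) := by
  have hK : (0 : ℝ) ≤ K := K.2
  set ρ := r / (K + 3) with hρ
  have hρ0 : 0 < ρ := by positivity
  have hρe : ρ * (K + 3) = r := by rw [hρ]; field_simp
  have hρr : ρ ≤ r := by nlinarith
  have hsub : graphMap c φ '' (Metric.ball t₀ ρ ×ˢ Ioo 0 ρ)
      ⊆ Metric.ball (graphCurve c φ t₀) r ∩ E := by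
    rintro _ ⟨⟨t, τ⟩, ⟨ht, hτ⟩, rfl⟩
    rw [Metric.mem_ball, Real.dist_eq] at ht
    dsimp only at ht hτ
    have htJ : t ∈ Ioo (-a) a := hJ (by
      rw [Metric.mem_closedBall, Real.dist_eq]; exact ht.le.trans hρr)
    refine ⟨?_, (h.mem_iff t τ (abs_lt.2 htJ) ?_).2 hτ.1⟩
    · rw [Metric.mem_ball, dist_eq_norm, sub_eq_frame (c := c)]
      refine (norm_frame_le _ _).trans_lt ?_
      rw [coord_graphMap_zero, coord_graphCurve_zero, coord_graphMap_one, coord_graphCurve_one]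
      dsimp only
      have b2 := h.lip.dist_le_mul t t₀
      rw [Real.dist_eq, Real.dist_eq] at b2
      have b3 : |φ t - φ t₀| ≤ K * ρ := b2.trans (mul_le_mul_of_nonneg_left ht.le hK)
      have b4 : |φ t - τ - φ t₀| ≤ |φ t - φ t₀| + τ := by
        rw [show φ t - τ - φ t₀ = (φ t - φ t₀) - τ by ring]
        refine (abs_sub _ _).trans ?_
        rw [abs_of_pos hτ.1]
      have := hτ.2
      nlinarith
    · rw [abs_of_pos hτ.1]
      nlinarith [hτ.2]
  refine le_trans (le_of_eq ?_) (measure_mono hsub)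
  have hmp := measurePreserving_graphMap (c := c) h.continuous
  have hemb := measurableEmbedding_graphMap (c := c) h.continuous
  rw [← hmp.measure_preimage_emb hemb, preimage_image_eq _ hemb.injective,
    Measure.volume_eq_prod, Measure.prod_prod, Real.volume_ball, Real.volume_Ioo,
    ← ENNReal.ofReal_mul (by positivity)]
  congr 1; ring

/-- At almost every boundary point of a chart the trace exists and is the limit of the
mollifications. -/
theorem ae_hasTraceAt (h : IsLipChart E c φ K a d) (hE : MeasurableSet E)
    (hf : MemH1 E f F) (ha : a' < a) (hd0 : 0 < d') (hd : d' < d)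
    (hfs : MemLp fs 2 (volume.restrict (Ioo (-a') a')))
    (hlim : Tendsto (fun k => eLpNorm ((fun t => mollify (chartDir c K) k (E.indicator f)
        (graphCurve c φ t)) - fs) 2 (volume.restrict (Ioo (-a') a'))) atTop (𝓝 0)) :
    ∀ᵐ t ∂volume.restrict (Ioo (-a') a'), HasTraceAt E f (graphCurve c φ t) (fs t) := by
  set J := Ioo (-a') a' with hJ
  set S : Plane → ℝ≥0∞ := fun z => ‖E.indicator (F 0) z‖ₑ + ‖E.indicator (F 1) z‖ₑ with hS
  have hfL := (memLp_indicator_iff_restrict hE).2 hf.memLp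
  have hFL := fun i => (memLp_indicator_iff_restrict hE).2 (hf.partial_memLp i)
  have hSm : AEMeasurable (fun q : ℝ × ℝ => S (graphMap c φ q)) (volume.prod volume) :=
    (aestronglyMeasurable_comp_graphMap h.continuous (hFL 0).1).enorm.add
      (aestronglyMeasurable_comp_graphMap h.continuous (hFL 1).1).enorm
  set δ : ℕ → ℝ := fun n => d' * molScale n with hδ
  have hδpos : ∀ n, 0 < δ n := fun n => mul_pos hd0 (molScale_pos n)
  have hms1 : ∀ n, molScale n ≤ 1 := fun n => pow_le_one₀ (by norm_num) (by norm_num)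
  have hδle : ∀ n, δ n ≤ d' := fun n => mul_le_of_le_one_right hd0.le (hms1 n)
  -- `H n t` is the integral of the gradient over the vertical segment of length `δ n` below the
  -- boundary point with parameter `t`.
  set H : ℕ → ℝ → ℝ≥0∞ := fun n =>
    J.indicator fun t => ∫⁻ s in Ioo 0 (δ n), S (graphMap c φ (t, s)) with hH
  have hHin : ∀ n, ∀ t ∈ J, H n t = ∫⁻ s in Ioo 0 (δ n), S (graphMap c φ (t, s)) :=
    fun n t ht => indicator_of_mem ht _
  have hHm : ∀ n, AEMeasurable (H n) volume := by
    intro n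
    refine AEMeasurable.indicator ?_ measurableSet_Ioo
    refine AEMeasurable.lintegral_prod_right' (f := fun q : ℝ × ℝ => S (graphMap c φ q)) ?_
    refine hSm.mono_measure ?_
    exact Measure.prod_mono le_rfl Measure.restrict_le_self
  have hHint : ∀ n, ∫⁻ t, H n t ≠ ⊤ := by
    intro n
    rw [hH, lintegral_indicator measurableSet_Ioo]
    have e : ∫⁻ t in J, ∫⁻ s in Ioo 0 (δ n), S (graphMap c φ (t, s))
        = ∫⁻ q in J ×ˢ Ioo 0 (δ n), S (graphMap c φ q) := by
      rw [Measure.volume_eq_prod, ← Measure.prod_restrict, lintegral_prod]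
      exact hSm.mono_measure (Measure.prod_mono Measure.restrict_le_self Measure.restrict_le_self)
    rw [e]
    have hQ : volume (J ×ˢ Ioo 0 (δ n)) ^ (1 / 2 : ℝ) ≠ ⊤ := by
      refine ENNReal.rpow_ne_top_of_nonneg (by norm_num) ?_
      rw [Measure.volume_eq_prod, Measure.prod_prod]
      simp [hJ, ENNReal.mul_eq_top]
    have hm0 : AEMeasurable (fun q : ℝ × ℝ => ‖E.indicator (F 0) (graphMap c φ q)‖ₑ) volume :=
      (aestronglyMeasurable_comp_graphMap h.continuous (hFL 0).1).enorm
    simp only [hS]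
    rw [lintegral_add_left' hm0.restrict]
    refine ne_top_of_le_ne_top ?_ (add_le_add
      (setLIntegral_enorm_graphMap_le (c := c) h.continuous (hFL 0).1 _)
      (setLIntegral_enorm_graphMap_le (c := c) h.continuous (hFL 1).1 _))
    exact ENNReal.add_ne_top.2 ⟨ENNReal.mul_ne_top hQ (hFL 0).2.ne,
      ENNReal.mul_ne_top hQ (hFL 1).2.ne⟩
  -- The exceptional null set consists of the points that are not Lebesgue points of some `H n` or
  -- of the limit `fs`.
  have hLeb1 : ∀ᵐ t, ∀ n, Tendsto (fun r => (∫⁻ y in Metric.closedBall t r, H n y)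
      / volume (Metric.closedBall t r)) (𝓝[>] 0) (𝓝 (H n t)) := by
    rw [ae_all_iff]
    intro n
    filter_upwards [(Besicovitch.vitaliFamily (volume : Measure ℝ)).ae_tendsto_lintegral_div
      (hHm n) (hHint n)] with t ht using ht.comp (Besicovitch.tendsto_filterAt volume t)
  have hgi : LocallyIntegrable (J.indicator fs) volume :=
    ((memLp_indicator_iff_restrict measurableSet_Ioo).2 hfs).locallyIntegrable (by norm_num)
  have hLeb2 : ∀ᵐ t, Tendsto (fun r => (∫⁻ y in Metric.closedBall t r,
      ‖J.indicator fs y - J.indicator fs t‖ₑ) / volume (Metric.closedBall t r)) (𝓝[>] 0) (𝓝 0) := by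
    filter_upwards [(Besicovitch.vitaliFamily (volume : Measure ℝ)).ae_tendsto_lintegral_enorm_sub_div
      hgi] with t ht using ht.comp (Besicovitch.tendsto_filterAt volume t)
  filter_upwards [ae_restrict_of_ae hLeb1, ae_restrict_of_ae hLeb2,
    ae_restrict_of_ae (ae_lt_top' (hHm 0) (hHint 0)), ae_restrict_mem measurableSet_Ioo]
    with t₀ hL1 hL2 hfin ht₀
  have hK : (0 : ℝ) ≤ K := K.2
  set κ : ℝ := (K + 1) * (K + 3) ^ 2 with hκ
  have hκ0 : 0 < κ := by positivity
  -- the inner integrals over shrinking strips tend to zero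
  have hHlim : Tendsto (fun n => H n t₀) atTop (𝓝 0) := by
    have hfin' : ∫⁻ s in Ioo 0 (δ 0), S (graphMap c φ (t₀, s)) ≠ ⊤ := by
      have := hfin.ne
      rwa [hHin _ _ ht₀] at this
    have hvol : Tendsto ((volume.restrict (Ioo 0 (δ 0))) ∘ fun n => Ioo 0 (δ n)) atTop (𝓝 0) := by
      have h1 : Tendsto (fun n => ENNReal.ofReal (δ n)) atTop (𝓝 0) := by
        have := ENNReal.tendsto_ofReal (tendsto_molScale.const_mul d')
        simpa using this
      refine tendsto_of_tendsto_of_tendsto_of_le_of_le tendsto_const_nhds h1 (fun _ => zero_le)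
        fun n => ?_
      refine (Measure.restrict_apply_le _ _).trans ?_
      simp
    have := tendsto_setLIntegral_zero hfin' hvol
    refine this.congr fun n => ?_
    rw [hHin _ _ ht₀, Measure.restrict_restrict measurableSet_Ioo,
      inter_eq_left.2 (Ioo_subset_Ioo_right ?_)]
    exact mul_le_mul_of_nonneg_left ((hms1 n).trans (by simp [molScale])) hd0.le
  -- The ball is contained in a strip of depth `(K + 1) r`, in which `f` differs in mean from `fs`
  -- by the gradient integral; the length of `B` and the area of `W` turn the bound into means over
  -- `B`.
  have hmain : ∀ n, ∀ᶠ r in 𝓝[>] (0 : ℝ),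
      ‖(⨍ y in Metric.ball (graphCurve c φ t₀) r ∩ E, f y) - fs t₀‖ₑ
        ≤ ENNReal.ofReal κ * ((∫⁻ y in Metric.closedBall t₀ r, H n y)
            / volume (Metric.closedBall t₀ r)
          + (∫⁻ y in Metric.closedBall t₀ r, ‖J.indicator fs y - J.indicator fs t₀‖ₑ)
            / volume (Metric.closedBall t₀ r)) := by
    intro n
    have ev1 : ∀ᶠ r in 𝓝[>] (0 : ℝ), Metric.closedBall t₀ r ⊆ J := by
      obtain ⟨ρ, hρ, hsub⟩ := Metric.isOpen_iff.1 isOpen_Ioo t₀ ht₀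
      filter_upwards [Ioo_mem_nhdsGT hρ] with r hr
      exact (Metric.closedBall_subset_ball hr.2).trans hsub
    have ev2 : ∀ᶠ r in 𝓝[>] (0 : ℝ), (K + 1) * r ≤ δ n := by
      have hp : 0 < δ n / (K + 1) := div_pos (hδpos n) (by positivity)
      filter_upwards [Ioo_mem_nhdsGT hp] with r hr
      have := hr.2
      rw [lt_div_iff₀ (by positivity)] at this
      linarith
    filter_upwards [ev1, ev2, self_mem_nhdsWithin] with r hr1 hr2 hr0
    have hr0 : 0 < r := hr0
    have hrJ : Metric.closedBall t₀ r ⊆ Ioo (-a) a :=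
      hr1.trans (Ioo_subset_Ioo (by linarith) ha.le)
    have hrd : ((K : ℝ) + 1) * r ≤ d := hr2.trans ((hδle n).trans hd.le)
    set W := Metric.ball (graphCurve c φ t₀) r ∩ E with hW
    have hWm : MeasurableSet W := Metric.isOpen_ball.measurableSet.inter hE
    have hWtop : volume W ≠ ⊤ :=
      ne_top_of_le_ne_top (measure_ball_lt_top (x := graphCurve c φ t₀) (r := r)).ne
        (measure_mono inter_subset_left)
    have hWlow := h.le_volume_ball_inter hr0 hrJ hrd
    have hlowpos : 0 < 2 * (r / (K + 3)) ^ 2 := by positivity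
    have hW0 : volume W ≠ 0 := (lt_of_lt_of_le (ENNReal.ofReal_pos.2 hlowpos) hWlow).ne'
    have hfi : IntegrableOn f W := by
      have : IsFiniteMeasure (volume.restrict W) := ⟨by
        rw [Measure.restrict_apply_univ]; exact hWtop.lt_top⟩
      exact (hf.memLp.mono_measure (Measure.restrict_mono inter_subset_right le_rfl)).integrable
        (by norm_num)
    refine (enorm_setAverage_sub_le hWtop hW0 hfi (fs t₀)).trans ?_
    set B := Metric.closedBall t₀ r
    set C : ℝ := (K + 1) * r with hC
    set Q := B ×ˢ Ioo 0 C with hQ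
    have hfsB : AEStronglyMeasurable fs (volume.restrict B) :=
      hfs.1.mono_measure (Measure.restrict_mono hr1 le_rfl)
    have hprod : (volume.restrict Q : Measure (ℝ × ℝ))
        = (volume.restrict B).prod (volume.restrict (Ioo 0 C)) := by
      rw [hQ, Measure.volume_eq_prod, Measure.prod_restrict]
    have hfsQ : AEStronglyMeasurable (fun q : ℝ × ℝ => fs q.1) (volume.restrict Q) := by
      rw [hprod]; exact hfsB.comp_fst
    have j1 : ∫⁻ y in W, ‖f y - fs t₀‖ₑ
        ≤ ∫⁻ q in Q, ‖E.indicator f (graphMap c φ q) - fs t₀‖ₑ := by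
      calc ∫⁻ y in W, ‖f y - fs t₀‖ₑ = ∫⁻ y in W, ‖E.indicator f y - fs t₀‖ₑ :=
            setLIntegral_congr_fun hWm fun y hy => by rw [indicator_of_mem hy.2]
        _ = ∫⁻ q in graphMap c φ ⁻¹' W, ‖E.indicator f (graphMap c φ q) - fs t₀‖ₑ :=
            ((measurePreserving_graphMap h.continuous).setLIntegral_comp_preimage_emb
              (measurableEmbedding_graphMap h.continuous) _ _).symm
        _ ≤ _ := lintegral_mono_set (h.ball_inter_subset hrJ hrd)
    have j2 : ∫⁻ q in Q, ‖E.indicator f (graphMap c φ q) - fs t₀‖ₑ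
        ≤ (∫⁻ q in Q, ‖E.indicator f (graphMap c φ q) - fs q.1‖ₑ)
          + ∫⁻ q in Q, ‖fs q.1 - fs t₀‖ₑ := by
      have hm : AEStronglyMeasurable (fun q : ℝ × ℝ => fs q.1 - fs t₀) (volume.restrict Q) :=
        hfsQ.sub aestronglyMeasurable_const
      rw [← lintegral_add_right' _ hm.enorm]
      refine lintegral_mono fun q => ?_
      refine le_trans (le_of_eq ?_) (enorm_add_le _ _)
      congr 1; simp
    have j3 : ∫⁻ q in Q, ‖E.indicator f (graphMap c φ q) - fs q.1‖ₑ
        ≤ ENNReal.ofReal C * ∫⁻ t in B, H n t := by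
      refine (h.lintegral_sub_trace_le hE hf ha hd hfs hlim hr1 (hr2.trans (hδle n))).trans ?_
      gcongr ENNReal.ofReal C * ?_
      change ∫⁻ q in Q, S (graphMap c φ q) ≤ _
      rw [hprod, lintegral_prod]
      · refine setLIntegral_mono' Metric.isClosed_closedBall.measurableSet fun t ht => ?_
        rw [hHin _ _ (hr1 ht)]
        exact lintegral_mono_set (Ioo_subset_Ioo_right hr2)
      · exact hSm.mono_measure (Measure.prod_mono Measure.restrict_le_self Measure.restrict_le_self)
    have j4 : ∫⁻ q in Q, ‖fs q.1 - fs t₀‖ₑ = ENNReal.ofReal C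
        * ∫⁻ y in B, ‖J.indicator fs y - J.indicator fs t₀‖ₑ := by
      have hm : AEStronglyMeasurable (fun t => fs t - fs t₀) (volume.restrict B) :=
        hfsB.sub aestronglyMeasurable_const
      rw [hprod, lintegral_prod _ (hm.comp_fst (ν := volume.restrict (Ioo 0 C))).enorm]
      simp only [lintegral_const, Measure.restrict_apply_univ, Real.volume_Ioo, sub_zero]
      rw [lintegral_mul_const'' _ hm.enorm, mul_comm]
      congr 1
      refine setLIntegral_congr_fun Metric.isClosed_closedBall.measurableSet fun t ht => ?_
      rw [indicator_of_mem (hr1 ht), indicator_of_mem ht₀]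
    have hvB : volume B = ENNReal.ofReal (2 * r) := Real.volume_closedBall _ _
    -- This comparison determines the constant `κ`.
    have hfac : (volume W)⁻¹ * ENNReal.ofReal C ≤ ENNReal.ofReal κ * (volume B)⁻¹ := by
      rw [hvB]
      calc (volume W)⁻¹ * ENNReal.ofReal C
          ≤ (ENNReal.ofReal (2 * (r / (K + 3)) ^ 2))⁻¹ * ENNReal.ofReal C := by
            gcongr
        _ = ENNReal.ofReal κ * (ENNReal.ofReal (2 * r))⁻¹ := by
            rw [← ENNReal.ofReal_inv_of_pos hlowpos, ← ENNReal.ofReal_inv_of_pos (by positivity),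
              ← ENNReal.ofReal_mul (by positivity), ← ENNReal.ofReal_mul (by positivity)]
            congr 1
            rw [hκ, hC]
            field_simp
    calc (volume W)⁻¹ * ∫⁻ y in W, ‖f y - fs t₀‖ₑ
        ≤ (volume W)⁻¹ * (ENNReal.ofReal C * (∫⁻ t in B, H n t) + ENNReal.ofReal C
          * ∫⁻ y in B, ‖J.indicator fs y - J.indicator fs t₀‖ₑ) := by
          gcongr
          exact j1.trans (j2.trans (add_le_add j3 j4.le))
      _ = (volume W)⁻¹ * ENNReal.ofReal C * ((∫⁻ t in B, H n t)
          + ∫⁻ y in B, ‖J.indicator fs y - J.indicator fs t₀‖ₑ) := by ring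
      _ ≤ ENNReal.ofReal κ * (volume B)⁻¹ * ((∫⁻ t in B, H n t)
          + ∫⁻ y in B, ‖J.indicator fs y - J.indicator fs t₀‖ₑ) := mul_le_mul' hfac le_rfl
      _ = _ := by simp only [ENNReal.div_eq_inv_mul]; ring
  rw [HasTraceAt, tendsto_iff_edist_tendsto_0, ENNReal.tendsto_nhds_zero]
  intro ε hε
  have h1 : Tendsto (fun n => ENNReal.ofReal κ * (H n t₀ + 0)) atTop (𝓝 0) := by
    have := ENNReal.Tendsto.const_mul (hHlim.add_const 0) (Or.inr (ENNReal.ofReal_ne_top (r := κ)))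
    simpa using this
  -- First choose `n` to make the Lebesgue value of `H n` small, then the radius.
  obtain ⟨n, hn⟩ := (h1.eventually (gt_mem_nhds hε)).exists
  have h2 := ENNReal.Tendsto.const_mul ((hL1 n).add hL2) (Or.inr (ENNReal.ofReal_ne_top (r := κ)))
  filter_upwards [hmain n, h2.eventually (gt_mem_nhds hn)] with r hr1 hr2
  rw [edist_eq_enorm_sub]
  exact hr1.trans hr2.le

end IsLipChart

end

section

open scoped ENNReal

variable {c : Plane ≃ᵃⁱ[ℝ] Plane} {φ : ℝ → ℝ} {E : Set Plane} {K : NNReal} {a d a' d' : ℝ}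

/-! ### The Gauss–Green formula -/

theorem integral_deriv_eq_zero_of_lipschitz {g : ℝ → ℝ} {C : NNReal} (hg : LipschitzWith C g)
    (hc : HasCompactSupport g) : ∫ t, deriv g t = 0 := by
  have h := (LipschitzWith.const (α := ℝ) (1 : ℝ)).integral_lineDeriv_mul_eq (μ := volume) hg hc (-1)
  have h1 : ∀ x, lineDeriv ℝ (fun _ : ℝ => (1 : ℝ)) x (-1) = 0 := fun x => by
    simp [lineDeriv]
  have h2 : ∀ x, lineDeriv ℝ g x (- -1) = deriv g x := fun x => by
    rw [neg_neg, lineDeriv]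
    have := deriv_comp_const_add (f := g) x 0
    simp only [add_zero] at this
    simpa using this
  simp only [h1, h2, zero_mul, integral_zero, mul_one] at h
  exact h.symm

theorem exists_lipschitzWith_of_contDiff {F : Plane → ℝ} (hF : ContDiff ℝ 1 F)
    (hc : HasCompactSupport F) : ∃ C, LipschitzWith C F :=
  hF.lipschitzWith_of_hasCompactSupport hc (by simp)

theorem lipschitzWith_graphMap_left (hφ : LipschitzWith K φ) (τ : ℝ) :
    LipschitzWith (1 + K) fun t => graphMap c φ (t, τ) := by
  have : (fun t => graphMap c φ (t, τ)) = fun t => graphCurve c φ t + (-τ) • upVec c := by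
    ext1 t; rw [graphMap_eq, graphCurve_eq, sub_eq_add_neg, add_smul, ← add_assoc]
  rw [this]
  have := (lipschitzWith_graphCurve (c := c) hφ).add (LipschitzWith.const (α := ℝ) ((-τ) • upVec c))
  simpa using this

theorem hasDerivAt_graphMap_left {t τ m : ℝ} (hm : HasDerivAt φ m t) :
    HasDerivAt (fun t => graphMap c φ (t, τ)) (horVec c + m • upVec c) t := by
  have h : (fun t => graphMap c φ (t, τ))
      = fun t => (c.symm 0 + t • horVec c) + (φ t - τ) • upVec c := by
    ext1 s; rw [graphMap_eq]
  rw [h]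
  have h1 := ((hasDerivAt_id t).smul_const (horVec c)).const_add (c.symm 0)
  have h2 := (hm.sub_const τ).smul_const (upVec c)
  have := h1.add h2
  simp only [one_smul] at this
  exact this

theorem hasCompactSupport_comp_graphMap (hφ : Continuous φ) {G : Plane → ℝ}
    (hG : HasCompactSupport G) : HasCompactSupport fun q => G (graphMap c φ q) :=
  hG.comp_homeomorph (graphHomeo c φ hφ)

theorem hasCompactSupport_section {G : ℝ × ℝ → ℝ} (hG : HasCompactSupport G) (τ : ℝ) :
    HasCompactSupport fun t => G (t, τ) := by
  refine HasCompactSupport.intro (hG.isCompact.image continuous_fst) fun t ht => ?_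
  by_contra h0
  exact ht ⟨(t, τ), subset_tsupport G h0, rfl⟩

theorem hasCompactSupport_section' {G : ℝ × ℝ → ℝ} (hG : HasCompactSupport G) (t : ℝ) :
    HasCompactSupport fun τ => G (t, τ) := by
  refine HasCompactSupport.intro (hG.isCompact.image continuous_snd) fun τ ht => ?_
  by_contra h0
  exact ht ⟨(t, τ), subset_tsupport G h0, rfl⟩

section Smooth

variable {F : Plane → ℝ}

theorem integral_Ioi_fderiv_upVec (hF : ContDiff ℝ 1 F) (hφ : Continuous φ)
    (hc : HasCompactSupport F) (t : ℝ) :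
    ∫ τ in Ioi 0, fderiv ℝ F (graphMap c φ (t, τ)) (upVec c) = F (graphCurve c φ t) := by
  have hcs : HasCompactSupport fun τ => F (graphMap c φ (t, τ)) :=
    hasCompactSupport_section' (hasCompactSupport_comp_graphMap (c := c) hφ hc) t
  have hcd : ContDiff ℝ 1 fun τ => F (graphMap c φ (t, τ)) := by
    refine hF.comp ?_
    have h : (fun s => graphMap c φ (t, s))
        = fun s => (c.symm 0 + t • horVec c) + (φ t - s) • upVec c := by
      ext1 s; rw [graphMap_eq]
    rw [h]
    fun_prop
  have h1 := hcs.integral_Ioi_deriv_eq hcd 0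
  have h2 : ∀ τ, deriv (fun τ => F (graphMap c φ (t, τ))) τ
      = -fderiv ℝ F (graphMap c φ (t, τ)) (upVec c) := by
    intro τ
    have := ((hF.differentiable (by simp)) (graphMap c φ (t, τ))).hasFDerivAt.comp_hasDerivAt τ
      (hasDerivAt_graphMap t τ)
    rw [map_neg] at this
    exact this.deriv
  simp only [h2, integral_neg, neg_inj] at h1
  exact h1

/-- On a curve parallel to the graph, `F` has a Lipschitz restriction with compact support, whose
derivative has integral zero; by Rademacher's theorem the chain rule holds almost everywhere. -/
theorem integral_fderiv_horVec (hF : ContDiff ℝ 1 F) (hφ : LipschitzWith K φ)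
    (hc : HasCompactSupport F) (τ : ℝ) :
    ∫ t, fderiv ℝ F (graphMap c φ (t, τ)) (horVec c)
      = -∫ t, deriv φ t * fderiv ℝ F (graphMap c φ (t, τ)) (upVec c) := by
  obtain ⟨C, hC⟩ := exists_lipschitzWith_of_contDiff hF hc
  have hΦ := hasCompactSupport_comp_graphMap (c := c) hφ.continuous hc
  have h0 := integral_deriv_eq_zero_of_lipschitz (hC.comp (lipschitzWith_graphMap_left (c := c) hφ τ))
    (hasCompactSupport_section hΦ τ)
  have hcont : Continuous fun t => graphMap c φ (t, τ) :=
    (continuous_graphMap hφ.continuous).comp (by fun_prop)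
  have hint : ∀ w, Integrable fun t => fderiv ℝ F (graphMap c φ (t, τ)) w := by
    intro w
    refine Continuous.integrable_of_hasCompactSupport
      (((hF.continuous_fderiv (by simp)).comp hcont).clm_apply continuous_const) ?_
    have h1 : HasCompactSupport fun z => fderiv ℝ F z w := hc.fderiv_apply ℝ w
    exact hasCompactSupport_section (hasCompactSupport_comp_graphMap (c := c) hφ.continuous h1) τ
  have hint2 : Integrable fun t => deriv φ t * fderiv ℝ F (graphMap c φ (t, τ)) (upVec c) :=
    (hint _).bdd_mul (c := K) (measurable_deriv φ).aestronglyMeasurable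
      (ae_of_all _ fun t => norm_deriv_le_of_lipschitz hφ)
  have hd : ∀ᵐ t, deriv (F ∘ fun t => graphMap c φ (t, τ)) t
      = fderiv ℝ F (graphMap c φ (t, τ)) (horVec c)
        + deriv φ t * fderiv ℝ F (graphMap c φ (t, τ)) (upVec c) := by
    filter_upwards [hφ.ae_differentiableAt] with t ht
    have := ((hF.differentiable (by simp)) (graphMap c φ (t, τ))).hasFDerivAt.comp_hasDerivAt t
      (hasDerivAt_graphMap_left (c := c) ht.hasDerivAt)
    rw [map_add, map_smul, smul_eq_mul] at this
    exact this.deriv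
  rw [integral_congr_ae hd, integral_add (hint _) hint2] at h0
  linarith

theorem integrable_fderiv_graphMap (hF : ContDiff ℝ 1 F) (hφ : Continuous φ)
    (hc : HasCompactSupport F) (w : Plane) :
    Integrable (fun q => fderiv ℝ F (graphMap c φ q) w) (volume.prod volume) := by
  refine Continuous.integrable_of_hasCompactSupport
    (((hF.continuous_fderiv (by simp)).comp (continuous_graphMap hφ)).clm_apply continuous_const) ?_
  have h1 : HasCompactSupport fun z => fderiv ℝ F z w := hc.fderiv_apply ℝ w
  exact hasCompactSupport_comp_graphMap (c := c) hφ h1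

theorem integral_strip_upVec (hF : ContDiff ℝ 1 F) (hφ : Continuous φ)
    (hc : HasCompactSupport F) :
    ∫ q in univ ×ˢ Ioi 0, fderiv ℝ F (graphMap c φ q) (upVec c) = ∫ t, F (graphCurve c φ t) := by
  have hi := integrable_fderiv_graphMap (c := c) hF hφ hc (upVec c)
  rw [Measure.volume_eq_prod, setIntegral_prod _ hi.integrableOn, setIntegral_univ]
  simp only [integral_Ioi_fderiv_upVec hF hφ hc]

theorem integral_strip_horVec (hF : ContDiff ℝ 1 F) (hφ : LipschitzWith K φ)
    (hc : HasCompactSupport F) :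
    ∫ q in univ ×ˢ Ioi 0, fderiv ℝ F (graphMap c φ q) (horVec c)
      = -∫ t, deriv φ t * F (graphCurve c φ t) := by
  have hi := integrable_fderiv_graphMap (c := c) hF hφ.continuous hc (horVec c)
  have hi2 : Integrable (fun q : ℝ × ℝ => deriv φ q.1 * fderiv ℝ F (graphMap c φ q) (upVec c))
      (volume.prod volume) :=
    (integrable_fderiv_graphMap (c := c) hF hφ.continuous hc (upVec c)).bdd_mul (c := K)
      ((measurable_deriv φ).comp measurable_fst).aestronglyMeasurable
      (ae_of_all _ fun t => norm_deriv_le_of_lipschitz hφ)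
  have hr : (volume.prod volume : Measure (ℝ × ℝ)).restrict (univ ×ˢ Ioi 0)
      = volume.prod (volume.restrict (Ioi 0)) := by
    rw [← Measure.prod_restrict, Measure.restrict_univ]
  have hi' : Integrable (fun q => fderiv ℝ F (graphMap c φ q) (horVec c))
      (volume.prod (volume.restrict (Ioi 0))) := by rw [← hr]; exact hi.restrict
  have hi2' : Integrable (fun q : ℝ × ℝ => deriv φ q.1 * fderiv ℝ F (graphMap c φ q) (upVec c))
      (volume.prod (volume.restrict (Ioi 0))) := by rw [← hr]; exact hi2.restrict
  rw [Measure.volume_eq_prod, hr, integral_prod_symm _ hi']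
  simp only [integral_fderiv_horVec (c := c) hF hφ hc]
  rw [integral_neg, ← integral_prod_symm (fun q : ℝ × ℝ => deriv φ q.1
    * fderiv ℝ F (graphMap c φ q) (upVec c)) hi2', integral_prod _ hi2']
  simp only [integral_const_mul, integral_Ioi_fderiv_upVec (c := c) hF hφ.continuous hc]

end Smooth

theorem eq_frame (w : Plane) :
    w = inner ℝ w (horVec c) • horVec c + inner ℝ w (upVec c) • upVec c := by
  have h := sub_eq_frame (c := c) (c.symm 0 + w) (c.symm 0)
  rw [add_sub_cancel_left] at h
  set x := c (c.symm 0 + w) 0 - c (c.symm 0) 0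
  set y := c (c.symm 0 + w) 1 - c (c.symm 0) 1
  have h1 : inner ℝ w (horVec c) = x := by
    have := inner_frame (c := c) x y 1 0
    rw [← h] at this; simpa using this
  have h2 : inner ℝ w (upVec c) = y := by
    have := inner_frame (c := c) x y 0 1
    rw [← h] at this; simpa using this
  rw [h1, h2, ← h]

namespace IsLipChart

theorem mono (h : IsLipChart E c φ K a d) (ha0 : 0 < a') (ha : a' ≤ a) (hd0 : 0 < d')
    (hd : d' ≤ d) : IsLipChart E c φ K a' d' :=
  ⟨h.lip, ha0, hd0, fun t τ ht hτ => h.mem_iff t τ (ht.trans_le ha) (hτ.trans_le hd),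
    fun t τ ht hτ => h.frontier_iff t τ (ht.trans_le ha) (hτ.trans_le hd)⟩

/-- The divergence theorem for a smooth function supported in a chart. -/
theorem setIntegral_fderiv (h : IsLipChart E c φ K a d) (hE : MeasurableSet E) {F : Plane → ℝ}
    (hF : ContDiff ℝ 1 F) (hc : HasCompactSupport F) (hs : tsupport F ⊆ chartBox c φ a d)
    (w : Plane) :
    ∫ z in E, fderiv ℝ F z w = ∫ t in Ioo (-a) a, F (graphCurve c φ t)
      * inner ℝ w (upVec c - deriv φ t • horVec c) := by
  have hmp := measurePreserving_graphMap (c := c) h.continuous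
  have hemb := measurableEmbedding_graphMap (c := c) h.continuous
  have hzero : ∀ z ∉ chartBox c φ a d, F z = 0 := fun z hz =>
    image_eq_zero_of_notMem_tsupport fun hz' => hz (hs hz')
  have hzero' : ∀ z ∉ chartBox c φ a d, fderiv ℝ F z = 0 := fun z hz =>
    image_eq_zero_of_notMem_tsupport fun hz' => hz (hs (tsupport_fderiv_subset ℝ hz'))
  have e1 : ∀ w, ∫ z in E, fderiv ℝ F z w
      = ∫ q in univ ×ˢ Ioi 0, fderiv ℝ F (graphMap c φ q) w := by
    intro w
    rw [← hmp.setIntegral_preimage_emb hemb, ← integral_indicator (hemb.measurable hE),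
      ← integral_indicator (MeasurableSet.univ.prod measurableSet_Ioi)]
    congr 1
    ext q
    by_cases hq : graphMap c φ q ∈ chartBox c φ a d
    · have hq' := graphMap_mem_chartBox.1 hq
      have := h.mem_iff q.1 q.2 hq'.1 hq'.2
      by_cases hpos : 0 < q.2
      · rw [indicator_of_mem (show q ∈ graphMap c φ ⁻¹' E from this.2 hpos),
          indicator_of_mem (show q ∈ univ ×ˢ Ioi (0 : ℝ) from ⟨mem_univ _, hpos⟩)]
      · rw [indicator_of_notMem (show q ∉ graphMap c φ ⁻¹' E from fun h' => hpos (this.1 h')),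
          indicator_of_notMem (show q ∉ univ ×ˢ Ioi (0 : ℝ) from fun h' => hpos h'.2)]
    · simp only [indicator, hzero' _ hq, zero_apply, ite_self]
  have hfc : Continuous fun t => F (graphCurve c φ t) :=
    hF.continuous.comp (continuous_graphCurve h.continuous)
  have hfs : HasCompactSupport fun t => F (graphCurve c φ t) :=
    hasCompactSupport_section (hasCompactSupport_comp_graphMap (c := c) h.continuous hc) 0
  have i1 : Integrable fun t => F (graphCurve c φ t) := hfc.integrable_of_hasCompactSupport hfs
  have i2 : Integrable fun t => deriv φ t * F (graphCurve c φ t) :=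
    i1.bdd_mul (c := K) (measurable_deriv φ).aestronglyMeasurable
      (ae_of_all _ fun t => norm_deriv_le_of_lipschitz h.lip)
  have j : ∀ w, Integrable (fun z => fderiv ℝ F z w) (volume.restrict E) := fun w =>
    (Continuous.integrable_of_hasCompactSupport ((hF.continuous_fderiv (by simp)).clm_apply
      continuous_const) (hc.fderiv_apply ℝ w)).restrict
  set x := inner ℝ w (horVec c)
  set y := inner ℝ w (upVec c)
  -- Decompose `w` in the frame of the chart and integrate along each axis.
  have e2 : ∫ z in E, fderiv ℝ F z w = x * (∫ z in E, fderiv ℝ F z (horVec c))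
      + y * ∫ z in E, fderiv ℝ F z (upVec c) := by
    rw [← integral_const_mul, ← integral_const_mul,
      ← integral_add ((j _).const_mul _) ((j _).const_mul _)]
    congr 1; ext z
    conv_lhs => rw [eq_frame (c := c) w, map_add, map_smul, map_smul]
    rfl
  rw [e2, e1, e1, integral_strip_upVec hF h.continuous hc, integral_strip_horVec hF h.lip hc,
    mul_neg, neg_add_eq_sub, ← integral_const_mul, ← integral_const_mul,
    ← integral_sub (i1.const_mul _) (i2.const_mul _), ← integral_indicator measurableSet_Ioo]
  congr 1; ext t
  by_cases ht : t ∈ Ioo (-a) a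
  · rw [indicator_of_mem ht, inner_sub_right, inner_smul_right]
    ring
  · have : graphCurve c φ t ∉ chartBox c φ a d := fun h' => ht (abs_lt.1 (graphMap_mem_chartBox.1 h').1)
    rw [indicator_of_notMem ht, hzero _ this]
    simp

end IsLipChart

/-- Convergence in mean square implies convergence of the pairing with a square integrable function.
-/
theorem tendsto_integral_mul {α : Type*} [MeasurableSpace α] {μ : Measure α} {g : ℕ → α → ℝ}
    {g₀ w : α → ℝ} (hg : ∀ k, MemLp (g k) 2 μ) (hg0 : MemLp g₀ 2 μ) (hw : MemLp w 2 μ)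
    (h : Tendsto (fun k => eLpNorm (g k - g₀) 2 μ) atTop (𝓝 0)) :
    Tendsto (fun k => ∫ x, g k x * w x ∂μ) atTop (𝓝 (∫ x, g₀ x * w x ∂μ)) := by
  rw [tendsto_iff_edist_tendsto_0]
  have hb : Tendsto (fun k => eLpNorm (g k - g₀) 2 μ * eLpNorm w 2 μ) atTop (𝓝 0) := by
    have := ENNReal.Tendsto.mul_const h (Or.inr hw.2.ne)
    simpa using this
  refine tendsto_of_tendsto_of_tendsto_of_le_of_le tendsto_const_nhds hb (fun _ => zero_le)
    fun k => ?_
  have i1 : Integrable (fun x => g k x * w x) μ := (hg k).integrable_mul hw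
  have i2 : Integrable (fun x => g₀ x * w x) μ := hg0.integrable_mul hw
  dsimp only
  rw [edist_eq_enorm_sub, ← integral_sub i1 i2]
  refine (enorm_integral_le_lintegral_enorm _).trans ?_
  have := eLpNorm_le_eLpNorm_mul_eLpNorm_of_nnnorm (p := 2) (q := 2) (r := 1)
    ((hg k).sub hg0).1 hw.1 (fun x y => x * y) 1 (ae_of_all _ fun x => by simp)
  rw [eLpNorm_one_eq_lintegral_enorm] at this
  simp only [ENNReal.coe_one, one_mul] at this
  refine le_trans (le_of_eq ?_) this
  refine lintegral_congr fun x => ?_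
  rw [Pi.sub_apply, sub_mul]

theorem memLp_of_continuous_compactSupport {w : Plane → ℝ} (hw : Continuous w)
    (hc : HasCompactSupport w) (μ : Measure Plane) [IsFiniteMeasureOnCompacts μ] : MemLp w 2 μ :=
  hw.memLp_of_hasCompactSupport hc

theorem inner_single (w : Plane) (i : Fin 2) : inner ℝ (EuclideanSpace.single i (1 : ℝ)) w = w i := by
  simp [EuclideanSpace.inner_single_left]

namespace IsLipChart

variable {f : Plane → ℝ} {F : Fin 2 → Plane → ℝ} {fs : ℝ → ℝ}

/-- The Gauss–Green formula in a chart, for a Sobolev function and a smooth test function. -/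
theorem gaussGreen (h : IsLipChart E c φ K a d) (hE : MeasurableSet E)
    (hf : MemH1 E f F) (ha0 : 0 < a') (ha : a' < a) (hd0 : 0 < d') (hd : d' < d)
    (hfs : MemLp fs 2 (volume.restrict (Ioo (-a') a')))
    (hlim : Tendsto (fun k => eLpNorm ((fun t => mollify (chartDir c K) k (E.indicator f)
        (graphCurve c φ t)) - fs) 2 (volume.restrict (Ioo (-a') a'))) atTop (𝓝 0))
    {ψ : Plane → ℝ} (hψ : ContDiff ℝ ∞ ψ) (hψc : HasCompactSupport ψ)
    (hψs : tsupport ψ ⊆ chartBox c φ a' d') (i : Fin 2) :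
    ∫ z in E, (F i z * ψ z + f z * fderiv ℝ ψ z (EuclideanSpace.single i 1))
      = ∫ t in Ioo (-a') a', fs t * (ψ (graphCurve c φ t)
        * (upVec c - deriv φ t • horVec c) i) := by
  have h' := h.mono ha0 ha.le hd0 hd.le
  set S : ℕ → (Plane → ℝ) → Plane → ℝ := fun k g => mollify (chartDir c K) k (E.indicator g) with hS
  have hfL := (memLp_indicator_iff_restrict hE).2 hf.memLp
  have hFL := fun i => (memLp_indicator_iff_restrict hE).2 (hf.partial_memLp i)
  have hcd : ∀ k, ContDiff ℝ ∞ (S k f) := fun k =>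
    contDiff_mollify (locallyIntegrable_indicator hE hf.memLp)
  have hcdF : ∀ k i, Continuous (S k (F i)) := fun k i =>
    (contDiff_mollify (locallyIntegrable_indicator hE (hf.partial_memLp i))).continuous
  have hψ1 : MemLp ψ 2 volume := memLp_of_continuous_compactSupport hψ.continuous hψc _
  have hdψc : Continuous fun z => fderiv ℝ ψ z (EuclideanSpace.single i 1) :=
    (hψ.continuous_fderiv (by simp)).clm_apply continuous_const
  have hdψs : HasCompactSupport fun z => fderiv ℝ ψ z (EuclideanSpace.single i 1) :=
    hψc.fderiv_apply ℝ _
  have hψ2 : MemLp (fun z => fderiv ℝ ψ z (EuclideanSpace.single i 1)) 2 volume :=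
    memLp_of_continuous_compactSupport hdψc hdψs _
  -- restrict everything to a compact set carrying the test function
  set Z := tsupport ψ
  have hZc : IsCompact Z := hψc
  have hSm : ∀ k (g : Plane → ℝ), Continuous (S k g) → MemLp (S k g) 2 (volume.restrict (E ∩ Z)) := by
    intro k g hg
    obtain ⟨C, hC⟩ := hZc.exists_bound_of_continuousOn hg.continuousOn
    have hfin : IsFiniteMeasure (volume.restrict (E ∩ Z)) := ⟨by
      rw [Measure.restrict_apply_univ]
      exact (measure_mono inter_subset_right).trans_lt hZc.measure_lt_top⟩
    refine MemLp.of_bound hg.aestronglyMeasurable C ?_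
    have hm : MeasurableSet (E ∩ Z) := hE.inter hZc.measurableSet
    filter_upwards [ae_restrict_mem hm] with z hz using hC z hz.2
  have hconv : ∀ g : Plane → ℝ, MemLp (E.indicator g) 2 volume → Tendsto (fun k =>
      eLpNorm (S k g - g) 2 (volume.restrict (E ∩ Z))) atTop (𝓝 0) := by
    intro g hg
    refine tendsto_of_tendsto_of_tendsto_of_le_of_le tendsto_const_nhds
      (tendsto_eLpNorm_mollify (v := chartDir c K) hg) (fun _ => zero_le) fun k => ?_
    refine le_trans (le_of_eq (eLpNorm_congr_ae ?_))
      (eLpNorm_mono_measure (S k g - E.indicator g) (Measure.restrict_le_self (s := E ∩ Z)))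
    have hm : MeasurableSet (E ∩ Z) := hE.inter hZc.measurableSet
    filter_upwards [ae_restrict_mem hm] with z hz
    rw [Pi.sub_apply, Pi.sub_apply, indicator_of_mem hz.1]
  have hrest : ∀ {g : Plane → ℝ}, MemLp g 2 (volume.restrict E) →
      MemLp g 2 (volume.restrict (E ∩ Z)) := fun hg =>
    hg.mono_measure (Measure.restrict_mono inter_subset_left le_rfl)
  have t1 := tendsto_integral_mul (fun k => hSm k (F i) (hcdF k i)) (hrest (hf.partial_memLp i))
    (hψ1.restrict _) (hconv (F i) (hFL i))
  have t2 := tendsto_integral_mul (fun k => hSm k f (hcd k).continuous) (hrest hf.memLp)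
    (hψ2.restrict _) (hconv f hfL)
  have hγ := continuous_graphCurve (c := c) h.continuous
  have hN : MemLp (fun t => ψ (graphCurve c φ t) * (upVec c - deriv φ t • horVec c) i) 2
      (volume.restrict (Ioo (-a') a')) := by
    obtain ⟨C, hC⟩ := hψ.continuous.bounded_above_of_compact_support hψc
    refine MemLp.of_bound ?_ (C * (1 + K)) ?_
    · refine ((hψ.continuous.comp hγ).measurable.mul ?_).aestronglyMeasurable
      have := measurable_deriv φ
      simp only [PiLp.sub_apply, PiLp.smul_apply, smul_eq_mul]
      fun_prop
    · refine ae_of_all _ fun t => ?_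
      rw [norm_mul]
      refine mul_le_mul (hC _) ?_ (norm_nonneg _) ((norm_nonneg _).trans (hC 0))
      refine (PiLp.norm_apply_le (p := 2) (upVec c - deriv φ t • horVec c) i).trans ?_
      refine (norm_sub_le _ _).trans ?_
      rw [norm_smul, norm_upVec, norm_horVec, mul_one]
      have : ‖deriv φ t‖ ≤ K := norm_deriv_le_of_lipschitz h.lip
      linarith
  have t3 := tendsto_integral_mul (fun k => memLp_Ioo_of_continuous
    ((hcd k).continuous.comp hγ) (-a') a') hfs hN hlim
  have hred : ∀ g : Plane → ℝ, (∀ z ∉ Z, g z = 0) → ∫ z in E ∩ Z, g z = ∫ z in E, g z := by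
    intro g hg
    rw [← integral_indicator hE, ← integral_indicator (hE.inter hZc.measurableSet)]
    congr 1; ext z
    by_cases hz : z ∈ Z
    · by_cases hzE : z ∈ E <;> simp [indicator, hz, hzE]
    · simp [indicator, hz, hg z hz]
  have hψ0 : ∀ z ∉ Z, ψ z = 0 := fun z hz => image_eq_zero_of_notMem_tsupport hz
  have hdψ0 : ∀ z ∉ Z, fderiv ℝ ψ z = 0 := fun z hz =>
    image_eq_zero_of_notMem_tsupport fun hz' => hz (tsupport_fderiv_subset ℝ hz')
  have hlhs : ∫ z in E, (F i z * ψ z + f z * fderiv ℝ ψ z (EuclideanSpace.single i 1))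
      = (∫ z in E ∩ Z, F i z * ψ z)
        + ∫ z in E ∩ Z, f z * fderiv ℝ ψ z (EuclideanSpace.single i 1) := by
    have i1 : Integrable (fun z => F i z * ψ z) (volume.restrict (E ∩ Z)) :=
      (hrest (hf.partial_memLp i)).integrable_mul (hψ1.restrict _)
    have i2 : Integrable (fun z => f z * fderiv ℝ ψ z (EuclideanSpace.single i 1))
      (volume.restrict (E ∩ Z)) := (hrest hf.memLp).integrable_mul (hψ2.restrict _)
    rw [← integral_add i1 i2]
    refine (hred _ fun z hz => ?_).symm
    rw [hψ0 z hz, hdψ0 z hz]; simp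
  -- The divergence theorem for the smooth function `S k f * ψ`.
  have hEk : ∀ᶠ k in atTop, (∫ z in E ∩ Z, S k (F i) z * ψ z)
        + ∫ z in E ∩ Z, S k f z * fderiv ℝ ψ z (EuclideanSpace.single i 1)
      = ∫ t in Ioo (-a') a', S k f (graphCurve c φ t) * (ψ (graphCurve c φ t)
        * (upVec c - deriv φ t • horVec c) i) := by
    filter_upwards [h.fderiv_mollify_eventually hE hf ha hd] with k hk
    have hprodc : ContDiff ℝ 1 fun z => S k f z * ψ z := ((hcd k).mul hψ).of_le (by simp)
    have hprods : tsupport (fun z => S k f z * ψ z) ⊆ chartBox c φ a' d' :=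
      (tsupport_mul_subset_right (f := S k f) (g := ψ)).trans hψs
    have := h'.setIntegral_fderiv hE hprodc hψc.mul_left hprods (EuclideanSpace.single i 1)
    simp only [inner_single] at this
    simp only [← mul_assoc] at this ⊢
    have i1 : Integrable (fun z => S k (F i) z * ψ z) (volume.restrict (E ∩ Z)) :=
      (hSm k (F i) (hcdF k i)).integrable_mul (hψ1.restrict _)
    have i2 : Integrable (fun z => S k f z * fderiv ℝ ψ z (EuclideanSpace.single i 1))
      (volume.restrict (E ∩ Z)) :=
      (hSm k f (hcd k).continuous).integrable_mul (hψ2.restrict _)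
    rw [← this, ← integral_add i1 i2]
    have hfd : ∀ z, fderiv ℝ (fun z => S k f z * ψ z) z (EuclideanSpace.single i 1)
        = S k f z * fderiv ℝ ψ z (EuclideanSpace.single i 1)
          + ψ z * fderiv ℝ (S k f) z (EuclideanSpace.single i 1) := by
      intro z
      have := fderiv_mul ((hcd k).differentiable (by simp) z) (hψ.differentiable (by simp) z)
      change fderiv ℝ (fun z => S k f z * ψ z) z = _ at this
      rw [this]; simp
    simp only [hfd]
    rw [← hred]
    · refine setIntegral_congr_fun (hE.inter hZc.measurableSet) fun z hz => ?_
      have hzb := hψs hz.2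
      obtain ⟨q, rfl⟩ := (graphHomeo c φ h.continuous).surjective z
      change graphMap c φ q ∈ _ at hzb
      have hq := graphMap_mem_chartBox.1 hzb
      have hpos : 0 < q.2 := (h'.mem_iff q.1 q.2 hq.1 hq.2).1 hz.1
      have := hk q.1 q.2 hq.1 hpos.le ((le_abs_self _).trans_lt hq.2) i
      change S k (F i) (graphMap c φ q) * ψ (graphMap c φ q) + _
        = _ + ψ (graphMap c φ q) * fderiv ℝ (S k f) (graphMap c φ q) _
      change fderiv ℝ (S k f) (graphMap c φ q) _ = S k (F i) (graphMap c φ q) at this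
      rw [this]
      change S k (F i) (graphMap c φ q) * ψ (graphMap c φ q)
        + S k f (graphMap c φ q) * _ = S k f (graphMap c φ q) * _ + _
      ring
    · intro z hz
      rw [hψ0 z hz, hdψ0 z hz]; simp
  rw [hlhs]
  exact tendsto_nhds_unique ((t1.add t2).congr' hEk) t3

end IsLipChart

end

section

open scoped ENNReal

variable {c : Plane ≃ᵃⁱ[ℝ] Plane} {φ : ℝ → ℝ} {E : Set Plane} {K : NNReal} {a d a' d' : ℝ}

/-! ### Traces and the Gauss–Green formula -/

/-- `trace` is defined as a `limUnder`; this is its value where the limit exists. -/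
theorem HasTraceAt.trace_eq {w : Plane → ℝ} {x : Plane} {t : ℝ} (h : HasTraceAt E w x t) :
    trace E w x = t := Tendsto.limUnder_eq h

theorem IsLipChart.graphCurve_coord (h : IsLipChart E c φ K a d) {x : Plane}
    (hx : x ∈ frontier E ∩ chartBox c φ a d) : graphCurve c φ (c x 0) = x := by
  rw [h.frontier_inter] at hx
  obtain ⟨t, -, rfl⟩ := hx
  rw [coord_graphCurve_zero]

/-- A property which holds almost everywhere on the boundary in each chart holds almost everywhere
on the boundary. -/
theorem ae_frontier_of_charts {p : Plane → Prop} (hE : HasLipschitzBoundary E)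
    (hp : ∀ c φ K a d a' d', IsLipChart E c φ K a d → 0 < a' → a' < a → 0 < d' → d' < d →
      ∀ᵐ t ∂volume.restrict (Ioo (-a') a'), p (graphCurve c φ t)) :
    ∀ᵐ x ∂arcLength.restrict (frontier E), p x := by
  rw [ae_restrict_iff' isClosed_frontier.measurableSet, ae_iff]
  refine measure_null_of_locally_null _ fun x hx => ?_
  have hxE : x ∈ frontier E := by
    simp only [mem_ofPred_eq, Classical.not_imp] at hx
    exact hx.1
  obtain ⟨c, φ, K, a, d, a', d', h, h0, h1, ha, hd, hxb⟩ := exists_isLipChart hE hxE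
  have h' := h.mono h0 ha.le h1 hd.le
  have hae := h'.ae_iff.2 (hp c φ K a d a' d' h h0 ha h1 hd)
  rw [ae_restrict_iff' (isClosed_frontier.measurableSet.inter h'.isOpen_chartBox.measurableSet),
    ae_iff] at hae
  refine ⟨_ ∩ chartBox c φ a' d', inter_mem_nhdsWithin _ (h'.isOpen_chartBox.mem_nhds hxb),
    measure_mono_null ?_ hae⟩
  rintro y ⟨hy1, hy2⟩
  simp only [mem_ofPred_eq, Classical.not_imp] at hy1 ⊢
  exact ⟨⟨hy1.1, hy2⟩, hy1.2⟩

theorem MemLp.restrict_union {α : Type*} [MeasurableSpace α] {μ : Measure α} {g : α → ℝ}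
    {s t : Set α} (hs : MemLp g 2 (μ.restrict s)) (ht : MemLp g 2 (μ.restrict t)) :
    MemLp g 2 (μ.restrict (s ∪ t)) := by
  have hm := aestronglyMeasurable_union_iff.2 ⟨hs.1, ht.1⟩
  rw [memLp_two_iff_integrable_sq hm]
  exact IntegrableOn.union ((memLp_two_iff_integrable_sq hs.1).1 hs)
    ((memLp_two_iff_integrable_sq ht.1).1 ht)

/-- Square integrability on the boundary can be checked in charts. -/
theorem memLp_frontier_of_charts {g : Plane → ℝ} (hE : HasLipschitzBoundary E)
    (hb : Bornology.IsBounded E)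
    (hp : ∀ c φ K a d a' d', IsLipChart E c φ K a d → 0 < a' → a' < a → 0 < d' → d' < d →
      MemLp (fun t => g (graphCurve c φ t)) 2 (volume.restrict (Ioo (-a') a'))) :
    MemLp g 2 (arcLength.restrict (frontier E)) := by
  have hc : IsCompact (frontier E) := hb.isCompact_closure.of_isClosed_subset isClosed_frontier
    frontier_subset_closure
  refine hc.induction_on (p := fun s => MemLp g 2 (arcLength.restrict s)) (by simp)
    (fun s t hst ht => ht.mono_measure (Measure.restrict_mono hst le_rfl))
    (fun s t hs ht => MemLp.restrict_union hs ht) fun x hx => ?_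
  obtain ⟨c, φ, K, a, d, a', d', h, h0, h1, ha, hd, hxb⟩ := exists_isLipChart hE hx
  have h' := h.mono h0 ha.le h1 hd.le
  refine ⟨frontier E ∩ chartBox c φ a' d', inter_mem_nhdsWithin _ (h'.isOpen_chartBox.mem_nhds hxb),
    (memLp_congr_ae ?_).1 (h'.memLp_comp (hp c φ K a d a' d' h h0 ha h1 hd))⟩
  filter_upwards [ae_restrict_mem (isClosed_frontier.measurableSet.inter
    h'.isOpen_chartBox.measurableSet)] with y hy
  rw [h'.graphCurve_coord hy]

theorem norm_outwardNormal_le (E : Set Plane) (x : Plane) : ‖outwardNormal E x‖ ≤ 1 := by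
  unfold outwardNormal
  split_ifs with h
  · exact h.choose_spec.1.le
  · simp

theorem abs_outwardNormal_le (E : Set Plane) (x : Plane) (i : Fin 2) :
    |outwardNormal E x i| ≤ 1 :=
  (PiLp.norm_apply_le (p := 2) (outwardNormal E x) i).trans (norm_outwardNormal_le E x)

/-- In a chart, the chosen outward normal agrees almost everywhere with the measurable expression in
terms of `φ'`. -/
theorem aestronglyMeasurable_outwardNormal (hE : HasLipschitzBoundary E)
    (hb : Bornology.IsBounded E) (i : Fin 2) :
    AEStronglyMeasurable (fun x => outwardNormal E x i) (arcLength.restrict (frontier E)) := by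
  refine MemLp.aestronglyMeasurable (p := 2)
    (memLp_frontier_of_charts hE hb fun c φ K a d a' d' h h0 ha h1 hd => ?_)
  have h' := h.mono h0 ha.le h1 hd.le
  refine MemLp.of_bound ?_ 1 (ae_of_all _ fun t => abs_outwardNormal_le E _ i)
  have hm : Measurable fun t => (graphSpeed φ t)⁻¹ * (upVec c i - deriv φ t * horVec c i) :=
    measurable_graphSpeed.inv.mul
      (measurable_const.sub ((measurable_deriv φ).mul measurable_const))
  refine hm.aestronglyMeasurable.congr ?_
  filter_upwards [h'.ae_outwardNormal] with t ht
  have := congrArg (fun v : Plane => v i) ht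
  simp only [PiLp.smul_apply, PiLp.sub_apply, smul_eq_mul] at this
  rw [← this, ← mul_assoc, inv_mul_cancel₀ (graphSpeed_pos t).ne', one_mul]

section Trace

variable {f : Plane → ℝ} {F : Fin 2 → Plane → ℝ}

/-- In a chart, the trace is the limit in `L²` of the mollifications on the boundary. -/
theorem IsLipChart.tendsto_trace (h : IsLipChart E c φ K a d) (hE : MeasurableSet E)
    (hf : MemH1 E f F) (ha : a' < a) (h1 : 0 < d') (hd : d' < d) :
    MemLp (fun t => trace E f (graphCurve c φ t)) 2 (volume.restrict (Ioo (-a') a')) ∧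
    Tendsto (fun k => eLpNorm ((fun t => mollify (chartDir c K) k (E.indicator f)
        (graphCurve c φ t)) - fun t => trace E f (graphCurve c φ t)) 2
        (volume.restrict (Ioo (-a') a'))) atTop (𝓝 0) ∧
    ∀ᵐ t ∂volume.restrict (Ioo (-a') a'),
      HasTraceAt E f (graphCurve c φ t) (trace E f (graphCurve c φ t)) := by
  obtain ⟨fs, hfs, hlim⟩ := h.exists_trace_limit hE hf ha h1 hd
  have htr := h.ae_hasTraceAt hE hf ha h1 hd hfs hlim
  have heq : fs =ᵐ[volume.restrict (Ioo (-a') a')] fun t => trace E f (graphCurve c φ t) := by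
    filter_upwards [htr] with t ht using ht.trace_eq.symm
  refine ⟨(memLp_congr_ae heq).1 hfs, hlim.congr fun k => eLpNorm_congr_ae ?_, ?_⟩
  · exact EventuallyEq.rfl.sub heq
  · filter_upwards [htr] with t ht
    rw [ht.trace_eq]; exact ht

theorem MemH1.ae_hasTraceAt (hf : MemH1 E f F) (hE : MeasurableSet E)
    (hL : HasLipschitzBoundary E) :
    ∀ᵐ x ∂arcLength.restrict (frontier E), HasTraceAt E f x (trace E f x) :=
  ae_frontier_of_charts hL fun _ _ _ _ _ _ _ h _ ha h1 hd =>
    (h.tendsto_trace hE hf ha h1 hd).2.2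

theorem MemH1.memLp_trace (hf : MemH1 E f F) (hE : MeasurableSet E)
    (hL : HasLipschitzBoundary E) (hb : Bornology.IsBounded E) :
    MemLp (trace E f) 2 (arcLength.restrict (frontier E)) :=
  memLp_frontier_of_charts hL hb fun _ _ _ _ _ _ _ h _ ha h1 hd =>
    (h.tendsto_trace hE hf ha h1 hd).1

theorem memLp_mul_of_bound {α : Type*} [MeasurableSpace α] {μ : Measure α} {g w : α → ℝ}
    (hg : MemLp g 2 μ) (hw : AEStronglyMeasurable w μ) {C : ℝ} (hC : ∀ᵐ x ∂μ, |w x| ≤ C) :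
    MemLp (fun x => g x * w x) 2 μ := by
  refine MemLp.of_le_mul (c := C) hg (hg.1.mul hw) ?_
  filter_upwards [hC] with x hx
  rw [norm_mul, mul_comm]
  exact mul_le_mul_of_nonneg_right hx (norm_nonneg _)

theorem memLp_continuous_frontier (hL : HasLipschitzBoundary E) (hb : Bornology.IsBounded E)
    {ψ : Plane → ℝ} (hψ : Continuous ψ) : MemLp ψ 2 (arcLength.restrict (frontier E)) := by
  have hc : IsCompact (frontier E) := hb.isCompact_closure.of_isClosed_subset isClosed_frontier
    frontier_subset_closure
  obtain ⟨C, hC⟩ := hc.exists_bound_of_continuousOn hψ.continuousOn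
  have hfin : IsFiniteMeasure (arcLength.restrict (frontier E)) := ⟨by
    rw [Measure.restrict_apply_univ]; exact arcLength_frontier_lt_top hL hb⟩
  refine MemLp.of_bound hψ.aestronglyMeasurable C ?_
  filter_upwards [ae_restrict_mem isClosed_frontier.measurableSet] with z hz using hC z hz

theorem memLp_continuous_of_bounded (hb : Bornology.IsBounded E) (hE : MeasurableSet E)
    {ψ : Plane → ℝ} (hψ : Continuous ψ) : MemLp ψ 2 (volume.restrict E) := by
  obtain ⟨C, hC⟩ := hb.isCompact_closure.exists_bound_of_continuousOn hψ.continuousOn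
  have hfin : IsFiniteMeasure (volume.restrict E) := ⟨by
    rw [Measure.restrict_apply_univ]; exact hb.measure_lt_top⟩
  refine MemLp.of_bound hψ.aestronglyMeasurable C ?_
  filter_upwards [ae_restrict_mem hE] with z hz using hC z (subset_closure hz)

theorem memLp_continuous_mul_outwardNormal (hL : HasLipschitzBoundary E)
    (hb : Bornology.IsBounded E) {ψ : Plane → ℝ} (hψ : Continuous ψ) (i : Fin 2) :
    MemLp (fun x => ψ x * outwardNormal E x i) 2 (arcLength.restrict (frontier E)) :=
  memLp_mul_of_bound (memLp_continuous_frontier hL hb hψ)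
    (aestronglyMeasurable_outwardNormal hL hb i) (ae_of_all _ fun x => abs_outwardNormal_le E x i)

/-- The **Gauss–Green formula** on a bounded Lipschitz domain. -/
theorem MemH1.gaussGreen (hf : MemH1 E f F) (hE : IsOpen E) (hL : HasLipschitzBoundary E)
    (hb : Bornology.IsBounded E) {ψ : Plane → ℝ} (hψ : ContDiff ℝ ∞ ψ) (hψc : HasCompactSupport ψ)
    (i : Fin 2) :
    ∫ z in E, (F i z * ψ z + f z * fderiv ℝ ψ z (EuclideanSpace.single i 1))
      = ∫ x in frontier E, trace E f x * (ψ x * outwardNormal E x i) ∂arcLength := by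
  have hEm := hE.measurableSet
  have hdc : ∀ {ψ : Plane → ℝ}, ContDiff ℝ ∞ ψ →
      Continuous fun z => fderiv ℝ ψ z (EuclideanSpace.single i 1) := fun hψ =>
    (hψ.continuous_fderiv (by simp)).clm_apply continuous_const
  have i1 : ∀ {ψ : Plane → ℝ}, ContDiff ℝ ∞ ψ →
      Integrable (fun z => F i z * ψ z) (volume.restrict E) := fun hψ =>
    (hf.partial_memLp i).integrable_mul (memLp_continuous_of_bounded hb hEm hψ.continuous)
  have i2 : ∀ {ψ : Plane → ℝ}, ContDiff ℝ ∞ ψ → Integrable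
      (fun z => f z * fderiv ℝ ψ z (EuclideanSpace.single i 1)) (volume.restrict E) := fun hψ =>
    hf.memLp.integrable_mul (memLp_continuous_of_bounded hb hEm (hdc hψ))
  have i3 : ∀ {ψ : Plane → ℝ}, ContDiff ℝ ∞ ψ → Integrable
      (fun x => trace E f x * (ψ x * outwardNormal E x i)) (arcLength.restrict (frontier E)) :=
    fun hψ => (hf.memLp_trace hEm hL hb).integrable_mul
      (memLp_continuous_mul_outwardNormal hL hb hψ.continuous i)
  refine localise_test_functions (m := ∞) le_rfl (Q := fun ψ =>
    ∫ z in E, (F i z * ψ z + f z * fderiv ℝ ψ z (EuclideanSpace.single i 1))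
      = ∫ x in frontier E, trace E f x * (ψ x * outwardNormal E x i) ∂arcLength)
    (by simp) ?_ univ ?_ hψ hψc (subset_univ _)
  · intro ψ₁ ψ₂ h1 _ h2 _ e1 e2
    have hL1 : ∀ z, F i z * (ψ₁ + ψ₂) z + f z * fderiv ℝ (ψ₁ + ψ₂) z (EuclideanSpace.single i 1)
        = (F i z * ψ₁ z + f z * fderiv ℝ ψ₁ z (EuclideanSpace.single i 1))
          + (F i z * ψ₂ z + f z * fderiv ℝ ψ₂ z (EuclideanSpace.single i 1)) := by
      intro z
      rw [fderiv_add (h1.differentiable (by simp) z) (h2.differentiable (by simp) z)]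
      simp; ring
    have hR1 : ∀ x, trace E f x * ((ψ₁ + ψ₂) x * outwardNormal E x i)
        = trace E f x * (ψ₁ x * outwardNormal E x i)
          + trace E f x * (ψ₂ x * outwardNormal E x i) := by
      intro x; simp; ring
    simp only [hL1, hR1]
    rw [integral_add (f := fun z => F i z * ψ₁ z + f z * fderiv ℝ ψ₁ z (EuclideanSpace.single i 1))
      (g := fun z => F i z * ψ₂ z + f z * fderiv ℝ ψ₂ z (EuclideanSpace.single i 1))
      ((i1 h1).add (i2 h1)) ((i1 h2).add (i2 h2)), integral_add (i3 h1) (i3 h2), e1, e2]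
  -- A test function with small support lives in a chart, inside `E`, or outside `closure E`.
  · intro x _
    by_cases hxF : x ∈ frontier E
    · obtain ⟨c, φ, K, a, d, a', d', h, h0, h1, ha, hd, hxb⟩ := exists_isLipChart hL hxF
      have h' := h.mono h0 ha.le h1 hd.le
      refine ⟨_, h'.isOpen_chartBox, hxb, fun ψ hψ hψc hψs => ?_⟩
      obtain ⟨t1, t2, -⟩ := h.tendsto_trace hEm hf ha h1 hd
      rw [h.gaussGreen hEm hf h0 ha h1 hd t1 t2 hψ hψc hψs i]
      rw [setIntegral_eq_of_subset_of_forall_sdiff_eq_zero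
        (s := frontier E ∩ chartBox c φ a' d') isClosed_frontier.measurableSet inter_subset_left,
        h'.setIntegral_eq]
      · refine integral_congr_ae ?_
        filter_upwards [h'.ae_outwardNormal] with t ht
        have := congrArg (fun v : Plane => v i) ht
        dsimp only at this ⊢
        rw [← this, PiLp.smul_apply, smul_eq_mul]
        ring
      · rintro y ⟨hy1, hy2⟩
        have : ψ y = 0 := image_eq_zero_of_notMem_tsupport fun hy => hy2 ⟨hy1, hψs hy⟩
        simp [this]
    · by_cases hxE : x ∈ E
      · refine ⟨E, hE, hxE, fun ψ hψ hψc hψs => ?_⟩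
        rw [integral_add (i1 hψ) (i2 hψ), (hf.weak i).2.2 ψ hψ hψc hψs, add_neg_cancel]
        symm
        refine setIntegral_eq_zero_of_forall_eq_zero fun y hy => ?_
        have : ψ y = 0 := image_eq_zero_of_notMem_tsupport fun hy' => by
          rw [hE.frontier_eq] at hy
          exact hy.2 (hψs hy')
        simp [this]
      · have hxc : x ∉ closure E := fun hx => hxF (by rw [hE.frontier_eq]; exact ⟨hx, hxE⟩)
        refine ⟨(closure E)ᶜ, isClosed_closure.isOpen_compl, hxc, fun ψ hψ hψc hψs => ?_⟩
        have h0 : ∀ y ∈ closure E, y ∉ tsupport ψ := fun y hy hy' => hψs hy' hy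
        rw [setIntegral_eq_zero_of_forall_eq_zero, setIntegral_eq_zero_of_forall_eq_zero]
        · intro y hy
          simp [image_eq_zero_of_notMem_tsupport (h0 y (frontier_subset_closure hy))]
        · intro y hy
          have h2 := h0 y (subset_closure hy)
          have h3 : fderiv ℝ ψ y = 0 :=
            image_eq_zero_of_notMem_tsupport fun hy' => h2 (tsupport_fderiv_subset ℝ hy')
          simp [image_eq_zero_of_notMem_tsupport h2, h3]

end Trace

end

section

open scoped ENNReal

variable {c : Plane ≃ᵃⁱ[ℝ] Plane} {φ : ℝ → ℝ} {E : Set Plane} {K : NNReal} {a d a' d' : ℝ}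

/-! ### Boundary values of functions with a finite Gagliardo seminorm -/

theorem mollify_sub_const {v : Plane} {k : ℕ} {f : Plane → ℝ} (hf : LocallyIntegrable f) (b : ℝ)
    (z : Plane) : mollify v k f z - b = mollify v k (fun y => f y - b) z := by
  have h1 := integrable_kernel_mul (continuous_molKernel k) (hasCompactSupport_molKernel k) hf
    (z - molScale k • v)
  have h2 : Integrable fun y => molKernel k (z - molScale k • v - y) := by
    have := integrable_kernel_mul (continuous_molKernel k) (hasCompactSupport_molKernel k)
      (locallyIntegrable_const (1 : ℝ)) (z - molScale k • v)
    simpa using this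
  have h3 : ∫ y, molKernel k (z - molScale k • v - y) = 1 := by
    rw [integral_sub_left_eq_self (fun y => molKernel k y), integral_molKernel]
  simp only [mollify, mul_sub]
  rw [integral_sub h1 (h2.mul_const b), integral_mul_const, h3, one_mul]

/-- The square of the difference of two averages is at most the average of the squared
differences. -/
theorem enorm_mollify_sub_mollify_sq_le {v : Plane} {k l : ℕ} {f : Plane → ℝ}
    (hf : LocallyIntegrable f) (z : Plane) :
    ‖mollify v k f z - mollify v l f z‖ₑ ^ 2
      ≤ ∫⁻ y, ∫⁻ y', ENNReal.ofReal (molKernel k (z - molScale k • v - y))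
        * ENNReal.ofReal (molKernel l (z - molScale l • v - y')) * ‖f y - f y'‖ₑ ^ 2 := by
  have hm := hf.aestronglyMeasurable
  rw [mollify_sub_const hf]
  refine (enorm_mollify_sq_le (hm.sub aestronglyMeasurable_const) z).trans
    (lintegral_mono fun y => ?_)
  have : ‖f y - mollify v l f z‖ₑ ^ 2 ≤
      ∫⁻ y', ENNReal.ofReal (molKernel l (z - molScale l • v - y')) * ‖f y - f y'‖ₑ ^ 2 := by
    rw [← enorm_neg, neg_sub, mollify_sub_const hf]
    refine (enorm_mollify_sq_le (hm.sub aestronglyMeasurable_const) z).trans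
      (le_of_eq (lintegral_congr fun y' => ?_))
    rw [← enorm_neg (f y - f y'), neg_sub]
    rfl
  refine (mul_le_mul' le_rfl this).trans ?_
  rw [← lintegral_const_mul' _ _ ENNReal.ofReal_ne_top]
  exact le_of_eq (lintegral_congr fun y' => (mul_assoc _ _ _).symm)

/-- A sequence in `L²` whose consecutive differences decay geometrically converges. -/
theorem exists_tendsto_eLpNorm_of_geometric {α : Type*} [MeasurableSpace α] {μ : Measure α}
    {g : ℕ → α → ℝ} (hg : ∀ k, MemLp (g k) 2 μ) {C r : ℝ≥0∞} (hC : C ≠ ⊤) (hr : r < 1)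
    (h : ∀ᶠ k in atTop, eLpNorm (g k - g (k + 1)) 2 μ ≤ C * r ^ k) :
    ∃ f, MemLp f 2 μ ∧ Tendsto (fun k => eLpNorm (g k - f) 2 μ) atTop (𝓝 0) := by
  obtain ⟨N, hN⟩ := eventually_atTop.1 h
  have hcs : CauchySeq fun k => (hg (k + N)).toLp (g (k + N)) := by
    refine cauchySeq_of_edist_le_geometric r C hr hC fun n => ?_
    rw [Lp.edist_toLp_toLp, add_right_comm]
    refine (hN (n + N) (by omega)).trans (mul_le_mul' le_rfl ?_)
    exact pow_le_pow_right_of_le_one' hr.le (by omega)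
  obtain ⟨f, hf⟩ := cauchySeq_tendsto_of_complete hcs
  refine ⟨f, Lp.memLp f, (tendsto_add_atTop_iff_nat N).1 ?_⟩
  rw [Lp.tendsto_Lp_iff_tendsto_eLpNorm'] at hf
  refine hf.congr fun k => eLpNorm_congr_ae ?_
  filter_upwards [(hg (k + N)).coeFn_toLp] with x hx
  rw [Pi.sub_apply, Pi.sub_apply, hx]

/-- The integrand of the Gagliardo seminorm. -/
def gagliardoKernel (σ : ℝ) (f : Plane → ℝ) (x y : Plane) : ℝ≥0∞ :=
  ENNReal.ofReal ((f x - f y) ^ 2 / ‖x - y‖ ^ (2 + 2 * σ))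

theorem enorm_sub_sq_le_gagliardoKernel {σ R : ℝ} (hσ : 0 < σ) (f : Plane → ℝ) {x y : Plane}
    (hxy : ‖x - y‖ ≤ R) :
    ‖f x - f y‖ₑ ^ 2 ≤ ENNReal.ofReal (R ^ (2 + 2 * σ)) * gagliardoKernel σ f x y := by
  rw [Real.enorm_eq_ofReal_abs, ← ENNReal.ofReal_pow (abs_nonneg _), sq_abs, gagliardoKernel,
    ← ENNReal.ofReal_mul (Real.rpow_nonneg ((norm_nonneg _).trans hxy) _)]
  refine ENNReal.ofReal_le_ofReal ?_
  rcases (norm_nonneg (x - y)).eq_or_lt with h0 | h0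
  · rw [eq_comm, norm_eq_zero, sub_eq_zero] at h0
    subst h0
    simp
  · have h1 : 0 < ‖x - y‖ ^ (2 + 2 * σ) := Real.rpow_pos_of_pos h0 _
    have h2 : ‖x - y‖ ^ (2 + 2 * σ) ≤ R ^ (2 + 2 * σ) :=
      Real.rpow_le_rpow h0.le hxy (by linarith)
    rw [mul_div_assoc', le_div_iff₀ h1, mul_comm]
    exact mul_le_mul_of_nonneg_right h2 (sq_nonneg _)

theorem aemeasurable_gagliardoKernel {σ : ℝ} {f : Plane → ℝ}
    (hf : AEStronglyMeasurable f (volume.restrict E)) :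
    AEMeasurable (fun p : Plane × Plane => gagliardoKernel σ f p.1 p.2)
      ((volume.restrict E).prod (volume.restrict E)) := by
  have h1 := (hf.comp_fst (ν := volume.restrict E)).aemeasurable
  have h2 := (hf.comp_snd (μ := volume.restrict E)).aemeasurable
  unfold gagliardoKernel
  fun_prop

/-- The difference of two consecutive mollifications at a point is dominated by the Gagliardo
kernel, integrated over the points whose horizontal coordinate is close to that of the point. -/
theorem enorm_mollify_sub_succ_sq_le (hE : MeasurableSet E) {f : Plane → ℝ}
    (hf : MemLp f 2 (volume.restrict E)) {σ : ℝ} (hσ : 0 < σ) {C : ℝ} (hC0 : 0 ≤ C)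
    (hC : ∀ k z, molKernel k z ≤ C / molScale k ^ 2) {k : ℕ} {z x x' v : Plane} {t : ℝ}
    (hz : c z 0 = t) (hx : x = z - molScale k • v) (hx' : x' = z - molScale (k + 1) • v)
    (hcx : c x 0 = c z 0)
    (hb : Metric.closedBall x (molScale k) ⊆ E)
    (hb' : Metric.closedBall x' (molScale (k + 1)) ⊆ E) :
    ‖mollify v k (E.indicator f) z - mollify v (k + 1) (E.indicator f) z‖ₑ ^ 2
      ≤ ∫⁻ y in E, ENNReal.ofReal (C / molScale k ^ 2 * (C / molScale (k + 1) ^ 2)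
          * ((2 + ‖v‖) * molScale k) ^ (2 + 2 * σ))
        * ({p : ℝ × Plane | |p.1 - c p.2 0| ≤ molScale k}.indicator (fun _ => (1 : ℝ≥0∞)) (t, y)
          * ∫⁻ y' in E, gagliardoKernel σ f y y') := by
  have hloc := locallyIntegrable_indicator hE hf
  have hε := molScale_pos k
  have hε1 := molScale_succ k
  refine (enorm_mollify_sub_mollify_sq_le hloc _).trans ?_
  rw [← lintegral_indicator hE]
  rw [← hx, ← hx']
  set D : Set (ℝ × Plane) := {p : ℝ × Plane | |p.1 - c p.2 0| ≤ molScale k} with hD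
  refine lintegral_mono fun y => ?_
  by_cases hy : y ∈ Metric.closedBall x (molScale k)
  · rw [indicator_of_mem (hb hy), indicator_of_mem (hb hy)]
    have hyn : ‖x - y‖ ≤ molScale k := by rwa [← dist_eq_norm, dist_comm]
    have hDy : (t, y) ∈ D := by
      have h1 := (abs_coord_sub_le (c := c) x y 0).trans hyn
      rw [hcx, hz] at h1
      exact h1
    rw [indicator_of_mem hDy, one_mul, ← lintegral_const_mul' _ _ ENNReal.ofReal_ne_top,
      ← lintegral_indicator hE]
    refine lintegral_mono fun y' => ?_
    by_cases hy' : y' ∈ Metric.closedBall x' (molScale (k + 1))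
    · rw [indicator_of_mem (hb' hy'), indicator_of_mem (hb' hy')]
      have hyn' : ‖x' - y'‖ ≤ molScale k / 2 := by rw [← hε1]; rwa [← dist_eq_norm, dist_comm]
      have hdist : ‖y - y'‖ ≤ (2 + ‖v‖) * molScale k := by
        have e1 : y - y' = -(x - y) + (x' - y') + (-(molScale k / 2)) • v := by
          rw [hx, hx', hε1]
          have : (-(molScale k / 2)) • v = (molScale k / 2) • v - molScale k • v := by
            rw [← sub_smul]; congr 1; ring
          rw [this]; abel
        rw [e1]
        refine (norm_add₃_le).trans ?_
        rw [norm_neg, norm_smul, Real.norm_eq_abs, abs_neg, abs_of_pos (half_pos hε)]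
        have : 0 ≤ ‖v‖ := norm_nonneg _
        nlinarith
      calc _ ≤ ENNReal.ofReal (C / molScale k ^ 2) * ENNReal.ofReal (C / molScale (k + 1) ^ 2)
            * (ENNReal.ofReal (((2 + ‖v‖) * molScale k) ^ (2 + 2 * σ)) * gagliardoKernel σ f y y') :=
            mul_le_mul' (mul_le_mul' (ENNReal.ofReal_le_ofReal (hC _ _))
              (ENNReal.ofReal_le_ofReal (hC _ _))) (enorm_sub_sq_le_gagliardoKernel hσ f hdist)
        _ = _ := by
          rw [ENNReal.ofReal_mul (by positivity), ENNReal.ofReal_mul (by positivity)]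
          ring
    · have : molKernel (k + 1) (x' - y') = 0 := molKernel_eq_zero (by
        rw [Metric.mem_closedBall, dist_comm, dist_eq_norm, not_le] at hy'; exact hy')
      rw [this]; simp
  · have : molKernel k (x - y) = 0 := molKernel_eq_zero (by
      rw [Metric.mem_closedBall, dist_comm, dist_eq_norm, not_le] at hy; exact hy)
    rw [this]; simp

namespace IsLipChart

/-- Consecutive mollifications differ, on the boundary, by a power of the scale. -/
theorem lintegral_mollify_sub_succ_le (h : IsLipChart E c φ K a d) (hE : MeasurableSet E)
    {f : Plane → ℝ} (hf : MemLp f 2 (volume.restrict E)) {σ : ℝ} (hσ : 0 < σ) (ha : a' < a)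
    (hd0 : 0 < d) :
    ∃ M : ℝ, 0 ≤ M ∧ ∀ᶠ k in atTop, ∫⁻ t in Ioo (-a') a',
      ‖mollify (chartDir c K) k (E.indicator f) (graphCurve c φ t)
        - mollify (chartDir c K) (k + 1) (E.indicator f) (graphCurve c φ t)‖ₑ ^ 2
      ≤ ENNReal.ofReal (M * molScale k ^ (2 * σ - 1)) * gagliardoSq E σ f := by
  obtain ⟨C, hC0, hC⟩ := exists_molKernel_le
  set v := chartDir c K with hv
  set R : ℝ := 2 + ‖v‖ with hR
  have hR0 : 0 < R := by positivity
  refine ⟨C * (C * 4) * R ^ (2 + 2 * σ) * 2, by positivity, ?_⟩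
  have hcb : ∀ᶠ k in atTop, ∀ t, |t| < a' →
      Metric.closedBall (graphCurve c φ t - molScale k • v) (molScale k) ⊆ E := by
    filter_upwards [h.closedBall_subset (d' := d / 2) ha (by linarith)] with k hk t ht
    exact hk t 0 ht le_rfl (half_pos hd0)
  obtain ⟨N, hN⟩ := eventually_atTop.1 hcb
  filter_upwards [eventually_ge_atTop N] with k hkN
  have hk := hN k hkN
  have hk1 := hN (k + 1) (by omega)
  have hε := molScale_pos k
  have hε1 := molScale_succ k
  set M : ℝ := C / molScale k ^ 2 * (C / molScale (k + 1) ^ 2) * (R * molScale k) ^ (2 + 2 * σ) with hM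
  have hM0 : 0 ≤ M := by positivity
  have hloc := locallyIntegrable_indicator hE hf
  set w : Plane → ℝ≥0∞ := fun y => ∫⁻ y' in E, gagliardoKernel σ f y y' with hw
  have hwm : AEMeasurable w (volume.restrict E) :=
    (aemeasurable_gagliardoKernel hf.1).lintegral_prod_right'
  set D : Set (ℝ × Plane) := {p | |p.1 - c p.2 0| ≤ molScale k} with hD
  have hc0 := continuous_coord (c := c) 0
  have hDm : MeasurableSet D :=
    (isClosed_le (continuous_fst.sub (hc0.comp continuous_snd)).abs continuous_const).measurableSet
  have hpt : ∀ t ∈ Ioo (-a') a',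
      ‖mollify v k (E.indicator f) (graphCurve c φ t)
        - mollify v (k + 1) (E.indicator f) (graphCurve c φ t)‖ₑ ^ 2
      ≤ ∫⁻ y in E, ENNReal.ofReal M * (D.indicator (fun _ => (1 : ℝ≥0∞)) (t, y) * w y) := by
    intro t ht
    have ht' := abs_lt.2 ht
    have hcx : c (graphCurve c φ t - molScale k • v) 0 = c (graphCurve c φ t) 0 := by
      have h2 := (coord_add_frame (c := c) (graphCurve c φ t) 0 (-(molScale k * (K + 2)))).1
      have h3 : graphCurve c φ t + (0 : ℝ) • horVec c + (-(molScale k * (K + 2))) • upVec c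
          = graphCurve c φ t - molScale k • v := by
        rw [hv, chartDir, smul_smul, zero_smul, add_zero, neg_smul, sub_eq_add_neg]
      rw [h3, add_zero] at h2
      exact h2
    exact enorm_mollify_sub_succ_sq_le hE hf hσ hC0 hC (coord_graphCurve_zero (c := c) t) rfl rfl
      hcx (hk t ht') (hk1 t ht')
  refine (setLIntegral_mono' measurableSet_Ioo hpt).trans ?_
  have hJ : volume.restrict (Ioo (-a') a') ≤ (volume : Measure ℝ) := Measure.restrict_le_self
  refine (lintegral_mono' hJ le_rfl).trans ?_
  have hmeas : AEMeasurable (Function.uncurry fun (t : ℝ) (y : Plane) =>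
      ENNReal.ofReal M * (D.indicator (fun _ => (1 : ℝ≥0∞)) (t, y) * w y))
      ((volume : Measure ℝ).prod (volume.restrict E)) := by
    have h1 : Measurable fun p : ℝ × Plane => D.indicator (fun _ => (1 : ℝ≥0∞)) p :=
      measurable_const.indicator hDm
    have h2 : AEMeasurable (fun p : ℝ × Plane => w p.2)
        ((volume : Measure ℝ).prod (volume.restrict E)) := hwm.comp_snd
    exact (h1.aemeasurable.mul h2).const_mul _
  -- Integrating over `t` first gains the length `2 * molScale k` of the interval of admissible `t`.
  rw [lintegral_lintegral_swap hmeas]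
  have hin : ∀ y, ∫⁻ t, ENNReal.ofReal M * (D.indicator (fun _ => (1 : ℝ≥0∞)) (t, y) * w y)
      ≤ ENNReal.ofReal (M * (2 * molScale k)) * w y := by
    intro y
    have h1 : Measurable fun t : ℝ => D.indicator (fun _ => (1 : ℝ≥0∞)) (t, y) :=
      (measurable_const.indicator hDm).comp (by fun_prop : Measurable fun t : ℝ => (t, y))
    rw [lintegral_const_mul' _ _ ENNReal.ofReal_ne_top, lintegral_mul_const _ h1,
      ENNReal.ofReal_mul hM0, mul_assoc]
    refine mul_le_mul' le_rfl (mul_le_mul' (le_of_eq ?_) le_rfl)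
    have h2 : (fun t : ℝ => D.indicator (fun _ => (1 : ℝ≥0∞)) (t, y))
        = (Metric.closedBall (c y 0) (molScale k)).indicator fun _ => 1 := by
      ext t
      have : (t, y) ∈ D ↔ t ∈ Metric.closedBall (c y 0) (molScale k) := by
        rw [Metric.mem_closedBall, Real.dist_eq]; rfl
      by_cases hm : (t, y) ∈ D
      · rw [indicator_of_mem hm, indicator_of_mem (this.1 hm)]
      · rw [indicator_of_notMem hm, indicator_of_notMem (fun h' => hm (this.2 h'))]
    rw [h2, lintegral_indicator Metric.isClosed_closedBall.measurableSet, lintegral_const, one_mul,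
      Measure.restrict_apply_univ, Real.volume_closedBall]
  refine (lintegral_mono hin).trans ?_
  rw [lintegral_const_mul' _ _ ENNReal.ofReal_ne_top]
  refine mul_le_mul' (ENNReal.ofReal_le_ofReal (le_of_eq ?_)) le_rfl
  rw [hM, hε1, Real.mul_rpow hR0.le hε.le]
  -- Powers of the scale: `-4` from the two kernels, `2 + 2 σ` from the Gagliardo kernel, and `1`.
  have e1 : molScale k ^ (2 + 2 * σ) = molScale k ^ (2 * σ - 1) * molScale k ^ 3 := by
    rw [← Real.rpow_natCast (molScale k) 3, ← Real.rpow_add hε]; congr 1; push_cast; ring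
  rw [e1]
  field_simp
  ring

/-- If the Gagliardo seminorm of order `σ > 1/2` is finite, the mollifications converge on the
boundary: consecutive ones differ by a constant times `(2 ^ (-k)) ^ (σ - 1/2)`. -/
theorem exists_limit_of_gagliardo (h : IsLipChart E c φ K a d) (hE : MeasurableSet E)
    {f : Plane → ℝ} (hf : MemLp f 2 (volume.restrict E)) {σ : ℝ} (hσ : 1 / 2 < σ)
    (hG : gagliardoSq E σ f < ⊤) (ha : a' < a) :
    ∃ fs : ℝ → ℝ, MemLp fs 2 (volume.restrict (Ioo (-a') a')) ∧
      Tendsto (fun k => eLpNorm ((fun t => mollify (chartDir c K) k (E.indicator f)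
        (graphCurve c φ t)) - fs) 2 (volume.restrict (Ioo (-a') a'))) atTop (𝓝 0) := by
  obtain ⟨M, hM0, hM⟩ := h.lintegral_mollify_sub_succ_le hE hf (lt_trans (by norm_num) hσ) ha h.d_pos
  set r : ℝ := (1 / 2 : ℝ) ^ (σ - 1 / 2) with hr
  have hr0 : 0 < r := by positivity
  have hr1 : r < 1 := Real.rpow_lt_one (by norm_num) (by norm_num) (by linarith)
  have hrk : ∀ k, molScale k ^ (2 * σ - 1) = (r ^ k) ^ 2 := by
    intro k
    have hr2 : r ^ 2 = (1 / 2 : ℝ) ^ (2 * σ - 1) := by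
      rw [hr, ← Real.rpow_natCast, ← Real.rpow_mul (by norm_num)]
      congr 1; push_cast; ring
    rw [molScale, ← Real.rpow_pow_comm (by norm_num), ← hr2, ← pow_mul, ← pow_mul, mul_comm]
  set B := M * (gagliardoSq E σ f).toReal
  have hB : 0 ≤ B := by positivity
  refine exists_tendsto_eLpNorm_of_geometric (C := ENNReal.ofReal (√B)) (r := ENNReal.ofReal r)
    (fun k => ?_) ENNReal.ofReal_ne_top (by simpa using hr1) ?_
  · exact memLp_Ioo_of_continuous ((contDiff_mollify
      (locallyIntegrable_indicator hE hf)).continuous.comp (continuous_graphCurve h.continuous)) _ _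
  · filter_upwards [hM] with k hk
    refine (ENNReal.pow_le_pow_left_iff two_ne_zero).1 ?_
    rw [eLpNorm_two_sq]
    refine hk.trans (le_of_eq ?_)
    rw [← ENNReal.ofReal_toReal hG.ne,
      ← ENNReal.ofReal_mul (mul_nonneg hM0 (Real.rpow_nonneg (molScale_pos k).le _)),
      ← ENNReal.ofReal_pow hr0.le, ← ENNReal.ofReal_mul (by positivity),
      ← ENNReal.ofReal_pow (by positivity), hrk, mul_pow, Real.sq_sqrt hB]
    congr 1; ring

end IsLipChart

end

section

open scoped ENNReal

variable {c : Plane ≃ᵃⁱ[ℝ] Plane} {φ : ℝ → ℝ} {E : Set Plane} {K : NNReal} {a d a' d' : ℝ}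

/-! ### The tangential derivative of the trace -/

/-- In every chart, the mollifications of `f` converge in `L²` on the boundary. -/
def HasBoundaryLimit (E : Set Plane) (f : Plane → ℝ) : Prop :=
  ∀ (c : Plane ≃ᵃⁱ[ℝ] Plane) (φ : ℝ → ℝ) (K : NNReal) (a d a' : ℝ), IsLipChart E c φ K a d →
    a' < a → ∃ fs : ℝ → ℝ, MemLp fs 2 (volume.restrict (Ioo (-a') a')) ∧
      Tendsto (fun k => eLpNorm ((fun t => mollify (chartDir c K) k (E.indicator f)
        (graphCurve c φ t)) - fs) 2 (volume.restrict (Ioo (-a') a'))) atTop (𝓝 0)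

theorem MemH1.hasBoundaryLimit {f : Plane → ℝ} {F : Fin 2 → Plane → ℝ} (hf : MemH1 E f F)
    (hE : MeasurableSet E) : HasBoundaryLimit E f := fun _ _ _ _ _ _ h ha =>
  h.exists_trace_limit hE hf ha (half_pos h.d_pos) (half_lt_self h.d_pos)

theorem hasBoundaryLimit_of_gagliardo {f : Plane → ℝ} (hE : MeasurableSet E)
    (hf : MemLp f 2 (volume.restrict E)) {σ : ℝ} (hσ : 1 / 2 < σ) (hG : gagliardoSq E σ f < ⊤) :
    HasBoundaryLimit E f := fun _ _ _ _ _ _ h ha => h.exists_limit_of_gagliardo hE hf hσ hG ha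

theorem mollify_congr_ae {v : Plane} {k : ℕ} {f g : Plane → ℝ} (h : f =ᵐ[volume] g) :
    mollify v k f = mollify v k g := by
  ext z
  refine integral_congr_ae ?_
  filter_upwards [h] with y hy
  rw [hy]

theorem HasBoundaryLimit.congr_ae {f g : Plane → ℝ} (hE : MeasurableSet E)
    (hf : HasBoundaryLimit E f) (h : f =ᵐ[volume.restrict E] g) : HasBoundaryLimit E g := by
  intro c φ K a d a' hc ha
  have : E.indicator f =ᵐ[volume] E.indicator g := (ae_eq_restrict_iff_indicator_ae_eq hE).1 h
  simp only [← mollify_congr_ae this]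
  exact hf c φ K a d a' hc ha

/-- The `i`-th partial derivative of a smooth function. -/
def partialDeriv (i : Fin 2) (s : Plane → ℝ) (z : Plane) : ℝ :=
  fderiv ℝ s z (EuclideanSpace.single i 1)

theorem ContDiff.partialDeriv {s : Plane → ℝ} (hs : ContDiff ℝ ∞ s) (i : Fin 2) :
    ContDiff ℝ ∞ (partialDeriv i s) :=
  (hs.fderiv_right (m := ∞) (by simp)).clm_apply contDiff_const

theorem HasCompactSupport.partialDeriv {s : Plane → ℝ} (hs : HasCompactSupport s) (i : Fin 2) :
    HasCompactSupport (partialDeriv i s) := hs.fderiv_apply ℝ _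

theorem partialDeriv_comm {s : Plane → ℝ} (hs : ContDiff ℝ ∞ s) (i j : Fin 2) (z : Plane) :
    partialDeriv i (partialDeriv j s) z = partialDeriv j (partialDeriv i s) z := by
  have h : ∀ i j, partialDeriv i (partialDeriv j s) z
      = fderiv ℝ (fderiv ℝ s) z (EuclideanSpace.single i 1) (EuclideanSpace.single j 1) := by
    intro i j
    have hd : DifferentiableAt ℝ (fderiv ℝ s) z :=
      (hs.fderiv_right (m := ∞) (by simp)).differentiable (by simp) z
    have := hd.hasFDerivAt.clm_apply (hasFDerivAt_const (EuclideanSpace.single j (1 : ℝ)) z)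
    change fderiv ℝ (fun z => fderiv ℝ s z (EuclideanSpace.single j 1)) z _ = _
    rw [this.fderiv]
    simp
  rw [h, h]
  exact (hs.contDiffAt.isSymmSndFDerivAt (by
    rw [minSmoothness_of_isRCLikeNormedField]; exact WithTop.coe_le_coe.2 (le_top (a := (2 : ℕ∞))))).eq _ _

theorem partialDeriv_mul {f g : Plane → ℝ} (hf : ContDiff ℝ ∞ f) (hg : ContDiff ℝ ∞ g) (i : Fin 2)
    (z : Plane) : partialDeriv i (fun z => f z * g z) z
      = f z * partialDeriv i g z + g z * partialDeriv i f z := by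
  have := fderiv_mul (hf.differentiable (by simp) z) (hg.differentiable (by simp) z)
  change fderiv ℝ (fun z => f z * g z) z = _ at this
  rw [partialDeriv, this]
  simp [partialDeriv]

theorem partialDeriv_add {f g : Plane → ℝ} (hf : ContDiff ℝ ∞ f) (hg : ContDiff ℝ ∞ g) (i : Fin 2)
    (z : Plane) : partialDeriv i (f + g) z = partialDeriv i f z + partialDeriv i g z := by
  rw [partialDeriv, fderiv_add (hf.differentiable (by simp) z) (hg.differentiable (by simp) z)]
  rfl

theorem partialDeriv_eq_zero {f : Plane → ℝ} {z : Plane} (hz : z ∉ tsupport f) (i : Fin 2) :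
    partialDeriv i f z = 0 := by
  have h : fderiv ℝ f z = 0 :=
    image_eq_zero_of_notMem_tsupport fun hz' => hz (tsupport_fderiv_subset ℝ hz')
  rw [partialDeriv, h]; rfl

section

variable {p q : Plane → ℝ} {P Q : Fin 2 → Plane → ℝ}

/-- The weak partial derivative of `χ q`. -/
def cutPartial (χ q : Plane → ℝ) (Q : Fin 2 → Plane → ℝ) (i : Fin 2) (z : Plane) : ℝ :=
  χ z * Q i z + q z * partialDeriv i χ z

theorem MemH1.memLp_cutPartial (hq : MemH1 E q Q) (hE : MeasurableSet E)
    (hb : Bornology.IsBounded E) {χ : Plane → ℝ} (hχ : ContDiff ℝ ∞ χ) (i : Fin 2) :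
    MemLp (cutPartial χ q Q i) 2 (volume.restrict E) := by
  have key : ∀ {ψ g : Plane → ℝ}, Continuous ψ → MemLp g 2 (volume.restrict E) →
      MemLp (fun z => g z * ψ z) 2 (volume.restrict E) := by
    intro ψ g hψ hg
    obtain ⟨C, hC⟩ := hb.isCompact_closure.exists_bound_of_continuousOn hψ.continuousOn
    refine memLp_mul_of_bound hg hψ.aestronglyMeasurable (C := C) ?_
    filter_upwards [ae_restrict_mem hE] with z hz using hC z (subset_closure hz)
  have h1 := key hχ.continuous (hq.partial_memLp i)
  have h2 := key (hχ.partialDeriv i).continuous hq.memLp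
  refine (memLp_congr_ae (ae_of_all _ fun z => ?_)).1 (h1.add h2)
  simp [cutPartial, mul_comm]

/-- The Gauss–Green formula for `∂₀(χ q) ∂₁ s - ∂₁(χ q) ∂₀ s`, where the second derivatives of `s`
cancel. -/
theorem MemH1.integral_cutPartial_mul (hq : MemH1 E q Q) (hE : IsOpen E)
    (hL : HasLipschitzBoundary E) (hb : Bornology.IsBounded E) {χ s : Plane → ℝ}
    (hχ : ContDiff ℝ ∞ χ) (hχc : HasCompactSupport χ) (hs : ContDiff ℝ ∞ s) :
    ∫ z in E, (partialDeriv 1 s z * cutPartial χ q Q 0 z - partialDeriv 0 s z * cutPartial χ q Q 1 z)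
      = ∫ x in frontier E, trace E q x * (χ x * (outwardNormal E x 0 * partialDeriv 1 s x
          - outwardNormal E x 1 * partialDeriv 0 s x)) ∂arcLength := by
  have hEm := hE.measurableSet
  have hψ : ∀ i, ContDiff ℝ ∞ fun z => χ z * partialDeriv i s z := fun i =>
    hχ.mul (hs.partialDeriv i)
  have hψc : ∀ i, HasCompactSupport fun z => χ z * partialDeriv i s z := fun i => hχc.mul_right
  have g0 := hq.gaussGreen hE hL hb (hψ 1) (hψc 1) 0
  have g1 := hq.gaussGreen hE hL hb (hψ 0) (hψc 0) 1
  have iE : ∀ i j, Integrable (fun z => Q i z * (χ z * partialDeriv j s z)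
      + q z * partialDeriv i (fun z => χ z * partialDeriv j s z) z) (volume.restrict E) := fun i j =>
    ((hq.partial_memLp i).integrable_mul (memLp_continuous_of_bounded hb hEm (hψ j).continuous)).add
      (hq.memLp.integrable_mul
        (memLp_continuous_of_bounded hb hEm ((hψ j).partialDeriv i).continuous))
  have iF : ∀ i j, Integrable (fun x => trace E q x * (χ x * partialDeriv j s x
      * outwardNormal E x i)) (arcLength.restrict (frontier E)) := fun i j =>
    (hq.memLp_trace hEm hL hb).integrable_mul
      (memLp_continuous_mul_outwardNormal hL hb (hψ j).continuous i)
  have e1 : ∀ z, partialDeriv 1 s z * cutPartial χ q Q 0 z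
      - partialDeriv 0 s z * cutPartial χ q Q 1 z
      = (Q 0 z * (χ z * partialDeriv 1 s z)
          + q z * partialDeriv 0 (fun z => χ z * partialDeriv 1 s z) z)
        - (Q 1 z * (χ z * partialDeriv 0 s z)
          + q z * partialDeriv 1 (fun z => χ z * partialDeriv 0 s z) z) := by
    intro z
    rw [partialDeriv_mul hχ (hs.partialDeriv 1), partialDeriv_mul hχ (hs.partialDeriv 0),
      partialDeriv_comm hs 0 1, cutPartial, cutPartial]
    ring
  have e2 : ∀ x, trace E q x * (χ x * (outwardNormal E x 0 * partialDeriv 1 s x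
          - outwardNormal E x 1 * partialDeriv 0 s x))
      = trace E q x * (χ x * partialDeriv 1 s x * outwardNormal E x 0)
        - trace E q x * (χ x * partialDeriv 0 s x * outwardNormal E x 1) := by
    intro x; ring
  simp only [e1, e2]
  rw [integral_sub (iE 0 1) (iE 1 0), integral_sub (iF 0 1) (iF 1 0), ← g0, ← g1]
  rfl

/-- The pairing of `∇p` with `∇(χ q)` is the limit of the pairings of the gradients of smooth
functions `s k`, whose derivatives are mollifications of the derivatives of `p` near the support of
`χ`. -/
theorem tendsto_integral_cutPartial (hp : MemH1 E p P) (hq : MemH1 E q Q) (hE : MeasurableSet E)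
    (hb : Bornology.IsBounded E) {χ : Plane → ℝ} (hχ : ContDiff ℝ ∞ χ) {s : ℕ → Plane → ℝ}
    {v : Plane} (hs : ∀ᶠ k in atTop, ∀ z ∈ E ∩ tsupport χ, ∀ j,
      partialDeriv j (s k) z = mollify v k (E.indicator (P j)) z) :
    Tendsto (fun k => ∫ z in E, (partialDeriv 1 (s k) z * cutPartial χ q Q 0 z
        - partialDeriv 0 (s k) z * cutPartial χ q Q 1 z)) atTop
      (𝓝 (∫ z in E, (P 1 z * cutPartial χ q Q 0 z - P 0 z * cutPartial χ q Q 1 z))) := by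
  have hcut := hq.memLp_cutPartial hE hb hχ
  have hm : ∀ j k, MemLp (mollify v k (E.indicator (P j))) 2 (volume.restrict E) := fun j k =>
    memLp_continuous_of_bounded hb hE
      (contDiff_mollify (locallyIntegrable_indicator hE (hp.partial_memLp j))).continuous
  have hlim : ∀ j, Tendsto (fun k => eLpNorm (mollify v k (E.indicator (P j)) - P j) 2
      (volume.restrict E)) atTop (𝓝 0) := by
    intro j
    refine tendsto_of_tendsto_of_tendsto_of_le_of_le tendsto_const_nhds
      (tendsto_eLpNorm_mollify (v := v) ((memLp_indicator_iff_restrict hE).2 (hp.partial_memLp j)))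
      (fun _ => zero_le) fun k => ?_
    refine le_trans (le_of_eq (eLpNorm_congr_ae ?_))
      (eLpNorm_mono_measure _ (Measure.restrict_le_self (s := E)))
    filter_upwards [ae_restrict_mem hE] with z hz
    rw [Pi.sub_apply, Pi.sub_apply, indicator_of_mem hz]
  have t : ∀ i j, Tendsto (fun k => ∫ z in E, mollify v k (E.indicator (P j)) z
      * cutPartial χ q Q i z) atTop (𝓝 (∫ z in E, P j z * cutPartial χ q Q i z)) := fun i j =>
    tendsto_integral_mul (hm j) (hp.partial_memLp j) (hcut i) (hlim j)
  have i1 : ∀ i j, Integrable (fun z => P j z * cutPartial χ q Q i z) (volume.restrict E) :=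
    fun i j => (hp.partial_memLp j).integrable_mul (hcut i)
  have i2 : ∀ i j k, Integrable (fun z => mollify v k (E.indicator (P j)) z
      * cutPartial χ q Q i z) (volume.restrict E) := fun i j k => (hm j k).integrable_mul (hcut i)
  rw [integral_sub (i1 0 1) (i1 1 0)]
  refine ((t 0 1).sub (t 1 0)).congr' ?_
  filter_upwards [hs] with k hk
  rw [← integral_sub (i2 0 1 k) (i2 1 0 k)]
  refine setIntegral_congr_fun hE fun z hz => ?_
  by_cases hzχ : z ∈ tsupport χ
  · rw [hk z ⟨hz, hzχ⟩, hk z ⟨hz, hzχ⟩]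
  · have : ∀ i, cutPartial χ q Q i z = 0 := fun i => by
      rw [cutPartial, image_eq_zero_of_notMem_tsupport hzχ, partialDeriv_eq_zero hzχ]; simp
    rw [this, this]; simp

/-- The pairing of `∇p` with `∇(χ q)` is a boundary pairing, for test functions `χ` carried by a
boundary chart. -/
theorem IsLipChart.exists_pairing (h : IsLipChart E c φ K a d) (h0 : 0 < a') (ha : a' < a)
    (h1 : 0 < d') (hd : d' < d) (hE : IsOpen E)
    (hL : HasLipschitzBoundary E) (hb : Bornology.IsBounded E) (hp : MemH1 E p P)
    (hP : ∀ j, HasBoundaryLimit E (P j)) {χ : Plane → ℝ} (hχ : ContDiff ℝ ∞ χ)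
    (hχc : HasCompactSupport χ) (hχs : tsupport χ ⊆ chartBox c φ a' d') :
    ∃ G : Plane → ℝ, MemLp G 2 (arcLength.restrict (frontier E)) ∧
      ∀ q Q, MemH1 E q Q →
        ∫ z in E, (P 1 z * cutPartial χ q Q 0 z - P 0 z * cutPartial χ q Q 1 z)
          = ∫ x in frontier E, trace E q x * G x ∂arcLength := by
  have hEm := hE.measurableSet
  have h' := h.mono h0 ha.le h1 hd.le
  choose Ps hPs hPlim using fun j => hP j c φ K a d a' h ha
  set B := chartBox c φ a' d' with hB
  have hBm : MeasurableSet B := h'.isOpen_chartBox.measurableSet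
  have hFm : MeasurableSet (frontier E) := isClosed_frontier.measurableSet
  have hχ0 : ∀ x ∉ B, χ x = 0 := fun x hx =>
    image_eq_zero_of_notMem_tsupport fun hx' => hx (hχs hx')
  obtain ⟨C, hC⟩ := hχ.continuous.bounded_above_of_compact_support hχc
  -- The boundary density: the tangential component `n₀ ∂₁p - n₁ ∂₀p`, times `χ`.
  set G : Plane → ℝ := fun x => χ x * (outwardNormal E x 0 * Ps 1 (c x 0)
    - outwardNormal E x 1 * Ps 0 (c x 0)) with hG
  have hGB : B.indicator G = G := by
    refine indicator_eq_self.2 fun x hx => ?_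
    by_contra hxB
    exact hx (by simp [hG, hχ0 x hxB])
  have hGm : MemLp G 2 (arcLength.restrict (frontier E)) := by
    rw [← hGB, memLp_indicator_iff_restrict hBm, Measure.restrict_restrict hBm, inter_comm]
    have hn : ∀ i, AEStronglyMeasurable (fun x => outwardNormal E x i)
        (arcLength.restrict (frontier E ∩ B)) := fun i =>
      (aestronglyMeasurable_outwardNormal hL hb i).mono_measure
        (Measure.restrict_mono inter_subset_left le_rfl)
    have hj : ∀ i j, MemLp (fun x => Ps j (c x 0) * outwardNormal E x i) 2
        (arcLength.restrict (frontier E ∩ B)) := fun i j =>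
      memLp_mul_of_bound (h'.memLp_comp (hPs j)) (hn i)
        (ae_of_all _ fun x => abs_outwardNormal_le E x i)
    have := memLp_mul_of_bound ((hj 0 1).sub (hj 1 0)) hχ.continuous.aestronglyMeasurable
      (ae_of_all _ hC)
    refine (memLp_congr_ae (ae_of_all _ fun x => ?_)).1 this
    simp only [hG, Pi.sub_apply]; ring
  refine ⟨G, hGm, fun q Q hq => ?_⟩
  set s : ℕ → Plane → ℝ := fun k => mollify (chartDir c K) k (E.indicator p) with hs
  have hsc : ∀ k, ContDiff ℝ ∞ (s k) := fun k =>
    contDiff_mollify (locallyIntegrable_indicator hEm hp.memLp)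
  have hev := h.fderiv_mollify_eventually hEm hp ha hd
  have hlhs := tendsto_integral_cutPartial hp hq hEm hb hχ (s := s) (v := chartDir c K) (by
    filter_upwards [hev] with k hk z hz j
    have hzB := hχs hz.2
    obtain ⟨r, rfl⟩ := (graphHomeo c φ h.continuous).surjective z
    change graphMap c φ r ∈ _ at hzB
    have hr := graphMap_mem_chartBox.1 hzB
    have hpos : 0 < r.2 := (h'.mem_iff r.1 r.2 hr.1 hr.2).1 hz.1
    exact hk r.1 r.2 hr.1 hpos.le ((le_abs_self _).trans_lt hr.2) j)
  obtain ⟨t1, -, -⟩ := h.tendsto_trace hEm hq ha h1 hd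
  -- the weights which multiply the mollified derivatives on the boundary, in the chart
  set W : Fin 2 → ℝ → ℝ := fun i t => trace E q (graphCurve c φ t)
    * (χ (graphCurve c φ t) * (upVec c - deriv φ t • horVec c) i) with hW
  have hWm : ∀ i, MemLp (W i) 2 (volume.restrict (Ioo (-a') a')) := by
    intro i
    have hγ := continuous_graphCurve (c := c) h.continuous
    refine memLp_mul_of_bound (C := C * (1 + K)) t1 ?_ (ae_of_all _ fun t => ?_)
    · refine ((hχ.continuous.comp hγ).measurable.mul ?_).aestronglyMeasurable
      have := measurable_deriv φ
      simp only [PiLp.sub_apply, PiLp.smul_apply, smul_eq_mul]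
      fun_prop
    · rw [abs_mul]
      refine mul_le_mul (hC _) ?_ (abs_nonneg _) ((norm_nonneg _).trans (hC 0))
      refine (PiLp.norm_apply_le (p := 2) (upVec c - deriv φ t • horVec c) i).trans ?_
      refine (norm_sub_le _ _).trans ?_
      rw [norm_smul, norm_upVec, norm_horVec, mul_one]
      have : ‖deriv φ t‖ ≤ K := norm_deriv_le_of_lipschitz h.lip
      linarith
  -- The boundary side of the Gauss–Green formula in the parameter of the chart.
  have hchart : ∀ A : Fin 2 → Plane → ℝ,
      ∫ x in frontier E, trace E q x * (χ x * (outwardNormal E x 0 * A 1 x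
          - outwardNormal E x 1 * A 0 x)) ∂arcLength
        = ∫ t in Ioo (-a') a', (A 1 (graphCurve c φ t) * W 0 t
          - A 0 (graphCurve c φ t) * W 1 t) := by
    intro A
    rw [setIntegral_eq_of_subset_of_forall_sdiff_eq_zero (s := frontier E ∩ B) hFm
      inter_subset_left, h'.setIntegral_eq]
    · refine integral_congr_ae ?_
      filter_upwards [h'.ae_outwardNormal] with t ht
      have hi : ∀ i, graphSpeed φ t * outwardNormal E (graphCurve c φ t) i
          = (upVec c - deriv φ t • horVec c) i := fun i => by
        rw [← ht, PiLp.smul_apply, smul_eq_mul]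
      simp only [hW, ← hi]
      ring
    · rintro y ⟨hy1, hy2⟩
      rw [hχ0 y fun hy => hy2 ⟨hy1, hy⟩]; simp
  have hm : ∀ j k, MemLp (fun t => mollify (chartDir c K) k (E.indicator (P j))
      (graphCurve c φ t)) 2 (volume.restrict (Ioo (-a') a')) := fun j k =>
    memLp_Ioo_of_continuous ((contDiff_mollify (locallyIntegrable_indicator hEm
      (hp.partial_memLp j))).continuous.comp (continuous_graphCurve h.continuous)) _ _
  have tt : ∀ i j, Tendsto (fun k => ∫ t in Ioo (-a') a', mollify (chartDir c K) k
      (E.indicator (P j)) (graphCurve c φ t) * W i t) atTop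
      (𝓝 (∫ t in Ioo (-a') a', Ps j t * W i t)) := fun i j =>
    tendsto_integral_mul (hm j) (hPs j) (hWm i) (hPlim j)
  have i1 : ∀ i j, Integrable (fun t => Ps j t * W i t) (volume.restrict (Ioo (-a') a')) :=
    fun i j => (hPs j).integrable_mul (hWm i)
  have i2 : ∀ i j k, Integrable (fun t => mollify (chartDir c K) k (E.indicator (P j))
      (graphCurve c φ t) * W i t) (volume.restrict (Ioo (-a') a')) :=
    fun i j k => (hm j k).integrable_mul (hWm i)
  have hGint : ∫ x in frontier E, trace E q x * G x ∂arcLength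
      = (∫ t in Ioo (-a') a', Ps 1 t * W 0 t) - ∫ t in Ioo (-a') a', Ps 0 t * W 1 t := by
    rw [← integral_sub (i1 0 1) (i1 1 0)]
    refine (hchart fun j x => Ps j (c x 0)).trans ?_
    simp only [coord_graphCurve_zero]
  rw [hGint]
  -- Both sides of the formula for `s k` converge.
  refine tendsto_nhds_unique hlhs (((tt 0 1).sub (tt 1 0)).congr' ?_)
  filter_upwards [hev] with k hk
  rw [hq.integral_cutPartial_mul hE hL hb hχ hχc (hsc k), hchart fun j => partialDeriv j (s k),
    ← integral_sub (i2 0 1 k) (i2 1 0 k)]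
  refine setIntegral_congr_fun measurableSet_Ioo fun t ht => ?_
  have := hk t 0 (abs_lt.2 ht) le_rfl h1
  change _ = fderiv ℝ (s k) (graphMap c φ (t, 0)) _ * _ - fderiv ℝ (s k) (graphMap c φ (t, 0)) _ * _
  rw [this, this]
  rfl

/-- In the interior, the pairing of `∇p` with `∇(χ q)` vanishes. -/
theorem MemH1.integral_pairing_interior (hp : MemH1 E p P) (hq : MemH1 E q Q) (hE : IsOpen E)
    (hL : HasLipschitzBoundary E) (hb : Bornology.IsBounded E) {χ : Plane → ℝ}
    (hχ : ContDiff ℝ ∞ χ) (hχc : HasCompactSupport χ) (hχs : tsupport χ ⊆ E) :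
    ∫ z in E, (P 1 z * cutPartial χ q Q 0 z - P 0 z * cutPartial χ q Q 1 z) = 0 := by
  have hEm := hE.measurableSet
  obtain ⟨δ, hδ, hδE⟩ := hχc.isCompact.exists_cthickening_subset_open hE hχs
  have hlhs := tendsto_integral_cutPartial hp hq hEm hb hχ
    (s := fun k => mollify 0 k (E.indicator p)) (v := 0) (by
    filter_upwards [tendsto_molScale.eventually (gt_mem_nhds hδ)] with k hk z hz j
    refine fderiv_mollify_eq hEm hp.memLp (hp.weak j) ?_
    rw [smul_zero, sub_zero]
    exact (Metric.closedBall_subset_closedBall hk.le).trans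
      ((Metric.closedBall_subset_cthickening hz.2 δ).trans hδE))
  refine tendsto_nhds_unique hlhs (tendsto_const_nhds.congr fun k => ?_)
  rw [hq.integral_cutPartial_mul hE hL hb hχ hχc
    (contDiff_mollify (locallyIntegrable_indicator hEm hp.memLp))]
  symm
  refine setIntegral_eq_zero_of_forall_eq_zero fun y hy => ?_
  rw [image_eq_zero_of_notMem_tsupport (f := χ) fun hy' => ?_]
  · simp
  · rw [hE.frontier_eq] at hy
    exact hy.2 (hχs hy')

/-- A smooth compactly supported function which is `1` near a bounded set. -/
theorem exists_cutoff (hb : Bornology.IsBounded E) : ∃ χ : Plane → ℝ, ContDiff ℝ ∞ χ ∧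
    HasCompactSupport χ ∧ ∀ z ∈ closure E, χ =ᶠ[𝓝 z] fun _ => 1 := by
  obtain ⟨R, hR⟩ := hb.subset_closedBall (0 : Plane)
  set r := max R 0 + 1
  have hr : 0 < r := by positivity
  let χ : ContDiffBump (0 : Plane) := ⟨r, r + 1, hr, by linarith⟩
  refine ⟨χ, χ.contDiff, χ.hasCompactSupport, fun z hz => ?_⟩
  have hz' : z ∈ Metric.ball (0 : Plane) r :=
    (closure_minimal hR Metric.isClosed_closedBall).trans
      (Metric.closedBall_subset_ball (by have := le_max_left R 0; simp only [r]; linarith)) hz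
  filter_upwards [Metric.isOpen_ball.mem_nhds hz'] with y hy
  exact χ.one_of_mem_closedBall (Metric.ball_subset_closedBall hy)

/-- If the gradient `P` of `p` has boundary limits, then the pairing `∂₀q ∂₁p - ∂₁q ∂₀p` is given
by a square integrable function on the boundary, namely the tangential derivative of `p`. -/
theorem MemH1.exists_pairing (hp : MemH1 E p P) (hP : ∀ j, HasBoundaryLimit E (P j)) (hE : IsOpen E)
    (hL : HasLipschitzBoundary E) (hb : Bornology.IsBounded E) :
    ∃ G : Plane → ℝ, MemLp G 2 (arcLength.restrict (frontier E)) ∧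
      ∀ q Q, MemH1 E q Q → ∫ z in E, (P 1 z * Q 0 z - P 0 z * Q 1 z)
          = ∫ x in frontier E, trace E q x * G x ∂arcLength := by
  have hEm := hE.measurableSet
  obtain ⟨χ, hχ, hχc, hχ1⟩ := exists_cutoff hb
  obtain ⟨G, hG, hGq⟩ : ∃ G : Plane → ℝ, MemLp G 2 (arcLength.restrict (frontier E)) ∧
      ∀ q Q, MemH1 E q Q →
        ∫ z in E, (P 1 z * cutPartial χ q Q 0 z - P 0 z * cutPartial χ q Q 1 z)
          = ∫ x in frontier E, trace E q x * G x ∂arcLength := by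
    refine localise_test_functions (m := ∞) le_rfl (Q := fun χ => ∃ G : Plane → ℝ,
      MemLp G 2 (arcLength.restrict (frontier E)) ∧ ∀ q Q, MemH1 E q Q →
        ∫ z in E, (P 1 z * cutPartial χ q Q 0 z - P 0 z * cutPartial χ q Q 1 z)
          = ∫ x in frontier E, trace E q x * G x ∂arcLength) ?_ ?_ univ ?_ hχ hχc (subset_univ _)
    · refine ⟨0, MemLp.zero', fun q Q _ => ?_⟩
      have : ∀ i z, cutPartial 0 q Q i z = 0 := fun i z => by
        simp [cutPartial, partialDeriv]
      simp [this]
    · rintro χ₁ χ₂ h1 - h2 - ⟨G₁, hG₁, e₁⟩ ⟨G₂, hG₂, e₂⟩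
      refine ⟨fun x => G₁ x + G₂ x, hG₁.add hG₂, fun q Q hq => ?_⟩
      have hc : ∀ i z, cutPartial (χ₁ + χ₂) q Q i z
          = cutPartial χ₁ q Q i z + cutPartial χ₂ q Q i z := fun i z => by
        rw [cutPartial, cutPartial, cutPartial, partialDeriv_add h1 h2, Pi.add_apply]; ring
      have j : ∀ {χ : Plane → ℝ}, ContDiff ℝ ∞ χ → Integrable (fun z =>
          P 1 z * cutPartial χ q Q 0 z - P 0 z * cutPartial χ q Q 1 z) (volume.restrict E) :=
        fun h => ((hp.partial_memLp 1).integrable_mul (hq.memLp_cutPartial hEm hb h 0)).sub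
          ((hp.partial_memLp 0).integrable_mul (hq.memLp_cutPartial hEm hb h 1))
      have htr := hq.memLp_trace hEm hL hb
      have k1 : Integrable (fun x => trace E q x * G₁ x) (arcLength.restrict (frontier E)) :=
        htr.integrable_mul hG₁
      have k2 : Integrable (fun x => trace E q x * G₂ x) (arcLength.restrict (frontier E)) :=
        htr.integrable_mul hG₂
      simp only [mul_add]
      rw [integral_add k1 k2, ← e₁ q Q hq, ← e₂ q Q hq, ← integral_add (j h1) (j h2)]
      refine integral_congr_ae (ae_of_all _ fun z => ?_)
      simp only [hc]; ring
    -- Near the boundary use a chart; in the interior and in the exterior the pairing is zero.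
    · intro x _
      by_cases hxF : x ∈ frontier E
      · obtain ⟨c, φ, K, a, d, a', d', h, h0, h1, ha, hd, hxb⟩ := exists_isLipChart hL hxF
        exact ⟨_, (h.mono h0 ha.le h1 hd.le).isOpen_chartBox, hxb, fun χ hχ hχc hχs =>
          h.exists_pairing h0 ha h1 hd hE hL hb hp hP hχ hχc hχs⟩
      · by_cases hxE : x ∈ E
        · refine ⟨E, hE, hxE, fun χ hχ hχc hχs => ⟨0, MemLp.zero', fun q Q hq => ?_⟩⟩
          rw [hp.integral_pairing_interior hq hE hL hb hχ hχc hχs]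
          simp
        · have hxc : x ∉ closure E := fun hx => hxF (by rw [hE.frontier_eq]; exact ⟨hx, hxE⟩)
          refine ⟨(closure E)ᶜ, isClosed_closure.isOpen_compl, hxc,
            fun χ hχ hχc hχs => ⟨0, MemLp.zero', fun q Q hq => ?_⟩⟩
          simp only [Pi.zero_apply, mul_zero, integral_zero]
          refine setIntegral_eq_zero_of_forall_eq_zero fun y hy => ?_
          have hy' : y ∉ tsupport χ := fun hy' => hχs hy' (subset_closure hy)
          have : ∀ i, cutPartial χ q Q i y = 0 := fun i => by
            rw [cutPartial, image_eq_zero_of_notMem_tsupport hy', partialDeriv_eq_zero hy']; simp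
          rw [this, this]; simp
  refine ⟨G, hG, fun q Q hq => ?_⟩
  rw [← hGq q Q hq]
  refine setIntegral_congr_fun hEm fun z hz => ?_
  have h1 := hχ1 z (subset_closure hz)
  have : ∀ i, cutPartial χ q Q i z = Q i z := fun i => by
    rw [cutPartial, partialDeriv, h1.fderiv_eq, h1.eq_of_nhds]; simp
  simp only [this]

end

end

section

open scoped ENNReal

variable {E : Set Plane}

/-! ### Weak derivatives and the regularity of `H^s` functions -/

theorem integrableOn_mul_of_locallyIntegrableOn {μ : Measure Plane} {s Z : Set Plane}
    {g φ : Plane → ℝ} (hs : MeasurableSet s) (hg : LocallyIntegrableOn g s μ) (hZ : IsCompact Z)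
    (hZs : Z ⊆ s) (hφ : Continuous φ) (h0 : ∀ x ∈ s \ Z, φ x = 0) :
    IntegrableOn (fun x => g x * φ x) s μ := by
  have h1 : IntegrableOn (fun x => g x * φ x) Z μ :=
    (hg.integrableOn_compact_subset hZs hZ).mul_continuousOn hφ.continuousOn hZ
  exact h1.of_forall_sdiff_eq_zero hs fun x hx => by rw [h0 x hx, mul_zero]

theorem HasWeakPartial.ae_eq (hE : IsOpen E) {i : Fin 2} {w g g' : Plane → ℝ}
    (h : HasWeakPartial E i w g) (h' : HasWeakPartial E i w g') :
    g =ᵐ[volume.restrict E] g' := by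
  have hz : ∀ᵐ x ∂volume, x ∈ E → (g - g') x = 0 := by
    refine hE.ae_eq_zero_of_integral_contDiff_smul_eq_zero (h.2.1.sub h'.2.1) fun φ hφ hφc hφs => ?_
    have h0 : ∀ x ∉ E, φ x = 0 := fun x hx =>
      image_eq_zero_of_notMem_tsupport fun hx' => hx (hφs hx')
    have hi : ∀ {g}, LocallyIntegrableOn g E → IntegrableOn (fun x => g x * φ x) E := fun hg =>
      integrableOn_mul_of_locallyIntegrableOn hE.measurableSet hg hφc hφs hφ.continuous
        fun x hx => image_eq_zero_of_notMem_tsupport hx.2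
    rw [← setIntegral_eq_integral_of_forall_compl_eq_zero (s := E) fun x hx => by simp [h0 x hx]]
    have e : ∀ x, φ x • (g - g') x = g x * φ x - g' x * φ x := fun x => by
      simp only [Pi.sub_apply, smul_eq_mul]; ring
    simp only [e]
    rw [integral_sub (hi h.2.1) (hi h'.2.1), sub_eq_zero, ← neg_inj, ← h.2.2 φ hφ hφc hφs,
      ← h'.2.2 φ hφ hφc hφs]
  rw [EventuallyEq, ae_restrict_iff' hE.measurableSet]
  filter_upwards [hz] with x hx hxE
  exact sub_eq_zero.1 (hx hxE)

theorem HasWeakPartial.hasWeakPartial_weakPartial {i : Fin 2} {w g : Plane → ℝ}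
    (h : HasWeakPartial E i w g) : HasWeakPartial E i w (weakPartial E i w) := by
  have hex : ∃ g, HasWeakPartial E i w g := ⟨g, h⟩
  rw [weakPartial, dif_pos hex]
  exact hex.choose_spec

theorem HasWeakPartial.congr_ae {i : Fin 2} {w w' g : Plane → ℝ} (h : HasWeakPartial E i w g)
    (hw' : LocallyIntegrableOn w' E) (hw : w =ᵐ[volume.restrict E] w') :
    HasWeakPartial E i w' g := by
  refine ⟨hw', h.2.1, fun φ hφ hφc hφs => ?_⟩
  rw [← h.2.2 φ hφ hφc hφs]
  refine integral_congr_ae ?_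
  filter_upwards [hw] with x hx
  rw [hx]

/-- Weak partial derivatives commute. -/
theorem HasWeakPartial.comm (hE : IsOpen E) {i j : Fin 2} {w wi wj wij wji : Plane → ℝ}
    (hi : HasWeakPartial E i w wi) (hj : HasWeakPartial E j w wj) (hij : HasWeakPartial E i wj wij)
    (hji : HasWeakPartial E j wi wji) : wij =ᵐ[volume.restrict E] wji := by
  refine hij.ae_eq hE ⟨hj.2.1, hji.2.1, fun φ hφ hφc hφs => ?_⟩
  have hs : ∀ k, tsupport (partialDeriv k φ) ⊆ E := fun k =>
    (closure_minimal (fun x hx => by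
      by_contra hx'
      exact hx (partialDeriv_eq_zero hx' k)) (isClosed_tsupport φ)).trans hφs
  have e1 := hj.2.2 (partialDeriv i φ) (hφ.partialDeriv i) (hφc.partialDeriv i) (hs i)
  have e2 := hi.2.2 (partialDeriv j φ) (hφ.partialDeriv j) (hφc.partialDeriv j) (hs j)
  have e3 := hji.2.2 φ hφ hφc hφs
  change ∫ x in E, w x * partialDeriv j (partialDeriv i φ) x = _ at e1
  change ∫ x in E, w x * partialDeriv i (partialDeriv j φ) x = _ at e2
  simp only [partialDeriv_comm hφ j i] at e1
  rw [← e3]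
  exact neg_injective (e1.symm.trans e2)

/-- The regularity of `w ∈ H^s(E)`, `s > 5/2`, which the identities need: the first derivatives are
in `H¹(E)` and the second derivatives have boundary values. -/
structure HasRegularGradient (E : Set Plane) (w : Plane → ℝ) : Prop where
  memH1 : ∀ i, MemH1 E (weakPartial E i w) fun j => weakPartial₂ E j i w
  hasBoundaryLimit : ∀ i j, HasBoundaryLimit E (weakPartial₂ E j i w)
  symm : weakPartial₂ E 0 1 w =ᵐ[volume.restrict E] weakPartial₂ E 1 0 w

theorem MemSlobodeckij.memLp {σ : ℝ} {k : ℕ} {w : Plane → ℝ} (h : MemSlobodeckij E σ k w) :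
    MemLp w 2 (volume.restrict E) := by
  cases k with
  | zero => exact h.1
  | succ k => exact h.1

/-- If `⌊s⌋ ≥ 3`, the second derivatives are in `H¹`; otherwise `⌊s⌋ = 2`, and they have a finite
Gagliardo seminorm of order `s - 2 > 1/2`. -/
theorem MemHs.hasRegularGradient (hE : IsOpen E) {s : ℝ} (hs : 5 / 2 < s) {w : Plane → ℝ}
    (hw : MemHs E s w) : HasRegularGradient E w := by
  have hEm := hE.measurableSet
  obtain ⟨k, hk⟩ : ∃ k, ⌊s⌋₊ = k + 1 + 1 := by
    have h2 : 2 ≤ ⌊s⌋₊ := Nat.le_floor (by push_cast; linarith)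
    exact ⟨⌊s⌋₊ - 2, by omega⟩
  rw [MemHs, hk] at hw
  obtain ⟨-, hw1⟩ := hw
  choose g hg hgm using hw1
  have hgm' : ∀ i, ∀ j, ∃ gg, HasWeakPartial E j (g i) gg ∧ MemSlobodeckij E (Int.fract s) k gg :=
    fun i => (hgm i).2
  choose gg hgg hggm using hgm'
  have hlim : ∀ i j, HasBoundaryLimit E (gg i j) := by
    intro i j
    have hm := hggm i j
    cases k with
    | zero =>
      have hsf : (2 : ℝ) + Int.fract s = s := by
        have h0 : (0 : ℝ) ≤ s := by linarith
        have h1 : ⌊s⌋ = 2 := by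
          have := Int.natCast_floor_eq_floor h0
          rw [hk] at this; exact_mod_cast this.symm
        have := Int.floor_add_fract s
        rw [h1] at this; exact_mod_cast this
      have hf : 1 / 2 < Int.fract s := by linarith
      exact hasBoundaryLimit_of_gagliardo hEm hm.1 hf (hm.2.resolve_left (by linarith))
    | succ k =>
      obtain ⟨hm0, hm1⟩ := hm
      choose r hr hrm using hm1
      exact MemH1.hasBoundaryLimit ⟨hm0, fun l => (hrm l).memLp, hr⟩ hEm
  have hD : ∀ i, HasWeakPartial E i w (weakPartial E i w) := fun i =>
    (hg i).hasWeakPartial_weakPartial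
  have hDg : ∀ i, g i =ᵐ[volume.restrict E] weakPartial E i w := fun i => (hg i).ae_eq hE (hD i)
  have hDD0 : ∀ i j, HasWeakPartial E j (weakPartial E i w) (gg i j) := fun i j =>
    (hgg i j).congr_ae (hD i).2.1 (hDg i)
  have hDD : ∀ i j, HasWeakPartial E j (weakPartial E i w) (weakPartial₂ E j i w) := fun i j =>
    (hDD0 i j).hasWeakPartial_weakPartial
  have hDDg : ∀ i j, gg i j =ᵐ[volume.restrict E] weakPartial₂ E j i w := fun i j =>
    (hDD0 i j).ae_eq hE (hDD i j)
  exact ⟨fun i => ⟨(memLp_congr_ae (hDg i)).1 (hgm i).1,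
    fun j => (memLp_congr_ae (hDDg i j)).1 (hggm i j).memLp, fun j => hDD i j⟩,
    fun i j => (hlim i j).congr_ae hEm (hDDg i j), (hD 0).comm hE (hD 1) (hDD 1 0) (hDD 0 1)⟩

/-! ### Test functions as Sobolev functions -/

theorem continuous_partialDeriv {ψ : Plane → ℝ} (hψ : ContDiff ℝ 1 ψ) (i : Fin 2) :
    Continuous (partialDeriv i ψ) :=
  (hψ.continuous_fderiv (by simp)).clm_apply continuous_const

theorem hasWeakPartial_of_contDiff (hE : IsOpen E) {ψ : Plane → ℝ} (hψ : ContDiff ℝ 1 ψ)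
    (i : Fin 2) : HasWeakPartial E i ψ (partialDeriv i ψ) := by
  refine ⟨hψ.continuous.continuousOn.locallyIntegrableOn hE.measurableSet,
    (continuous_partialDeriv hψ i).continuousOn.locallyIntegrableOn hE.measurableSet,
    fun φ hφ hφc hφs => ?_⟩
  have hφ1 : ContDiff ℝ 1 φ := hφ.of_le (by simp)
  have h0 : ∀ x ∉ E, x ∉ tsupport φ := fun x hx hx' => hx (hφs hx')
  rw [setIntegral_eq_integral_of_forall_compl_eq_zero fun x hx => by
      change _ * partialDeriv i φ x = 0; rw [partialDeriv_eq_zero (h0 x hx), mul_zero],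
    setIntegral_eq_integral_of_forall_compl_eq_zero fun x hx => by
      rw [image_eq_zero_of_notMem_tsupport (h0 x hx), mul_zero]]
  have c1 := (continuous_partialDeriv hψ i).mul hφ.continuous
  have c2 := hψ.continuous.mul (continuous_partialDeriv hφ1 i)
  exact integral_mul_fderiv_eq_neg_fderiv_mul_of_integrable
    (c1.integrable_of_hasCompactSupport hφc.mul_left)
    (c2.integrable_of_hasCompactSupport (hφc.partialDeriv i).mul_left)
    ((hψ.continuous.mul hφ.continuous).integrable_of_hasCompactSupport hφc.mul_left)
    (fun x _ => hψ.differentiable (by simp) x) (fun x _ => hφ.differentiable (by simp) x)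

theorem memH1_of_contDiff (hE : IsOpen E) (hb : Bornology.IsBounded E) {ψ : Plane → ℝ}
    (hψ : ContDiff ℝ 1 ψ) : MemH1 E ψ fun i => partialDeriv i ψ :=
  ⟨memLp_continuous_of_bounded hb hE.measurableSet hψ.continuous,
    fun i => memLp_continuous_of_bounded hb hE.measurableSet (continuous_partialDeriv hψ i),
    hasWeakPartial_of_contDiff hE hψ⟩

/-- A continuous function agrees with its trace. -/
theorem trace_continuous (hE : IsOpen E) {ψ : Plane → ℝ} (hψ : Continuous ψ) {x : Plane}
    (hx : x ∈ closure E) : trace E ψ x = ψ x := by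
  refine HasTraceAt.trace_eq (Metric.tendsto_nhds.2 fun ε hε => ?_)
  obtain ⟨δ, hδ, hball⟩ := Metric.continuousAt_iff.1 hψ.continuousAt (ε / 2) (half_pos hε)
  filter_upwards [nhdsWithin_le_nhds (gt_mem_nhds hδ), self_mem_nhdsWithin] with r hr hr0
  have hr0 : 0 < r := hr0
  have hO : IsOpen (Metric.ball x r ∩ E) := Metric.isOpen_ball.inter hE
  have hne : (Metric.ball x r ∩ E).Nonempty :=
    mem_closure_iff.1 hx _ Metric.isOpen_ball (Metric.mem_ball_self hr0)
  have hfin : volume (Metric.ball x r ∩ E) < ⊤ :=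
    (measure_mono inter_subset_left).trans_lt measure_ball_lt_top
  have hin : ∀ᵐ y ∂volume.restrict (Metric.ball x r ∩ E),
      ψ y ∈ Metric.closedBall (ψ x) (ε / 2) := by
    filter_upwards [ae_restrict_mem hO.measurableSet] with y hy
    exact (hball (lt_trans hy.1 hr)).le
  have hint : IntegrableOn ψ (Metric.ball x r ∩ E) := by
    have := (hψ.continuousOn.integrableOn_compact (μ := volume) (isCompact_closedBall x r))
    exact this.mono_set (inter_subset_left.trans Metric.ball_subset_closedBall)
  have := (convex_closedBall (ψ x) (ε / 2)).set_average_mem Metric.isClosed_closedBall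
    (hO.measure_pos volume hne).ne' hfin.ne hin hint
  exact (Metric.mem_closedBall.1 this).trans_lt (half_lt_self hε)

/-! ### Approximation of test functions -/

theorem tendsto_mollify {ψ : Plane → ℝ} (hψ : Continuous ψ) (x : Plane) :
    Tendsto (fun k => mollify 0 k ψ x) atTop (𝓝 (ψ x)) := by
  simp only [mollify_eq_convolution, smul_zero, sub_zero]
  exact ContDiffBump.convolution_tendsto_right_of_continuous (φ := molBump) tendsto_molScale hψ x

theorem abs_mollify_le {v : Plane} {k : ℕ} {ψ : Plane → ℝ} (hψ : Continuous ψ) {C : ℝ}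
    (hC : ∀ x, |ψ x| ≤ C) (x : Plane) : |mollify v k ψ x| ≤ C := by
  have hC0 : 0 ≤ C := (abs_nonneg _).trans (hC 0)
  have h := enorm_mollify_sq_le (v := v) (k := k) hψ.aestronglyMeasurable x
  have h2 : ‖mollify v k ψ x‖ₑ ^ 2 ≤ ENNReal.ofReal C ^ 2 := by
    refine h.trans ?_
    calc _ ≤ ∫⁻ y, ENNReal.ofReal (molKernel k (x - molScale k • v - y)) * ENNReal.ofReal C ^ 2 := by
          refine lintegral_mono fun y => mul_le_mul' le_rfl (pow_le_pow_left₀ zero_le ?_ 2)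
          rw [Real.enorm_eq_ofReal_abs]
          exact ENNReal.ofReal_le_ofReal (hC y)
      _ = _ := by
          rw [lintegral_mul_const' _ _ (by finiteness), lintegral_molKernel_sub, one_mul]
  have h3 := (ENNReal.pow_le_pow_left_iff two_ne_zero).1 h2
  rw [Real.enorm_eq_ofReal_abs] at h3
  exact (ENNReal.ofReal_le_ofReal_iff hC0).1 h3

theorem partialDeriv_mollify {ψ : Plane → ℝ} (hψ : ContDiff ℝ 1 ψ) (hψc : HasCompactSupport ψ)
    (i : Fin 2) (k : ℕ) (x : Plane) :
    partialDeriv i (mollify 0 k ψ) x = mollify 0 k (partialDeriv i ψ) x := by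
  have h := fderiv_mollify_eq (v := 0) (k := k) (z := x) MeasurableSet.univ
    ((memLp_of_continuous_compactSupport hψ.continuous hψc volume).restrict univ)
    (hasWeakPartial_of_contDiff isOpen_univ hψ i) (subset_univ _)
  rwa [indicator_univ, indicator_univ] at h

/-! ### The weak tangential derivative of a trace -/

/-- The unit tangent is `(-n₁, n₀)`. -/
theorem fderiv_unitTangent (ψ : Plane → ℝ) (x : Plane) :
    fderiv ℝ ψ x (unitTangent E x)
      = outwardNormal E x 0 * partialDeriv 1 ψ x - outwardNormal E x 1 * partialDeriv 0 ψ x := by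
  rw [fderiv_apply_eq, unitTangent, perp]
  simp [partialDeriv]; ring

variable {p : Plane → ℝ} {P : Fin 2 → Plane → ℝ}

/-- The boundary pairing of `∇p` is the weak tangential derivative of the trace of `p`. -/
theorem MemH1.integral_trace_mul_tangent (hp : MemH1 E p P) (hE : IsOpen E)
    (hL : HasLipschitzBoundary E) (hb : Bornology.IsBounded E) {G : Plane → ℝ}
    (hG : MemLp G 2 (arcLength.restrict (frontier E)))
    (hGq : ∀ q Q, MemH1 E q Q → ∫ z in E, (P 1 z * Q 0 z - P 0 z * Q 1 z)
          = ∫ x in frontier E, trace E q x * G x ∂arcLength)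
    {ψ : Plane → ℝ} (hψ : ContDiff ℝ 1 ψ) (hψc : HasCompactSupport ψ) :
    ∫ x in frontier E, trace E p x * fderiv ℝ ψ x (unitTangent E x) ∂arcLength
      = -∫ x in frontier E, G x * ψ x ∂arcLength := by
  have hEm := hE.measurableSet
  have hFm : MeasurableSet (frontier E) := isClosed_frontier.measurableSet
  have htr := hp.memLp_trace hEm hL hb
  -- smooth test functions
  have hsmooth : ∀ s : Plane → ℝ, ContDiff ℝ ∞ s →
      ∫ x in frontier E, trace E p x * fderiv ℝ s x (unitTangent E x) ∂arcLength
        = -∫ x in frontier E, G x * s x ∂arcLength := by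
    intro s hs
    obtain ⟨χ, hχ, hχc, hχ1⟩ := exists_cutoff hb
    have e1 := hp.integral_cutPartial_mul hE hL hb hχ hχc hs
    -- The pairing of `∇p` with `∇s` is antisymmetric: Gauss–Green for `p` evaluates it as the left
    -- side, the density `G` as the right side.
    have e2 := hGq s _ (memH1_of_contDiff hE hb (hs.of_le (by simp)))
    have e3 : ∫ x in frontier E, trace E p x * fderiv ℝ s x (unitTangent E x) ∂arcLength
        = ∫ x in frontier E, trace E p x * (χ x * (outwardNormal E x 0 * partialDeriv 1 s x
          - outwardNormal E x 1 * partialDeriv 0 s x)) ∂arcLength := by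
      refine setIntegral_congr_fun hFm fun x hx => ?_
      dsimp only
      rw [fderiv_unitTangent, (hχ1 x (frontier_subset_closure hx)).eq_of_nhds, one_mul]
    have e4 : ∫ x in frontier E, G x * s x ∂arcLength
        = ∫ x in frontier E, trace E s x * G x ∂arcLength := by
      refine setIntegral_congr_fun hFm fun x hx => ?_
      rw [trace_continuous hE hs.continuous (frontier_subset_closure hx), mul_comm]
    rw [e3, e4, ← e1, ← e2, ← integral_neg]
    refine setIntegral_congr_fun hEm fun z hz => ?_
    have h1 := hχ1 z (subset_closure hz)
    have : ∀ i, cutPartial χ p P i z = P i z := fun i => by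
      rw [cutPartial, partialDeriv, h1.fderiv_eq, h1.eq_of_nhds]; simp
    simp only [this]; ring
  -- approximation of the test function
  obtain ⟨C, hC⟩ := hψ.continuous.bounded_above_of_compact_support hψc
  have hbd : ∀ i, ∃ C, ∀ x, ‖partialDeriv i ψ x‖ ≤ C := fun i =>
    (continuous_partialDeriv hψ i).bounded_above_of_compact_support (hψc.partialDeriv i)
  choose D hD using hbd
  have hloc : LocallyIntegrable ψ := hψ.continuous.locallyIntegrable
  have hsk : ∀ k, ContDiff ℝ ∞ (mollify 0 k ψ) := fun k => contDiff_mollify hloc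
  have hfin : IsFiniteMeasure (arcLength.restrict (frontier E)) := ⟨by
    rw [Measure.restrict_apply_univ]; exact arcLength_frontier_lt_top hL hb⟩
  have hn := fun i => aestronglyMeasurable_outwardNormal hL hb i
  have l1 : Tendsto (fun k => ∫ x in frontier E, trace E p x
      * fderiv ℝ (mollify 0 k ψ) x (unitTangent E x) ∂arcLength) atTop
      (𝓝 (∫ x in frontier E, trace E p x * fderiv ℝ ψ x (unitTangent E x) ∂arcLength)) := by
    simp only [fderiv_unitTangent, partialDeriv_mollify hψ hψc]
    have hc : ∀ i k, Continuous (mollify 0 k (partialDeriv i ψ)) := fun i k =>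
      (contDiff_mollify (continuous_partialDeriv hψ i).locallyIntegrable).continuous
    refine tendsto_integral_of_dominated_convergence
      (fun x => ‖trace E p x‖ * (D 1 + D 0)) (fun k => ?_) ?_ (fun k => ae_of_all _ fun x => ?_)
      (ae_of_all _ fun x => ?_)
    · exact htr.1.mul (((hn 0).mul (hc 1 k).aestronglyMeasurable).sub
        ((hn 1).mul (hc 0 k).aestronglyMeasurable))
    · exact (htr.integrable (by norm_num)).norm.mul_const _
    · rw [norm_mul]
      refine mul_le_mul_of_nonneg_left ((norm_sub_le _ _).trans (add_le_add ?_ ?_)) (norm_nonneg _)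
      · rw [norm_mul, ← one_mul (D 1)]
        exact mul_le_mul (abs_outwardNormal_le E x 0)
          (abs_mollify_le (continuous_partialDeriv hψ 1) (hD 1) x) (norm_nonneg _) zero_le_one
      · rw [norm_mul, ← one_mul (D 0)]
        exact mul_le_mul (abs_outwardNormal_le E x 1)
          (abs_mollify_le (continuous_partialDeriv hψ 0) (hD 0) x) (norm_nonneg _) zero_le_one
    · exact (((tendsto_mollify (continuous_partialDeriv hψ 1) x).const_mul _).sub
        ((tendsto_mollify (continuous_partialDeriv hψ 0) x).const_mul _)).const_mul _
  have l2 : Tendsto (fun k => ∫ x in frontier E, G x * mollify 0 k ψ x ∂arcLength) atTop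
      (𝓝 (∫ x in frontier E, G x * ψ x ∂arcLength)) := by
    refine tendsto_integral_of_dominated_convergence
      (fun x => ‖G x‖ * C) (fun k => hG.1.mul (hsk k).continuous.aestronglyMeasurable)
      ((hG.integrable (by norm_num)).norm.mul_const _) (fun k => ae_of_all _ fun x => ?_)
      (ae_of_all _ fun x => (tendsto_mollify hψ.continuous x).const_mul _)
    rw [norm_mul]
    exact mul_le_mul_of_nonneg_left (abs_mollify_le hψ.continuous hC x) (norm_nonneg _)
  exact tendsto_nhds_unique l1 (l2.neg.congr fun k => (hsmooth _ (hsk k)).symm)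

end

section

open scoped ENNReal

variable {c : Plane ≃ᵃⁱ[ℝ] Plane} {φ : ℝ → ℝ} {E Γ : Set Plane} {K : NNReal} {a d a' d' : ℝ}

/-! ### Charts of class `C²` -/

/-- A chart in which the boundary is the graph of a `C²` function. -/
structure IsC2Chart (E : Set Plane) (c : Plane ≃ᵃⁱ[ℝ] Plane) (φ : ℝ → ℝ) (K : NNReal)
    (a d : ℝ) : Prop extends IsLipChart E c φ K a d where
  contDiffOn : ContDiffOn ℝ 2 φ (Ioo (-a) a)

theorem IsGraphNear.exists_isC2Chart {x : Plane}
    (h : IsGraphNear (fun φ I => ContDiffOn ℝ 2 φ I) E Γ x) (hx : x ∈ Γ) :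
    ∃ c φ K a d, IsC2Chart E c φ K a d ∧ x ∈ chartBox c φ a d ∧
      ∀ z ∈ chartBox c φ a d, (z ∈ Γ ↔ z ∈ frontier E) := by
  obtain ⟨c, φ₀, φ, K, a, d, a', d', hc, ⟨-, h1⟩, heq, -, -, h2, h3, h4, h5⟩ :=
    h.lipschitz_and_c2.exists_isLipChart (fun _ _ h => h.1) hx
  exact ⟨c, φ, K, a, d, ⟨hc, h1.congr fun t ht => (heq ht).symm⟩,
    ⟨h4.1.trans h2, h4.2.trans h3⟩, h5⟩

/-- The frame of a chart is positively or negatively oriented. -/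
theorem exists_orientation (c : Plane ≃ᵃⁱ[ℝ] Plane) : ∃ o : ℝ, o ^ 2 = 1 ∧
    perp (horVec c) = o • upVec c ∧ perp (upVec c) = -o • horVec c := by
  have hperp : ∀ v : Plane, inner ℝ (perp v) v = 0 := fun v => by
    simp [perp, PiLp.inner_apply, Fin.sum_univ_two]; ring
  have hnorm : ∀ v : Plane, inner ℝ (perp v) (perp v) = inner ℝ v v := fun v => by
    simp only [perp, PiLp.inner_apply, Fin.sum_univ_two]; simp; ring
  have hpp : perp (perp (horVec c)) = -horVec c := by
    ext i; fin_cases i <;> simp [perp]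
  have hsm : ∀ (r : ℝ) (v : Plane), perp (r • v) = r • perp v := fun r v => by
    ext i; fin_cases i <;> simp [perp]
  have h1 := eq_frame (c := c) (perp (horVec c))
  rw [hperp, zero_smul, zero_add] at h1
  set o := inner ℝ (perp (horVec c)) (upVec c)
  have ho : o ^ 2 = 1 := by
    have h2 := hnorm (horVec c)
    rw [h1, inner_smul_left, inner_smul_right, inner_upVec_self, inner_horVec_self] at h2
    simp only [RCLike.conj_to_real] at h2
    linarith
  refine ⟨o, ho, h1, ?_⟩
  have h3 : o • perp (upVec c) = -horVec c := by rw [← hsm, ← h1, hpp]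
  have h4 : (o * o) • perp (upVec c) = -o • horVec c := by
    rw [mul_smul, h3, smul_neg, neg_smul]
  rwa [← sq, ho, one_smul] at h4

theorem contDiff_coord (i : Fin 2) {n : WithTop ℕ∞} : ContDiff ℝ n fun z : Plane => c z i := by
  have h : ∀ z : Plane, c z = c.linearIsometryEquiv z + c 0 := fun z => by
    have := c.map_vadd 0 z
    simpa using this
  have h2 : (fun z : Plane => c z i) = fun z => (c.linearIsometryEquiv z) i + (c 0) i := by
    ext z; rw [h, PiLp.add_apply]
  rw [h2]
  exact (((EuclideanSpace.proj (𝕜 := ℝ) i).contDiff).comp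
    c.linearIsometryEquiv.contDiff).add contDiff_const

theorem perp_add (v w : Plane) : perp (v + w) = perp v + perp w := by
  ext i; fin_cases i <;> simp [perp]; ring

theorem perp_smul (r : ℝ) (v : Plane) : perp (r • v) = r • perp v := by
  ext i; fin_cases i <;> simp [perp]

namespace IsC2Chart

variable (h : IsC2Chart E c φ K a d)
include h

theorem hasDerivAt {t : ℝ} (ht : t ∈ Ioo (-a) a) : HasDerivAt φ (deriv φ t) t :=
  ((h.contDiffOn.differentiableOn (by norm_num)).differentiableAt
    (isOpen_Ioo.mem_nhds ht)).hasDerivAt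

theorem contDiffOn_deriv : ContDiffOn ℝ 1 (deriv φ) (Ioo (-a) a) :=
  ((contDiffOn_succ_iff_deriv_of_isOpen (n := 1) isOpen_Ioo).1 h.contDiffOn).2.2

theorem isOutwardNormal_graphCurve {t : ℝ} (ht : t ∈ Ioo (-a) a) :
    IsOutwardNormal E (graphCurve c φ t) (slopeNormal c (deriv φ t)) :=
  h.isOutwardNormal ht (h.hasDerivAt ht).differentiableAt

theorem graphCurve_mem {t : ℝ} (ht : t ∈ Ioo (-a) a) :
    graphCurve c φ t ∈ frontier E ∩ chartBox c φ a d := by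
  rw [h.frontier_inter]; exact mem_image_of_mem _ ht

theorem exists_graphCurve {x : Plane} (hx : x ∈ frontier E ∩ chartBox c φ a d) :
    ∃ t ∈ Ioo (-a) a, graphCurve c φ t = x := by
  rw [h.frontier_inter] at hx; exact hx

/-- The velocity of the boundary curve is a nonzero multiple of the unit tangent. -/
theorem exists_velocity : ∃ κ : ℝ → ℝ, ContinuousOn κ (Ioo (-a) a) ∧ (∀ t, κ t ≠ 0) ∧
    ∀ t ∈ Ioo (-a) a, HasDerivAt (graphCurve c φ)
      (κ t • unitTangent E (graphCurve c φ t)) t := by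
  obtain ⟨o, ho, o1, o2⟩ := exists_orientation c
  have ho0 : o ≠ 0 := fun h0 => by rw [h0] at ho; norm_num at ho
  refine ⟨fun t => -o * graphSpeed φ t, ?_, fun t => mul_ne_zero (neg_ne_zero.2 ho0)
    (graphSpeed_pos t).ne', fun t ht => ?_⟩
  · have := h.contDiffOn_deriv.continuousOn
    exact continuousOn_const.mul (Real.continuous_sqrt.comp_continuousOn
      (continuousOn_const.add (this.pow 2)))
  · have hT : (-o * graphSpeed φ t) • unitTangent E (graphCurve c φ t)
        = horVec c + deriv φ t • upVec c := by
      have hs := (graphSpeed_pos (φ := φ) t).ne'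
      rw [unitTangent, (h.isOutwardNormal_graphCurve ht).outwardNormal_eq, slopeNormal, perp_smul,
        sub_eq_add_neg, ← neg_smul, perp_add, perp_smul, o1, o2]
      change (-o * graphSpeed φ t) • ((graphSpeed φ t)⁻¹ • _) = _
      rw [smul_smul, mul_assoc, mul_inv_cancel₀ hs, mul_one, smul_add, smul_smul, smul_smul,
        smul_smul]
      have e1 : -o * -o = 1 := by linear_combination ho
      have e2 : -o * -deriv φ t * o = deriv φ t := by linear_combination deriv φ t * ho
      rw [e1, e2, one_smul]
    rw [hT]
    have hg : graphCurve c φ = fun t => c.symm 0 + t • horVec c + φ t • upVec c := by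
      ext1 t; rw [graphCurve_eq]
    rw [hg]
    have := (((hasDerivAt_id t).smul_const (horVec c)).const_add (c.symm 0)).add
      ((h.hasDerivAt ht).smul_const (upVec c))
    rw [one_smul] at this
    exact this

/-- The chain rule along the boundary curve. -/
theorem hasDerivAt_comp {κ : ℝ → ℝ} {t : ℝ} (ht : t ∈ Ioo (-a) a)
    (hκ : HasDerivAt (graphCurve c φ) (κ t • unitTangent E (graphCurve c φ t)) t)
    {g : Plane → ℝ} (hg : DifferentiableWithinAt ℝ g (frontier E) (graphCurve c φ t)) :
    HasDerivAt (fun t => g (graphCurve c φ t)) (κ t * tangDeriv E g (graphCurve c φ t)) t := by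
  have := hg.hasFDerivWithinAt.comp_hasDerivAt t hκ (by
    filter_upwards [isOpen_Ioo.mem_nhds ht] with s hs using (h.graphCurve_mem hs).1)
  rw [map_smul, smul_eq_mul] at this
  exact this

/-- A function which is continuously differentiable on the boundary is so along the boundary
curve. -/
theorem contDiffOn_comp {g : Plane → ℝ}
    (hg : ∀ x ∈ frontier E ∩ chartBox c φ a d, DifferentiableWithinAt ℝ g (frontier E) x)
    (hgc : ContinuousOn (tangDeriv E g) (frontier E ∩ chartBox c φ a d)) :
    ContDiffOn ℝ 1 (fun t => g (graphCurve c φ t)) (Ioo (-a) a) := by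
  obtain ⟨κ, hκc, -, hκ⟩ := h.exists_velocity
  have hd : ∀ t ∈ Ioo (-a) a, HasDerivAt (fun t => g (graphCurve c φ t))
      (κ t * tangDeriv E g (graphCurve c φ t)) t := fun t ht =>
    h.hasDerivAt_comp ht (hκ t ht) (hg _ (h.graphCurve_mem ht))
  refine (contDiffOn_succ_iff_deriv_of_isOpen (n := 0) isOpen_Ioo).2
    ⟨fun t ht => (hd t ht).differentiableAt.differentiableWithinAt, by simp, contDiffOn_zero.2 ?_⟩
  have hc : ContinuousOn (fun t => κ t * tangDeriv E g (graphCurve c φ t)) (Ioo (-a) a) :=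
    hκc.mul (hgc.comp (continuous_graphCurve h.continuous).continuousOn
      fun t ht => h.graphCurve_mem ht)
  exact hc.congr fun t ht => (hd t ht).deriv

/-- The product of a test function carried by a chart with a function which is continuously
differentiable on the boundary agrees on the boundary with a test function. -/
theorem exists_test_mul {g : Plane → ℝ}
    (hg : ∀ x ∈ frontier E ∩ chartBox c φ a d, DifferentiableWithinAt ℝ g (frontier E) x)
    (hgc : ContinuousOn (tangDeriv E g) (frontier E ∩ chartBox c φ a d))
    {ψ : Plane → ℝ} (hψ : ContDiff ℝ 1 ψ) (hψc : HasCompactSupport ψ)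
    (hψs : tsupport ψ ⊆ chartBox c φ a d) :
    ∃ χ : Plane → ℝ, ContDiff ℝ 1 χ ∧ HasCompactSupport χ ∧ tsupport χ ⊆ tsupport ψ ∧
      ∀ x ∈ frontier E, χ x = ψ x * g x ∧ fderiv ℝ χ x (unitTangent E x)
        = g x * fderiv ℝ ψ x (unitTangent E x) + ψ x * tangDeriv E g x := by
  obtain ⟨κ, hκc, hκ0, hκ⟩ := h.exists_velocity
  -- Extend `g` off the boundary as a function that is constant on vertical lines.
  set χ : Plane → ℝ := fun y => ψ y * g (graphCurve c φ (c y 0)) with hχ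
  have hχs : tsupport χ ⊆ tsupport ψ := tsupport_mul_subset_left
  have hgC := h.contDiffOn_comp hg hgc
  have hχC : ContDiff ℝ 1 χ := by
    refine contDiff_iff_contDiffAt.2 fun y => ?_
    by_cases hy : y ∈ chartBox c φ a d
    · have h1 : ContDiffAt ℝ 1 (fun t => g (graphCurve c φ t)) (c y 0) :=
        hgC.contDiffAt (isOpen_Ioo.mem_nhds (abs_lt.1 hy.1))
      have h2 : ContDiffAt ℝ 1 (fun z : Plane => c z 0) y := (contDiff_coord 0).contDiffAt
      exact hψ.contDiffAt.mul (ContDiffAt.comp (f := fun z : Plane => c z 0) y h1 h2)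
    · have : χ =ᶠ[𝓝 y] fun _ => 0 := notMem_tsupport_iff_eventuallyEq.1 fun hy' =>
        hy (hψs (hχs hy'))
      exact contDiffAt_const.congr_of_eventuallyEq this
  refine ⟨χ, hχC, hψc.mul_right, hχs, fun x hx => ?_⟩
  by_cases hxB : x ∈ chartBox c φ a d
  · obtain ⟨t, ht, rfl⟩ := h.exists_graphCurve ⟨hx, hxB⟩
    have hval : ∀ t, χ (graphCurve c φ t) = ψ (graphCurve c φ t) * g (graphCurve c φ t) := by
      intro t; simp only [hχ, coord_graphCurve_zero]
    refine ⟨hval t, ?_⟩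
    have d1 := ((hχC.differentiable (by simp)) (graphCurve c φ t)).hasFDerivAt.comp_hasDerivAt t
      (hκ t ht)
    have d2 := (((hψ.differentiable (by simp)) (graphCurve c φ t)).hasFDerivAt.comp_hasDerivAt t
      (hκ t ht)).mul (h.hasDerivAt_comp ht (hκ t ht) (hg _ ⟨hx, hxB⟩))
    have hfun : (χ ∘ graphCurve c φ)
        = (ψ ∘ graphCurve c φ) * fun t => g (graphCurve c φ t) := by
      ext t; exact hval t
    rw [hfun] at d1
    have := d1.unique d2
    rw [map_smul, map_smul, smul_eq_mul, smul_eq_mul, Function.comp_apply] at this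
    -- Both derivatives are taken along the boundary curve, whose speed `κ t` cancels.
    refine mul_left_cancel₀ (hκ0 t) (this.trans ?_)
    ring
  · have h1 : x ∉ tsupport ψ := fun hx' => hxB (hψs hx')
    have h2 : x ∉ tsupport χ := fun hx' => h1 (hχs hx')
    have h3 : ∀ {ψ : Plane → ℝ}, x ∉ tsupport ψ → fderiv ℝ ψ x = 0 := fun hx =>
      image_eq_zero_of_notMem_tsupport fun hz' => hx (tsupport_fderiv_subset ℝ hz')
    rw [image_eq_zero_of_notMem_tsupport h1, image_eq_zero_of_notMem_tsupport h2, h3 h1, h3 h2]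
    simp

end IsC2Chart

/-! ### Sobolev functions on a boundary portion -/

/-- `Γ` is a relatively open part of the boundary, of full length, and of class `C²`. -/
structure IsC2Portion (E Γ : Set Plane) : Prop where
  subset : Γ ⊆ frontier E
  chart : ∀ x ∈ Γ, ∃ c φ K a d, IsC2Chart E c φ K a d ∧ x ∈ chartBox c φ a d ∧
    frontier E ∩ chartBox c φ a d ⊆ Γ
  null : arcLength (frontier E \ Γ) = 0

theorem IsC2Portion.exists_isOpen (h : IsC2Portion E Γ) : ∃ O, IsOpen O ∧ Γ = frontier E ∩ O := by
  refine ⟨⋃₀ {U | IsOpen U ∧ frontier E ∩ U ⊆ Γ}, isOpen_sUnion fun U hU => hU.1, ?_⟩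
  ext x
  constructor
  · intro hx
    obtain ⟨c, φ, K, a, d, hc, hxb, hs⟩ := h.chart x hx
    exact ⟨h.subset hx, mem_sUnion.2 ⟨_, ⟨hc.isOpen_chartBox, hs⟩, hxb⟩⟩
  · rintro ⟨hx, U, ⟨-, hU⟩, hxU⟩
    exact hU ⟨hx, hxU⟩

theorem IsC2Portion.measurableSet (h : IsC2Portion E Γ) : MeasurableSet Γ := by
  obtain ⟨O, hO, rfl⟩ := h.exists_isOpen
  exact isClosed_frontier.measurableSet.inter hO.measurableSet

theorem IsC2Portion.restrict_eq (h : IsC2Portion E Γ) :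
    arcLength.restrict Γ = arcLength.restrict (frontier E) :=
  Measure.restrict_congr_set (Filter.EventuallyLE.antisymm h.subset.eventuallyLE
    (ae_le_set.2 h.null))

/-- `f` is square integrable on the boundary and has the square integrable weak tangential
derivative `g` on `Γ`. -/
structure IsBoundaryH1 (E Γ : Set Plane) (f g : Plane → ℝ) : Prop where
  memLp : MemLp f 2 (arcLength.restrict (frontier E))
  memLp_deriv : MemLp g 2 (arcLength.restrict (frontier E))
  weak : ∀ ψ : Plane → ℝ, ContDiff ℝ 1 ψ → HasCompactSupport ψ → tsupport ψ ∩ frontier E ⊆ Γ →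
    ∫ x in frontier E, (f x * fderiv ℝ ψ x (unitTangent E x) + g x * ψ x) ∂arcLength = 0

section

variable {f g f' g' : Plane → ℝ} (hL : HasLipschitzBoundary E) (hb : Bornology.IsBounded E)
include hL hb

theorem memLp_fderiv_unitTangent {ψ : Plane → ℝ} (hψ : ContDiff ℝ 1 ψ) :
    MemLp (fun x => fderiv ℝ ψ x (unitTangent E x)) 2 (arcLength.restrict (frontier E)) := by
  have h0 := memLp_continuous_mul_outwardNormal hL hb (continuous_partialDeriv hψ 1) 0
  have h1 := memLp_continuous_mul_outwardNormal hL hb (continuous_partialDeriv hψ 0) 1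
  refine (memLp_congr_ae (ae_of_all _ fun x => ?_)).1 (h0.sub h1)
  rw [fderiv_unitTangent, Pi.sub_apply]; ring

theorem IsBoundaryH1.integrable (hf : MemLp f 2 (arcLength.restrict (frontier E)))
    (hg : MemLp g 2 (arcLength.restrict (frontier E))) {ψ : Plane → ℝ} (hψ : ContDiff ℝ 1 ψ) :
    Integrable (fun x => f x * fderiv ℝ ψ x (unitTangent E x)) (arcLength.restrict (frontier E)) ∧
      Integrable (fun x => g x * ψ x) (arcLength.restrict (frontier E)) :=
  ⟨hf.integrable_mul (memLp_fderiv_unitTangent hL hb hψ),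
    hg.integrable_mul (memLp_continuous_frontier hL hb hψ.continuous)⟩

theorem IsBoundaryH1.add (h : IsBoundaryH1 E Γ f g) (h' : IsBoundaryH1 E Γ f' g') :
    IsBoundaryH1 E Γ (fun x => f x + f' x) (fun x => g x + g' x) := by
  refine ⟨h.memLp.add h'.memLp, h.memLp_deriv.add h'.memLp_deriv, fun ψ hψ hψc hψs => ?_⟩
  have i1 := IsBoundaryH1.integrable hL hb h.memLp h.memLp_deriv hψ
  have i2 := IsBoundaryH1.integrable hL hb h'.memLp h'.memLp_deriv hψ
  have := integral_add (i1.1.add i1.2) (i2.1.add i2.2)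
  simp only [Pi.add_apply] at this
  rw [h.weak ψ hψ hψc hψs, h'.weak ψ hψ hψc hψs, add_zero] at this
  rw [← this]
  exact integral_congr_ae (ae_of_all _ fun x => by ring)

omit hL hb in
theorem IsBoundaryH1.neg (h : IsBoundaryH1 E Γ f g) :
    IsBoundaryH1 E Γ (fun x => -f x) (fun x => -g x) := by
  refine ⟨h.memLp.neg, h.memLp_deriv.neg, fun ψ hψ hψc hψs => ?_⟩
  rw [← neg_eq_zero, ← integral_neg, ← h.weak ψ hψ hψc hψs]
  exact integral_congr_ae (ae_of_all _ fun x => by ring)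

theorem IsBoundaryH1.hasWeakTangDeriv (h : IsBoundaryH1 E Γ f g) (hΓ : IsC2Portion E Γ) :
    HasWeakTangDeriv E Γ f g := by
  have hfin : IsFiniteMeasure (arcLength.restrict (frontier E)) := ⟨by
    rw [Measure.restrict_apply_univ]; exact arcLength_frontier_lt_top hL hb⟩
  have hloc : ∀ {f : Plane → ℝ}, MemLp f 2 (arcLength.restrict (frontier E)) →
      LocallyIntegrableOn f Γ arcLength := fun {f} hf => by
    have hi : Integrable f (arcLength.restrict Γ) := by
      rw [hΓ.restrict_eq]; exact hf.integrable (by norm_num)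
    exact IntegrableOn.locallyIntegrableOn hi
  refine ⟨hloc h.memLp, hloc h.memLp_deriv, fun ψ hψ hψc hψs => ?_⟩
  have i := IsBoundaryH1.integrable hL hb h.memLp h.memLp_deriv hψ
  rw [hΓ.restrict_eq, eq_neg_iff_add_eq_zero, ← integral_add i.1 i.2]
  exact h.weak ψ hψ hψc hψs

/-- The product rule for the weak tangential derivative. -/
theorem IsBoundaryH1.mul (hf : IsBoundaryH1 E (frontier E) f f') (hΓ : IsC2Portion E Γ)
    (hg : ∀ x ∈ Γ, DifferentiableWithinAt ℝ g (frontier E) x)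
    (hgc : ContinuousOn (tangDeriv E g) Γ) {C M : ℝ} (hC : ∀ x ∈ Γ, |g x| ≤ C)
    (hM : ∀ x ∈ Γ, |tangDeriv E g x| ≤ M) :
    IsBoundaryH1 E Γ (fun x => f x * g x) (fun x => f' x * g x + f x * tangDeriv E g x) := by
  have hΓm := hΓ.measurableSet
  have hgC : ContinuousOn g Γ := fun x hx => (hg x hx).continuousWithinAt.mono hΓ.subset
  have haem : ∀ {g : Plane → ℝ}, ContinuousOn g Γ →
      AEStronglyMeasurable g (arcLength.restrict (frontier E)) := fun hg => by
    rw [← hΓ.restrict_eq]; exact hg.aestronglyMeasurable hΓm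
  have hae : ∀ {g : Plane → ℝ} {C : ℝ}, (∀ x ∈ Γ, |g x| ≤ C) →
      ∀ᵐ x ∂arcLength.restrict (frontier E), |g x| ≤ C := fun hg => by
    rw [← hΓ.restrict_eq]
    filter_upwards [ae_restrict_mem hΓm] with x hx using hg x hx
  have m1 := memLp_mul_of_bound hf.memLp (haem hgC) (hae hC)
  have m2 := (memLp_mul_of_bound hf.memLp_deriv (haem hgC) (hae hC)).add
    (memLp_mul_of_bound hf.memLp (haem hgc) (hae hM))
  refine ⟨m1, m2, fun ψ hψ hψc hψs => ?_⟩
  refine localise_test_functions (m := 1) (by simp) (Q := fun ψ => ∫ x in frontier E, (f x * g x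
    * fderiv ℝ ψ x (unitTangent E x) + (f' x * g x + f x * tangDeriv E g x) * ψ x) ∂arcLength = 0)
    (by simp) ?_ ((frontier E)ᶜ ∪ Γ) ?_ hψ hψc ?_
  · intro ψ₁ ψ₂ h1 _ h2 _ e1 e2
    have i1 := IsBoundaryH1.integrable hL hb m1 m2 h1
    have i2 := IsBoundaryH1.integrable hL hb m1 m2 h2
    have := integral_add (i1.1.add i1.2) (i2.1.add i2.2)
    simp only [Pi.add_apply] at this
    rw [e1, e2, add_zero] at this
    rw [← this]
    refine integral_congr_ae (ae_of_all _ fun x => ?_)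
    dsimp only
    rw [fderiv_add (h1.differentiable (by simp) x) (h2.differentiable (by simp) x),
      Pi.add_apply, add_apply]
    ring
  -- Off the boundary there is nothing to integrate; near a point of `Γ`, multiply the test function
  -- by `g`.
  · rintro x (hx | hx)
    · refine ⟨(frontier E)ᶜ, isClosed_frontier.isOpen_compl, hx, fun ψ hψ hψc hψs => ?_⟩
      refine setIntegral_eq_zero_of_forall_eq_zero fun y hy => ?_
      have hy' : y ∉ tsupport ψ := fun hy' => hψs hy' hy
      have h3 : fderiv ℝ ψ y = 0 :=
        image_eq_zero_of_notMem_tsupport fun hz' => hy' (tsupport_fderiv_subset ℝ hz')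
      rw [image_eq_zero_of_notMem_tsupport hy', h3]; simp
    · obtain ⟨c, φ, K, a, d, hc, hxb, hs⟩ := hΓ.chart x hx
      refine ⟨_, hc.isOpen_chartBox, hxb, fun ψ hψ hψc hψs => ?_⟩
      obtain ⟨χ, hχ, hχc, -, hχe⟩ := hc.exists_test_mul (fun y hy => hg y (hs hy)) (hgc.mono hs)
        hψ hψc hψs
      rw [← hf.weak χ hχ hχc inter_subset_right]
      refine setIntegral_congr_fun isClosed_frontier.measurableSet fun y hy => ?_
      rw [(hχe y hy).1, (hχe y hy).2]; ring
  · intro x hx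
    by_cases hxF : x ∈ frontier E
    · exact Or.inr (hψs ⟨hx, hxF⟩)
    · exact Or.inl hxF

end

/-- The weak tangential derivative is unique almost everywhere. -/
theorem HasWeakTangDeriv.ae_eq (hΓ : IsC2Portion E Γ) {f g g' : Plane → ℝ}
    (h : HasWeakTangDeriv E Γ f g) (h' : HasWeakTangDeriv E Γ f g') :
    g =ᵐ[arcLength.restrict (frontier E)] g' := by
  obtain ⟨O, hO, hΓO⟩ := hΓ.exists_isOpen
  have hΓm := hΓ.measurableSet
  rw [← hΓ.restrict_eq]
  -- The fundamental lemma of the calculus of variations, for the arc length measure on the open set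
  -- `O` which cuts `Γ` out of the boundary.
  have hloc : LocallyIntegrableOn (g - g') O (arcLength.restrict Γ) := by
    intro x hx
    by_cases hxF : x ∈ frontier E
    · have hxΓ : x ∈ Γ := by rw [hΓO]; exact ⟨hxF, hx⟩
      obtain ⟨t, ht, hi⟩ := (h.2.1.sub h'.2.1) x hxΓ
      obtain ⟨U, hU, hxU, hUt⟩ := mem_nhdsWithin.1 ht
      refine ⟨U, nhdsWithin_le_nhds (hU.mem_nhds hxU), ?_⟩
      rw [IntegrableOn, Measure.restrict_restrict hU.measurableSet]
      exact hi.mono_set hUt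
    · refine ⟨(frontier E)ᶜ, nhdsWithin_le_nhds
        (isClosed_frontier.isOpen_compl.mem_nhds hxF), ?_⟩
      rw [IntegrableOn, Measure.restrict_restrict isClosed_frontier.isOpen_compl.measurableSet]
      have : (frontier E)ᶜ ∩ Γ = ∅ := by
        ext y; simp only [mem_inter_iff, mem_compl_iff, mem_empty_iff_false, iff_false, not_and]
        exact fun hy hy' => hy (hΓ.subset hy')
      rw [this, Measure.restrict_empty]
      exact integrable_zero_measure
  have hz := hO.ae_eq_zero_of_integral_contDiff_smul_eq_zero hloc fun ψ hψ hψc hψs => by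
    have hψ1 : ContDiff ℝ 1 ψ := hψ.of_le (by simp)
    have hs : tsupport ψ ∩ frontier E ⊆ Γ := by
      rw [hΓO]; exact fun x hx => ⟨hx.2, hψs hx.1⟩
    have hi : ∀ {g}, LocallyIntegrableOn g Γ arcLength →
        IntegrableOn (fun x => g x * ψ x) Γ arcLength := fun hg =>
      integrableOn_mul_of_locallyIntegrableOn hΓm hg (hψc.isCompact.inter_right isClosed_frontier)
        hs hψ.continuous fun x hx => image_eq_zero_of_notMem_tsupport fun hx' =>
          hx.2 ⟨hx', hΓ.subset hx.1⟩
    have e : ∀ x, ψ x • (g - g') x = g x * ψ x - g' x * ψ x := fun x => by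
      simp only [Pi.sub_apply, smul_eq_mul]; ring
    simp only [e]
    rw [integral_sub (hi h.2.1) (hi h'.2.1), sub_eq_zero, ← neg_inj, ← h.2.2 ψ hψ1 hψc hs,
      ← h'.2.2 ψ hψ1 hψc hs]
  filter_upwards [hz, ae_restrict_mem hΓm] with x hx hxΓ
  rw [hΓO] at hxΓ
  exact sub_eq_zero.1 (hx hxΓ.2)

theorem HasWeakTangDeriv.hasWeakTangDeriv_weakTangDeriv {f g : Plane → ℝ}
    (h : HasWeakTangDeriv E Γ f g) : HasWeakTangDeriv E Γ f (weakTangDeriv E Γ f) := by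
  have hex : ∃ g, HasWeakTangDeriv E Γ f g := ⟨g, h⟩
  rw [weakTangDeriv, dif_pos hex]
  exact hex.choose_spec

end

section

open scoped ENNReal

variable {c : Plane ≃ᵃⁱ[ℝ] Plane} {φ : ℝ → ℝ} {E Γ : Set Plane} {K : NNReal} {a d : ℝ}

/-! ### The identities for a boundary of class `C²` up to a null set -/

theorem inner_eq (v w : Plane) : inner ℝ v w = v 0 * w 0 + v 1 * w 1 := by
  simp [PiLp.inner_apply, Fin.sum_univ_two]; ring

theorem dirDeriv_eq (b : Plane → Plane) (w : Plane → ℝ) (x : Plane) :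
    dirDeriv E b w x = b x 0 * trace E (weakPartial E 0 w) x
      + b x 1 * trace E (weakPartial E 1 w) x := by
  rw [dirDeriv, inner_eq]; simp [gradTrace]

theorem sq_add_sq_eq_one {v : Plane} (hv : ‖v‖ = 1) : v 0 ^ 2 + v 1 ^ 2 = 1 := by
  have := EuclideanSpace.real_norm_sq_eq v
  rw [hv, Fin.sum_univ_two] at this
  linarith

theorem abs_apply_le_one {v : Plane} (hv : ‖v‖ = 1) (i : Fin 2) : |v i| ≤ 1 :=
  (PiLp.norm_apply_le (p := 2) v i).trans hv.le

/-- The tangential derivative of a unit field is orthogonal to the field. -/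
theorem IsC2Portion.sum_mul_tangDeriv (hΓ : IsC2Portion E Γ) {β : Plane → Plane}
    (h1 : ∀ x ∈ Γ, ‖β x‖ = 1)
    (hd : ∀ i, ∀ x ∈ Γ, DifferentiableWithinAt ℝ (fun y => β y i) (frontier E) x) {x : Plane}
    (hx : x ∈ Γ) : β x 0 * tangDeriv E (fun y => β y 0) x
      + β x 1 * tangDeriv E (fun y => β y 1) x = 0 := by
  obtain ⟨c, φ, K, a, d, h, hxb, hs⟩ := hΓ.chart x hx
  obtain ⟨t, ht, rfl⟩ := h.exists_graphCurve ⟨hΓ.subset hx, hxb⟩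
  obtain ⟨κ, -, hκ0, hκ⟩ := h.exists_velocity
  have hi := fun i => (h.hasDerivAt_comp ht (hκ t ht) (hd i _ hx)).pow 2
  have h2 := (hi 0).add (hi 1)
  have h3 : HasDerivAt (fun _ : ℝ => (1 : ℝ)) 0 t := hasDerivAt_const t 1
  have h4 := h2.unique (h3.congr_of_eventuallyEq (by
    filter_upwards [isOpen_Ioo.mem_nhds ht] with s hs'
    exact sq_add_sq_eq_one (h1 _ (hs (h.graphCurve_mem hs')))))
  refine mul_left_cancel₀ (hκ0 t) ?_
  push_cast at h4
  linarith

/-- The algebraic identity behind the change of frame: it expresses the tangential derivatives of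
the partial derivatives by those of the derivatives in the moving frame. -/
theorem moving_frame_identity {b0 b1 b0' b1' A0 A1 A0' A1' B0 B1 : ℝ} (h1 : b0 ^ 2 + b1 ^ 2 = 1)
    (h2 : b0 * b0' + b1 * b1' = 0) :
    B0 * A1' - B1 * A0' = (b0 * b1' - b1 * b0')
        * ((A1 * b0 + -(A0 * b1)) * (B1 * b0 + -(B0 * b1))
          + (A0 * b0 + A1 * b1) * (B0 * b0 + B1 * b1))
      + ((A1' * b0 + A1 * b0' + -(A0' * b1 + A0 * b1')) * (B0 * b0 + B1 * b1)
        - (A0' * b0 + A0 * b0' + (A1' * b1 + A1 * b1')) * (B1 * b0 + -(B0 * b1))) := by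
  have e0 : b0' = -(b0 * b1' - b1 * b0') * b1 := by
    linear_combination (-b0') * h1 + b0 * h2
  have e1 : b1' = (b0 * b1' - b1 * b0') * b0 := by
    linear_combination (-b1') * h1 + b1 * h2
  -- A unit field turns with the angular velocity `w`.
  generalize b0 * b1' - b1 * b0' = w at *
  subst e0 e1
  linear_combination (-(A1' * B0 - A0' * B1)) * h1

/-- The first derivatives of a regular function have traces in `H¹` of the boundary; their
tangential derivatives represent the boundary pairing. -/
theorem HasRegularGradient.exists_tangDeriv {w : Plane → ℝ} (hw : HasRegularGradient E w)
    (hE : IsOpen E) (hL : HasLipschitzBoundary E) (hb : Bornology.IsBounded E) (i : Fin 2) :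
    ∃ G, IsBoundaryH1 E (frontier E) (trace E (weakPartial E i w)) G ∧
      ∀ q Q, MemH1 E q Q →
        ∫ z in E, (weakPartial₂ E 1 i w z * Q 0 z - weakPartial₂ E 0 i w z * Q 1 z)
          = ∫ x in frontier E, trace E q x * G x ∂arcLength := by
  have hp := hw.memH1 i
  obtain ⟨G, hG, hGq⟩ := hp.exists_pairing (hw.hasBoundaryLimit i) hE hL hb
  have htr := hp.memLp_trace hE.measurableSet hL hb
  refine ⟨G, ⟨htr, hG, fun ψ hψ hψc _ => ?_⟩, hGq⟩
  have hi := IsBoundaryH1.integrable hL hb htr hG hψ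
  rw [integral_add hi.1 hi.2, hp.integral_trace_mul_tangent hE hL hb hG hGq hψ hψc,
    neg_add_cancel]

section

variable {β : Plane → Plane} {M : ℝ} (hE : IsOpen E) (hL : HasLipschitzBoundary E)
  (hb : Bornology.IsBounded E) (hΓ : IsC2Portion E Γ) (h1 : ∀ x ∈ Γ, ‖β x‖ = 1)
  (hβ : IsC1OnBoundary E Γ β) (hM : ∀ x ∈ Γ, ∀ i, |tangDeriv E (fun y => β y i) x| ≤ M)
include hE hL hb hΓ h1 hβ hM

omit hE h1 hβ hM in
theorem IsBoundaryH1.weakTangDeriv {f g : Plane → ℝ} (h : IsBoundaryH1 E Γ f g) :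
    MemLp f 2 (arcLength.restrict (frontier E)) ∧ HasWeakTangDeriv E Γ f (weakTangDeriv E Γ f) ∧
    MemLp (weakTangDeriv E Γ f) 2 (arcLength.restrict (frontier E)) ∧
    weakTangDeriv E Γ f =ᵐ[arcLength.restrict (frontier E)] g := by
  have h1 := h.hasWeakTangDeriv hL hb hΓ
  have h2 := h1.hasWeakTangDeriv_weakTangDeriv
  have h3 := h2.ae_eq hΓ h1
  exact ⟨h.memLp, h2, (memLp_congr_ae h3.symm).1 h.memLp_deriv, h3⟩

/-- The derivatives of a regular function in the directions `β` and `β^⊥` on the boundary. -/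
theorem HasRegularGradient.exists_frame_derivatives {w : Plane → ℝ}
    (hw : HasRegularGradient E w) :
    BoundaryDerivativesExist E Γ β w ∧ ∃ G : Fin 2 → Plane → ℝ,
      (∀ i, ∀ q Q, MemH1 E q Q →
        ∫ z in E, (weakPartial₂ E 1 i w z * Q 0 z - weakPartial₂ E 0 i w z * Q 1 z)
          = ∫ x in frontier E, trace E q x * G i x ∂arcLength) ∧
      (∀ i, MemLp (G i) 2 (arcLength.restrict (frontier E))) ∧
      (∀ᵐ x ∂arcLength.restrict (frontier E), weakTangDeriv E Γ (dirDeriv E β w) x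
        = G 0 x * β x 0 + trace E (weakPartial E 0 w) x * tangDeriv E (fun y => β y 0) x
          + (G 1 x * β x 1 + trace E (weakPartial E 1 w) x * tangDeriv E (fun y => β y 1) x)) ∧
      ∀ᵐ x ∂arcLength.restrict (frontier E),
        weakTangDeriv E Γ (dirDeriv E (fun y => perp (β y)) w) x
        = G 1 x * β x 0 + trace E (weakPartial E 1 w) x * tangDeriv E (fun y => β y 0) x
          + -(G 0 x * β x 1 + trace E (weakPartial E 0 w) x * tangDeriv E (fun y => β y 1) x) := by
  choose G hG hGq using fun i => hw.exists_tangDeriv hE hL hb i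
  have H : ∀ i j, IsBoundaryH1 E Γ (fun x => trace E (weakPartial E i w) x * β x j) (fun x =>
      G i x * β x j + trace E (weakPartial E i w) x * tangDeriv E (fun y => β y j) x) :=
    fun i j => (hG i).mul hL hb hΓ (hβ j).1 (hβ j).2 (C := 1) (M := M)
      (fun x hx => abs_apply_le_one (h1 x hx) j) (fun x hx => hM x hx j)
  have e1 : dirDeriv E β w = fun x => trace E (weakPartial E 0 w) x * β x 0
      + trace E (weakPartial E 1 w) x * β x 1 := by
    ext x; rw [dirDeriv_eq]; ring
  have e2 : dirDeriv E (fun y => perp (β y)) w = fun x => trace E (weakPartial E 1 w) x * β x 0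
      + -(trace E (weakPartial E 0 w) x * β x 1) := by
    ext x; rw [dirDeriv_eq]; simp [perp]; ring
  have r1 := ((H 0 0).add hL hb (H 1 1)).weakTangDeriv hL hb hΓ
  have r2 := ((H 1 0).add hL hb (H 0 1).neg).weakTangDeriv hL hb hΓ
  rw [← e1] at r1
  rw [← e2] at r2
  refine ⟨⟨fun i => (hw.memH1 i).ae_hasTraceAt hE.measurableSet hL, ?_⟩, G, hGq,
    fun i => (hG i).memLp_deriv, r1.2.2.2, r2.2.2.2⟩
  rintro b (rfl | rfl)
  · exact ⟨r1.1, r1.2.1, r1.2.2.1⟩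
  · exact ⟨r2.1, r2.2.1, r2.2.2.1⟩

/-- Both identities, for a boundary of which a part of full length is of class `C²`. -/
theorem hessian_identities {u v : Plane → ℝ} (hu : HasRegularGradient E u)
    (hv : HasRegularGradient E v) :
    (BoundaryDerivativesExist E Γ β u ∧ BoundaryDerivativesExist E Γ β v ∧
        IntegrableOn (mixedHessian E u v) E ∧
        IntegrableOn (hessianProduct E u v) E ∧
        IntegrableOn (fun x => weakLaplacian E u x * weakLaplacian E v x) E ∧
        IntegrableOn (fun x => rotationRate E β x * zeroOrderTerm E β u v x)
          (frontier E) arcLength ∧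
        IntegrableOn (firstOrderTerm E Γ β u v) (frontier E) arcLength) ∧
      (∫ x in E, mixedHessian E u v x) =
        (∫ x in frontier E, rotationRate E β x * zeroOrderTerm E β u v x ∂arcLength)
          + (∫ x in frontier E, firstOrderTerm E Γ β u v x ∂arcLength) ∧
      (∫ x in E, hessianProduct E u v x)
          + (∫ x in frontier E, rotationRate E β x * zeroOrderTerm E β u v x ∂arcLength)
          + (∫ x in frontier E, firstOrderTerm E Γ β u v x ∂arcLength) =
        (∫ x in E, weakLaplacian E u x * weakLaplacian E v x) := by
  obtain ⟨hBu, G, hGq, hGm, hG1, hG2⟩ :=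
    hu.exists_frame_derivatives hE hL hb hΓ h1 hβ hM
  obtain ⟨hBv, -⟩ := hv.exists_frame_derivatives hE hL hb hΓ h1 hβ hM
  have hΓm := hΓ.measurableSet
  -- the interior terms
  have hU : ∀ i j, MemLp (weakPartial₂ E i j u) 2 (volume.restrict E) := fun i j =>
    (hu.memH1 j).partial_memLp i
  have hV : ∀ i j, MemLp (weakPartial₂ E i j v) 2 (volume.restrict E) := fun i j =>
    (hv.memH1 j).partial_memLp i
  have hUV : ∀ i j k l, Integrable (fun x => weakPartial₂ E i j u x * weakPartial₂ E k l v x)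
      (volume.restrict E) := fun i j k l => (hU i j).integrable_mul (hV k l)
  have iM : Integrable (mixedHessian E u v) (volume.restrict E) :=
    ((hUV 0 0 1 1).add (hUV 1 1 0 0)).sub ((hUV 0 1 0 1).const_mul 2)
  have iH : Integrable (hessianProduct E u v) (volume.restrict E) :=
    integrable_finsetSum _ fun i _ => integrable_finsetSum _ fun j _ => hUV i j i j
  have iL : Integrable (fun x => weakLaplacian E u x * weakLaplacian E v x)
      (volume.restrict E) :=
    MemLp.integrable_mul (memLp_finsetSum _ fun i _ => hU i i)
      (memLp_finsetSum _ fun i _ => hV i i)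
  -- the boundary terms
  have hperp : (fun x => perp (β x)) ∈ ({β, fun x => perp (β x)} : Set (Plane → Plane)) :=
    Or.inr rfl
  have hself : β ∈ ({β, fun x => perp (β x)} : Set (Plane → Plane)) := Or.inl rfl
  have du1 := hBu.2 _ hself
  have du2 := hBu.2 _ hperp
  have dv1 := hBv.2 _ hself
  have dv2 := hBv.2 _ hperp
  have hrotm : AEStronglyMeasurable (rotationRate E β) (arcLength.restrict (frontier E)) := by
    rw [← hΓ.restrict_eq]
    have hc : ∀ i, ContinuousOn (fun y => β y i) Γ := fun i x hx =>
      ((hβ i).1 x hx).continuousWithinAt.mono hΓ.subset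
    exact (((hc 0).mul (hβ 1).2).sub ((hc 1).mul (hβ 0).2)).aestronglyMeasurable hΓm
  have hrotb : ∀ᵐ x ∂arcLength.restrict (frontier E), |rotationRate E β x| ≤ M + M := by
    rw [← hΓ.restrict_eq]
    filter_upwards [ae_restrict_mem hΓm] with x hx
    refine (abs_sub _ _).trans (add_le_add ?_ ?_)
    · rw [abs_mul, ← one_mul M]
      exact mul_le_mul (abs_apply_le_one (h1 x hx) 0) (hM x hx 1) (abs_nonneg _) zero_le_one
    · rw [abs_mul, ← one_mul M]
      exact mul_le_mul (abs_apply_le_one (h1 x hx) 1) (hM x hx 0) (abs_nonneg _) zero_le_one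
  have iZ : Integrable (fun x => rotationRate E β x * zeroOrderTerm E β u v x)
      (arcLength.restrict (frontier E)) := by
    have j1 := (memLp_mul_of_bound du2.1 hrotm hrotb).integrable_mul dv2.1
    have j2 := (memLp_mul_of_bound du1.1 hrotm hrotb).integrable_mul dv1.1
    refine (j1.add j2).congr (ae_of_all _ fun x => ?_)
    simp only [Pi.add_apply, Pi.mul_apply, zeroOrderTerm]; ring
  have iF : Integrable (firstOrderTerm E Γ β u v) (arcLength.restrict (frontier E)) :=
    (du2.2.2.integrable_mul dv1.1).sub (du1.2.2.integrable_mul dv2.1)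
  -- the first identity
  have hv0 := hv.memH1 0
  have hv1 := hv.memH1 1
  have htr0 := hv0.memLp_trace hE.measurableSet hL hb
  have htr1 := hv1.memLp_trace hE.measurableSet hL hb
  have id1 : (∫ x in E, mixedHessian E u v x) =
      (∫ x in frontier E, rotationRate E β x * zeroOrderTerm E β u v x ∂arcLength)
          + (∫ x in frontier E, firstOrderTerm E Γ β u v x ∂arcLength) := by
    -- By symmetry of the second derivatives, the integrand is the pairing of `∇D₁u` with `∇D₀v`
    -- minus the pairing of `∇D₀u` with `∇D₁v`.
    have hl : ∫ x in E, mixedHessian E u v x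
        = (∫ x in frontier E, trace E (weakPartial E 0 v) x * G 1 x ∂arcLength)
          - ∫ x in frontier E, trace E (weakPartial E 1 v) x * G 0 x ∂arcLength := by
      have hs := integral_sub ((hUV 1 1 0 0).sub (hUV 0 1 1 0)) ((hUV 1 0 0 1).sub (hUV 0 0 1 1))
      simp only [Pi.sub_apply] at hs
      rw [← hGq 1 _ _ hv0, ← hGq 0 _ _ hv1, ← hs]
      refine integral_congr_ae ?_
      filter_upwards [hu.symm, hv.symm] with x hx1 hx2
      simp only [mixedHessian]
      rw [hx1, hx2]; ring
    have k0 : Integrable (fun x => trace E (weakPartial E 0 v) x * G 1 x)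
        (arcLength.restrict (frontier E)) := htr0.integrable_mul (hGm 1)
    have k1 : Integrable (fun x => trace E (weakPartial E 1 v) x * G 0 x)
        (arcLength.restrict (frontier E)) := htr1.integrable_mul (hGm 0)
    rw [hl, ← integral_sub k0 k1, ← integral_add iZ iF]
    refine integral_congr_ae ?_
    have hmem : ∀ᵐ x ∂arcLength.restrict (frontier E), x ∈ Γ := by
      rw [← hΓ.restrict_eq]; exact ae_restrict_mem hΓm
    filter_upwards [hG1, hG2, hmem] with x hx1 hx2 hxΓ
    have := moving_frame_identity (A0 := trace E (weakPartial E 0 u) x)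
      (A1 := trace E (weakPartial E 1 u) x) (A0' := G 0 x) (A1' := G 1 x)
      (B0 := trace E (weakPartial E 0 v) x) (B1 := trace E (weakPartial E 1 v) x)
      (sq_add_sq_eq_one (h1 x hxΓ)) (hΓ.sum_mul_tangDeriv h1 (fun i => (hβ i).1) hxΓ)
    simp only [firstOrderTerm, zeroOrderTerm, rotationRate, hx1, hx2, dirDeriv_eq]
    refine this.trans ?_
    simp only [perp, PiLp.toLp_apply, Matrix.cons_val_zero, Matrix.cons_val_one]
    ring
  refine ⟨⟨hBu, hBv, iM, iH, iL, iZ, iF⟩, id1, ?_⟩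
  -- `D²u : D²v` and the mixed term add up to `Δu Δv`.
  rw [add_assoc, ← id1, ← integral_add iH iM]
  refine integral_congr_ae ?_
  filter_upwards [hu.symm, hv.symm] with x hx1 hx2
  simp only [mixedHessian, hessianProduct, weakLaplacian, Fin.sum_univ_two]
  rw [hx1, hx2]; ring

end

/-! ### The rotation rate, the oblique angle and the mean curvature -/

theorem IsPiecewiseC2.isC2Portion {N : ℕ} {Γ : Fin N → Set Plane} (h : IsPiecewiseC2 E Γ) :
    IsC2Portion E (⋃ n, Γ n) := by
  refine ⟨?_, fun x hx => ?_, h.exceptional⟩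
  · rw [h.frontier_eq]
    exact iUnion_mono fun n => subset_closure
  · obtain ⟨n, hn⟩ := mem_iUnion.1 hx
    obtain ⟨c, φ, K, a, d, hc, hxb, hs⟩ := (h.graph n x hn).exists_isC2Chart hn
    exact ⟨c, φ, K, a, d, hc, hxb, fun z hz => mem_iUnion.2 ⟨n, (hs z hz.2).2 hz.1⟩⟩

theorem HasC2Boundary.isC2Portion (h : HasC2Boundary E) : IsC2Portion E (frontier E) := by
  refine ⟨Subset.rfl, fun x hx => ?_, by simp⟩
  obtain ⟨c, φ, K, a, d, hc, hxb, -⟩ := (h x hx).exists_isC2Chart hx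
  exact ⟨c, φ, K, a, d, hc, hxb, inter_subset_left⟩

theorem IsC2Portion.isOutwardNormal (hΓ : IsC2Portion E Γ) {x : Plane} (hx : x ∈ Γ) :
    IsOutwardNormal E x (outwardNormal E x) := by
  obtain ⟨c, φ, K, a, d, h, hxb, -⟩ := hΓ.chart x hx
  obtain ⟨t, ht, rfl⟩ := h.exists_graphCurve ⟨hΓ.subset hx, hxb⟩
  have := h.isOutwardNormal_graphCurve ht
  rwa [this.outwardNormal_eq]

/-- The outward normal is differentiable along a boundary portion of class `C²`. -/
theorem IsC2Portion.differentiableWithinAt_outwardNormal (hΓ : IsC2Portion E Γ) {x : Plane}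
    (hx : x ∈ Γ) (i : Fin 2) :
    DifferentiableWithinAt ℝ (fun y => outwardNormal E y i) (frontier E) x := by
  obtain ⟨c, φ, K, a, d, h, hxb, -⟩ := hΓ.chart x hx
  set g : ℝ → ℝ := fun m => (√(1 + m ^ 2))⁻¹ * (upVec c i - m * horVec c i)
  have hg : Differentiable ℝ g := by
    intro m
    have h0 : (1 + m ^ 2) ≠ 0 := by positivity
    have h1 : √(1 + m ^ 2) ≠ 0 := (Real.sqrt_pos.2 (by positivity)).ne'
    have h2 : DifferentiableAt ℝ (fun m : ℝ => √(1 + m ^ 2)) m :=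
      (by fun_prop : DifferentiableAt ℝ (fun m : ℝ => 1 + m ^ 2) m).sqrt h0
    exact (h2.inv h1).mul (by fun_prop)
  have heq : ∀ y ∈ frontier E ∩ chartBox c φ a d,
      outwardNormal E y i = g (deriv φ (c y 0)) := by
    intro y hy
    obtain ⟨t, ht, rfl⟩ := h.exists_graphCurve hy
    rw [(h.isOutwardNormal_graphCurve ht).outwardNormal_eq, coord_graphCurve_zero, slopeNormal]
    simp [g]
  have hd1 : DifferentiableAt ℝ (deriv φ) (c x 0) :=
    (h.contDiffOn_deriv.differentiableOn (by simp)).differentiableAt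
      (isOpen_Ioo.mem_nhds (abs_lt.1 hxb.1))
  have hd2 : DifferentiableAt ℝ (fun z : Plane => c z 0) x :=
    (contDiff_coord (n := 1) 0).differentiable (by simp) x
  have hd : DifferentiableAt ℝ (fun y : Plane => g (deriv φ (c y 0))) x :=
    (hg _).comp x (DifferentiableAt.comp (f := fun z : Plane => c z 0) x hd1 hd2)
  refine hd.differentiableWithinAt.congr_of_eventuallyEq ?_ (heq x ⟨hΓ.subset hx, hxb⟩)
  filter_upwards [self_mem_nhdsWithin, nhdsWithin_le_nhds (h.isOpen_chartBox.mem_nhds hxb)]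
    with y hy1 hy2
  exact heq y ⟨hy1, hy2⟩

/-- The cosine of the angle between `β` and the outward normal. -/
def angleCos (E : Set Plane) (β : Plane → Plane) (y : Plane) : ℝ :=
  β y 0 * outwardNormal E y 0 + β y 1 * outwardNormal E y 1

/-- The sine of the angle from the outward normal to `β`. -/
def angleSin (E : Set Plane) (β : Plane → Plane) (y : Plane) : ℝ :=
  β y 1 * outwardNormal E y 0 - β y 0 * outwardNormal E y 1

/-- If the angle between the values of the oblique angle at `x` and at `y` is at most a right angle,
the branch is the arcsine of the sine of the difference. -/
theorem angleBranch_eq_arcsin {β : Plane → Plane} {x y : Plane}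
    (hx : angleCos E β x ^ 2 + angleSin E β x ^ 2 = 1)
    (hy : angleCos E β y ^ 2 + angleSin E β y ^ 2 = 1)
    (hpos : 0 ≤ angleCos E β y * angleCos E β x + angleSin E β y * angleSin E β x) :
    angleBranch E β x y
      = Real.arcsin (angleSin E β y * angleCos E β x - angleCos E β y * angleSin E β x) := by
  have hob : ∀ y, obliqueAngle E β y
      = ((Complex.arg ⟨angleCos E β y, angleSin E β y⟩ : ℝ) : Real.Angle) := by
    intro y
    have e1 : inner ℝ (β y) (outwardNormal E y) = angleCos E β y := inner_eq _ _
    have e2 : inner ℝ (β y) (unitTangent E y) = angleSin E β y := by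
      rw [inner_eq, unitTangent, perp]; simp [angleSin]; ring
    rw [obliqueAngle, e1, e2]
  have hne : ∀ {y}, angleCos E β y ^ 2 + angleSin E β y ^ 2 = 1 →
      (⟨angleCos E β y, angleSin E β y⟩ : ℂ) ≠ 0 := by
    intro y hy h0
    have h1 := congrArg Complex.re h0
    have h2 := congrArg Complex.im h0
    simp only [Complex.zero_re, Complex.zero_im] at h1 h2
    rw [h1, h2] at hy; norm_num at hy
  have hcx : (starRingEnd ℂ) (⟨angleCos E β x, angleSin E β x⟩ : ℂ) ≠ 0 := by
    rw [Ne, map_eq_zero]; exact hne hx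
  set ζ : ℂ := ⟨angleCos E β y, angleSin E β y⟩ * (starRingEnd ℂ) ⟨angleCos E β x, angleSin E β x⟩
    with hζ
  have hre : ζ.re = angleCos E β y * angleCos E β x + angleSin E β y * angleSin E β x := by
    simp [hζ, Complex.mul_re]
  have him : ζ.im = angleSin E β y * angleCos E β x - angleCos E β y * angleSin E β x := by
    simp [hζ, Complex.mul_im]; ring
  have hnorm : ‖ζ‖ = 1 := by
    rw [Complex.norm_def, Complex.normSq_apply, hre, him, Real.sqrt_eq_one]
    linear_combination (angleCos E β x ^ 2 + angleSin E β x ^ 2) * hy + hx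
  have harg : obliqueAngle E β y - obliqueAngle E β x = ((Complex.arg ζ : ℝ) : Real.Angle) := by
    rw [hζ, Complex.arg_mul_coe_angle (hne hy) hcx, Complex.arg_conj_coe_angle, hob, hob,
      sub_eq_add_neg]
  rw [angleBranch, harg, Complex.arg_coe_angle_toReal_eq_arg,
    Complex.arg_of_re_nonneg (by rw [hre]; exact hpos), hnorm, div_one, him]

/-- Along a boundary portion of class `C²`, the oblique angle is differentiable and its tangential
derivative is the difference of the rotation rate of `β` and the mean curvature. -/
theorem IsC2Portion.rotationRate_eq (hΓ : IsC2Portion E Γ) {β : Plane → Plane}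
    (h1 : ∀ x ∈ Γ, ‖β x‖ = 1)
    (hd : ∀ i, ∀ x ∈ Γ, DifferentiableWithinAt ℝ (fun y => β y i) (frontier E) x) {x : Plane}
    (hx : x ∈ Γ) : DifferentiableWithinAt ℝ (angleBranch E β x) (frontier E) x ∧
      rotationRate E β x = angleTangDeriv E β x + meanCurvature E x := by
  obtain ⟨c, φ, K, a, d, h, hxb, hs⟩ := hΓ.chart x hx
  have hβd := fun i => hd i x hx
  have hnd := fun i => hΓ.differentiableWithinAt_outwardNormal hx i
  have hn1 : ∀ y ∈ Γ, outwardNormal E y 0 ^ 2 + outwardNormal E y 1 ^ 2 = 1 := fun y hy =>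
    sq_add_sq_eq_one (hΓ.isOutwardNormal hy).1
  have hunit : ∀ y ∈ Γ, angleCos E β y ^ 2 + angleSin E β y ^ 2 = 1 := by
    intro y hy
    rw [angleCos, angleSin]
    linear_combination (β y 0 ^ 2 + β y 1 ^ 2) * hn1 y hy + sq_add_sq_eq_one (h1 y hy)
  have hcd : DifferentiableWithinAt ℝ (angleCos E β) (frontier E) x :=
    ((hβd 0).mul (hnd 0)).add ((hβd 1).mul (hnd 1))
  have hsd : DifferentiableWithinAt ℝ (angleSin E β) (frontier E) x :=
    ((hβd 1).mul (hnd 0)).sub ((hβd 0).mul (hnd 1))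
  set S : Plane → ℝ := fun y =>
    angleSin E β y * angleCos E β x - angleCos E β y * angleSin E β x with hS
  have hSd : DifferentiableWithinAt ℝ S (frontier E) x :=
    (hsd.mul_const _).sub (hcd.mul_const _)
  have hSx : S x = 0 := by simp only [hS]; ring
  -- near `x` the branch is the arcsine of `S`
  have hbr : angleBranch E β x =ᶠ[𝓝[frontier E] x] fun y => Real.arcsin (S y) := by
    have hpos : ∀ᶠ y in 𝓝[frontier E] x,
        0 < angleCos E β y * angleCos E β x + angleSin E β y * angleSin E β x := by
      have ht : Tendsto (fun y => angleCos E β y * angleCos E β x + angleSin E β y * angleSin E β x)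
          (𝓝[frontier E] x) (𝓝 (angleCos E β x * angleCos E β x + angleSin E β x * angleSin E β x)) :=
        (hcd.continuousWithinAt.mul_const _).add (hsd.continuousWithinAt.mul_const _)
      refine ht.eventually (lt_mem_nhds ?_)
      have := hunit x hx
      nlinarith
    filter_upwards [hpos, self_mem_nhdsWithin,
      nhdsWithin_le_nhds (h.isOpen_chartBox.mem_nhds hxb)] with y hy hyF hyb
    exact angleBranch_eq_arcsin (hunit x hx) (hunit y (hs ⟨hyF, hyb⟩)) hy.le
  have hbrx : angleBranch E β x x = Real.arcsin (S x) :=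
    hbr.eq_of_nhdsWithin (hΓ.subset hx)
  have harc : HasDerivAt Real.arcsin 1 (S x) := by
    rw [hSx]
    have := Real.hasDerivAt_arcsin (x := 0) (by norm_num) (by norm_num)
    simpa using this
  have hdb : DifferentiableWithinAt ℝ (angleBranch E β x) (frontier E) x :=
    (harc.differentiableAt.comp_differentiableWithinAt x hSd).congr_of_eventuallyEq hbr hbrx
  refine ⟨hdb, ?_⟩
  -- compute the derivative along the boundary curve
  obtain ⟨t, ht, rfl⟩ := h.exists_graphCurve ⟨hΓ.subset hx, hxb⟩
  obtain ⟨κ, -, hκ0, hκ⟩ := h.exists_velocity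
  have B := fun i => h.hasDerivAt_comp ht (hκ t ht) (hβd i)
  have Nn := fun i => h.hasDerivAt_comp ht (hκ t ht) (hnd i)
  have hC' := ((B 0).mul (Nn 0)).add ((B 1).mul (Nn 1))
  have hS' := ((B 1).mul (Nn 0)).sub ((B 0).mul (Nn 1))
  have hcomp := (hS'.mul_const (angleCos E β (graphCurve c φ t))).sub
    (hC'.mul_const (angleSin E β (graphCurve c φ t)))
  have hang := h.hasDerivAt_comp ht (hκ t ht) hdb
  have hin : Tendsto (graphCurve c φ) (𝓝 t) (𝓝[frontier E] graphCurve c φ t) :=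
    tendsto_nhdsWithin_iff.2 ⟨(continuous_graphCurve h.continuous).tendsto t, by
      filter_upwards [isOpen_Ioo.mem_nhds ht] with s hs' using (h.graphCurve_mem hs').1⟩
  have hang2 := (harc.comp t (h := fun s => S (graphCurve c φ s)) hcomp).congr_of_eventuallyEq
    (hin.eventually hbr)
  have hu := hang.unique hang2
  have hβx := sq_add_sq_eq_one (h1 _ hx)
  have hnx := hn1 _ hx
  rw [meanCurvature, Fin.sum_univ_two]
  simp only [tangGrad, PiLp.smul_apply, smul_eq_mul, unitTangent, perp, Matrix.cons_val_zero,
    Matrix.cons_val_one]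
  refine mul_left_cancel₀ (hκ0 t) ?_
  rw [angleTangDeriv, mul_add, hu, rotationRate, angleCos, angleSin]
  set b0 := tangDeriv E (fun y => β y 0) (graphCurve c φ t)
  set b1 := tangDeriv E (fun y => β y 1) (graphCurve c φ t)
  set m0 := tangDeriv E (fun y => outwardNormal E y 0) (graphCurve c φ t)
  set m1 := tangDeriv E (fun y => outwardNormal E y 1) (graphCurve c φ t)
  linear_combination (-(κ t * (β (graphCurve c φ t) 0 * b1 - β (graphCurve c φ t) 1 * b0))) * hnx
    + κ t * (outwardNormal E (graphCurve c φ t) 0 * m1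
      - outwardNormal E (graphCurve c φ t) 1 * m0) * hβx

end

section

open scoped ENNReal

variable {E : Set Plane}

/-- Continuous differentiability on each of the portions, which are relatively open in the
boundary, gives continuous differentiability on their union. -/
theorem IsPiecewiseC2.isC1OnBoundary_iUnion {N : ℕ} {Γ : Fin N → Set Plane}
    (h : IsPiecewiseC2 E Γ) {β : Plane → Plane} (hβ : ∀ n, IsC1OnBoundary E (Γ n) β) :
    IsC1OnBoundary E (⋃ n, Γ n) β := by
  refine fun i => ⟨fun x hx => ?_, fun x hx => ?_⟩
  · obtain ⟨n, hn⟩ := mem_iUnion.1 hx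
    exact (hβ n i).1 x hn
  · obtain ⟨n, hn⟩ := mem_iUnion.1 hx
    obtain ⟨c, φ, K, a, d, hc, hxb, hs⟩ := (h.graph n x hn).exists_isC2Chart hn
    refine ((hβ n i).2 x hn).mono_of_mem_nhdsWithin ?_
    filter_upwards [self_mem_nhdsWithin, nhdsWithin_le_nhds (hc.isOpen_chartBox.mem_nhds hxb)]
      with y hy1 hy2
    exact (hs y hy2).2 (h.isC2Portion.subset hy1)

end

end

theorem mainTheorem3 :
    (∀ (E : Set Plane) (N : ℕ) (Γ : Fin N → Set Plane) (β : Plane → Plane) (s : ℝ)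
        (u v : Plane → ℝ),
      IsOpen E → Bornology.IsBounded E → HasLipschitzBoundary E → IsPiecewiseC2 E Γ →
      (∀ n, ∀ x ∈ Γ n, ‖β x‖ = 1) → (∀ n, IsC1OnBoundary E (Γ n) β) →
      (∀ n, ∃ M : ℝ, ∀ x ∈ Γ n, ∀ i, |tangDeriv E (fun y => β y i) x| ≤ M) →
      5 / 2 < s → MemHs E s u → MemHs E s v →
      -- all terms are meaningful
      (BoundaryDerivativesExist E (⋃ n, Γ n) β u ∧ BoundaryDerivativesExist E (⋃ n, Γ n) β v ∧
        IntegrableOn (mixedHessian E u v) E ∧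
        IntegrableOn (hessianProduct E u v) E ∧
        IntegrableOn (fun x => weakLaplacian E u x * weakLaplacian E v x) E ∧
        (∀ n, ∀ x ∈ Γ n, IsOutwardNormal E x (outwardNormal E x)) ∧
        IntegrableOn (fun x => rotationRate E β x * zeroOrderTerm E β u v x)
          (frontier E) arcLength ∧
        IntegrableOn (firstOrderTerm E (⋃ n, Γ n) β u v) (frontier E) arcLength) ∧
      -- the first identity
      (∫ x in E, mixedHessian E u v x) =
        (∫ x in frontier E, rotationRate E β x * zeroOrderTerm E β u v x ∂arcLength)
          + (∫ x in frontier E, firstOrderTerm E (⋃ n, Γ n) β u v x ∂arcLength) ∧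
      -- the second identity
      (∫ x in E, hessianProduct E u v x)
          + (∫ x in frontier E, rotationRate E β x * zeroOrderTerm E β u v x ∂arcLength)
          + (∫ x in frontier E, firstOrderTerm E (⋃ n, Γ n) β u v x ∂arcLength) =
        (∫ x in E, weakLaplacian E u x * weakLaplacian E v x)) ∧
    (∀ (Ω : Set Plane) (β : Plane → Plane) (s : ℝ) (u v : Plane → ℝ),
      IsOpen Ω → Bornology.IsBounded Ω → HasC2Boundary Ω →
      (∀ x ∈ frontier Ω, ‖β x‖ = 1) → IsC1OnBoundary Ω (frontier Ω) β →
      5 / 2 < s → MemHs Ω s u → MemHs Ω s v →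
      -- all terms are meaningful
      (BoundaryDerivativesExist Ω (frontier Ω) β u ∧ BoundaryDerivativesExist Ω (frontier Ω) β v ∧
        IntegrableOn (mixedHessian Ω u v) Ω ∧
        IntegrableOn (hessianProduct Ω u v) Ω ∧
        IntegrableOn (fun x => weakLaplacian Ω u x * weakLaplacian Ω v x) Ω ∧
        (∀ x ∈ frontier Ω, IsOutwardNormal Ω x (outwardNormal Ω x) ∧
          (∀ i, DifferentiableWithinAt ℝ (fun y => outwardNormal Ω y i) (frontier Ω) x) ∧
          DifferentiableWithinAt ℝ (angleBranch Ω β x) (frontier Ω) x) ∧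
        IntegrableOn (fun x => (angleTangDeriv Ω β x + meanCurvature Ω x)
          * zeroOrderTerm Ω β u v x) (frontier Ω) arcLength ∧
        IntegrableOn (firstOrderTerm Ω (frontier Ω) β u v) (frontier Ω) arcLength) ∧
      -- the coefficient
      (∀ x ∈ frontier Ω, rotationRate Ω β x = angleTangDeriv Ω β x + meanCurvature Ω x) ∧
      -- the first identity
      (∫ x in Ω, mixedHessian Ω u v x) =
        (∫ x in frontier Ω, (angleTangDeriv Ω β x + meanCurvature Ω x)
            * zeroOrderTerm Ω β u v x ∂arcLength)
          + (∫ x in frontier Ω, firstOrderTerm Ω (frontier Ω) β u v x ∂arcLength) ∧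
      -- the second identity
      (∫ x in Ω, hessianProduct Ω u v x)
          + (∫ x in frontier Ω, (angleTangDeriv Ω β x + meanCurvature Ω x)
            * zeroOrderTerm Ω β u v x ∂arcLength)
          + (∫ x in frontier Ω, firstOrderTerm Ω (frontier Ω) β u v x ∂arcLength) =
        (∫ x in Ω, weakLaplacian Ω u x * weakLaplacian Ω v x)) := by
  constructor
  · intro E N Γ β s u v hE hb hL hpw hβ1 hβ hM hs hu hv
    have hΓ := hpw.isC2Portion
    have h1 : ∀ x ∈ ⋃ n, Γ n, ‖β x‖ = 1 := fun x hx => by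
      obtain ⟨n, hn⟩ := mem_iUnion.1 hx
      exact hβ1 n x hn
    choose M hM using hM
    have hMs : ∀ x ∈ ⋃ n, Γ n, ∀ i, |tangDeriv E (fun y => β y i) x| ≤ ∑ n, |M n| := by
      intro x hx i
      obtain ⟨n, hn⟩ := mem_iUnion.1 hx
      exact ((hM n x hn i).trans (le_abs_self _)).trans
        (Finset.single_le_sum (f := fun n => |M n|) (fun _ _ => abs_nonneg _) (Finset.mem_univ n))
    obtain ⟨⟨k1, k2, k3, k4, k5, k6, k7⟩, k8, k9⟩ := hessian_identities hE hL hb hΓ h1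
      (hpw.isC1OnBoundary_iUnion hβ) hMs (hu.hasRegularGradient hE hs) (hv.hasRegularGradient hE hs)
    exact ⟨⟨k1, k2, k3, k4, k5, fun n x hx => hΓ.isOutwardNormal (mem_iUnion.2 ⟨n, hx⟩), k6, k7⟩,
      k8, k9⟩
  · intro E β s u v hE hb hC2 hβ1 hβ hs hu hv
    have hL := hC2.hasLipschitzBoundary
    have hΓ := hC2.isC2Portion
    have hc : IsCompact (frontier E) := hb.isCompact_closure.of_isClosed_subset isClosed_frontier
      frontier_subset_closure
    -- on the compact boundary the tangential derivative of `β` is bounded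
    have hMs : ∃ M, ∀ x ∈ frontier E, ∀ i, |tangDeriv E (fun y => β y i) x| ≤ M := by
      choose M hM using fun i => hc.exists_bound_of_continuousOn (hβ i).2
      refine ⟨∑ i, |M i|, fun x hx i => ?_⟩
      exact ((hM i x hx).trans (le_abs_self _)).trans
        (Finset.single_le_sum (f := fun n => |M n|) (fun _ _ => abs_nonneg _) (Finset.mem_univ i))
    obtain ⟨M, hM⟩ := hMs
    obtain ⟨⟨k1, k2, k3, k4, k5, k6, k7⟩, k8, k9⟩ := hessian_identities hE hL hb hΓ hβ1 hβ hM
      (hu.hasRegularGradient hE hs) (hv.hasRegularGradient hE hs)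
    have hrot := fun x hx => hΓ.rotationRate_eq hβ1 (fun i => (hβ i).1) (x := x) hx
    have hcongr : EqOn (fun x => rotationRate E β x * zeroOrderTerm E β u v x)
        (fun x => (angleTangDeriv E β x + meanCurvature E x) * zeroOrderTerm E β u v x)
        (frontier E) := fun x hx => by
      dsimp only
      rw [(hrot x hx).2]
    rw [setIntegral_congr_fun isClosed_frontier.measurableSet hcongr] at k8 k9
    exact ⟨⟨k1, k2, k3, k4, k5, fun x hx => ⟨hΓ.isOutwardNormal hx,
      hΓ.differentiableWithinAt_outwardNormal hx, (hrot x hx).1⟩,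
      (integrableOn_congr_fun hcongr isClosed_frontier.measurableSet).1 k6, k7⟩,
      fun x hx => (hrot x hx).2, k8, k9⟩
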